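/- **Theorem 2.8.** Let $\mathbb X\subseteq\mathbb R$ be an unbounded Borel set and let $\Xi=(\xi_n)_{n\ge 0}$ be a time-homogeneous Markov chain on $\mathbb X$. Write $\mathbb P_x,\mathbb E_x$ for its law and expectation when $\xi_0=x$, let $\theta=\xi_1-\xi_0$, $\theta_+=\max(\theta,0)$, $\theta_-=\max(-\theta,0)$, $\mu(x)=\mathbb E_x[\theta]$, and for $a\ge 0$ let $\tau_a=\min\{n\ge 0:|\xi_n|\le a\}$ (with $\tau_a=\infty$ if there is no such $n$). Suppose that, for some constants $\alpha\in(1,2)$, $c>0$, $x_0\ge 0$, $\gamma\ge 0$ and $b\in\mathbb R$, the following two conditions hold. * Balanced tails: $$\lim_{y\to\infty}\sup_{x\in\mathbb X,\ x\ge x_0}\bigl|y^\alpha\,\mathbb P_x[\theta_\pm>y]-c\bigr|=0 \quad\text{and}\quad \lim_{y\to\infty}\sup_{x\in\mathbb X,\ x\le -x_0}\bigl|y^\alpha\,\mathbb P_x[\theta_\pm>y]-c\bigr|=0,$$ each for both choices of the sign $\pm$. * Asymptotic drift: $$\lim_{x\to+\infty}x^\gamma\mu(x)=\lim_{x\to-\infty}\bigl(-|x|^\gamma\mu(x)\bigr)=b\qquad(x\in\mathbb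 X).$$ Let $q>0$. Then for all $a$ sufficiently large and all $x\in\mathbb X$ with $|x|>a$, the following hold. 1. If $\gamma>\alpha-1$, then $\mathbb E_x[\tau_a^q]<\infty$ for $q<1-\frac1\alpha$, and $\mathbb E_x[\tau_a^q]=\infty$ for $q>1-\frac1\alpha$. 2. If $\gamma=\alpha-1$ and $b+c\pi\cot\left(\frac{\pi\alpha}{2}\right)<0$, then the equation $$\frac bc=(\nu-1)\frac{\Gamma(1-\alpha)\Gamma(\alpha-\nu)}{\Gamma(2-\nu)}+\Gamma(\nu)\left(\frac{(1-\alpha+\nu)\Gamma(1-\alpha)}{\Gamma(2-\alpha+\nu)}-\frac{\Gamma(\alpha-\nu)}{\Gamma(\alpha)}\right)$$ has a unique solution $\nu=\nu^\star$ in $(0,\alpha)$, and $\mathbb E_x[\tau_a^q]<\infty$ for $q<\nu^\star/\alpha$, while $\mathbb E_x[\tau_a^q]=\infty$ for $q>\nu^\star/\alpha$. 3. If $\gamma<\alpha-1$ and $b<0$, then $\mathbb E_x[\tau_a^q]<\infty$ for $q<\frac{\alpha}{\gamma+1}$, and $\mathbb E_x[\tau_a^q]=\infty$ for $q\ge\frac{\alpha}{\gamma+1}$.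 -/

import Mathlib

open Set Filter Topology MeasureTheory ProbabilityTheory
open scoped ENNReal

noncomputable section

namespace HeavyTailWalk

variable {X : Set ℝ}

/-- The path law `ℙ_x` on `X^ℕ` of the time-homogeneous Markov chain with one-step kernel `P`
started at `ξ₀ = x`, obtained from the Ionescu-Tulcea theorem: given the path up to time `n`,
the next state has law `P ξₙ`. -/
def pathLaw (P : Kernel X X) [IsMarkovKernel P] (x : X) : Measure (ℕ → X) :=
  Kernel.traj (X := fun _ : ℕ => X)
    (fun n => P.comap (fun h : (i : Finset.Iic n) → X => h ⟨n, Finset.mem_Iic.2 le_rfl⟩)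
      (measurable_pi_apply _)) 0 (fun _ => x)

/-- The passage time `τ_a = min {n ≥ 0 : |ξₙ| ≤ a}` of a path, equal to `∞` if there is
no such `n`. -/
def passageTime (a : ℝ) (ξ : ℕ → X) : ℝ≥0∞ :=
  ⨅ (n : ℕ) (_ : |(ξ n : ℝ)| ≤ a), (n : ℝ≥0∞)

/-- The moment `𝔼_x[τ_a ^ q]`, with values in `[0, ∞]`. -/
def passageMoment (P : Kernel X X) [IsMarkovKernel P] (q a : ℝ) (x : X) : ℝ≥0∞ :=
  ∫⁻ ξ, passageTime a ξ ^ q ∂(pathLaw P x)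

/-- `ℙ_x[θ₊ > y]`, where `θ = ξ₁ - ξ₀`. -/
def rightTail (P : Kernel X X) (x : X) (y : ℝ) : ℝ :=
  (P x).real {z : X | y < ((z : ℝ) - (x : ℝ))⁺}

/-- `ℙ_x[θ₋ > y]`, where `θ = ξ₁ - ξ₀`. -/
def leftTail (P : Kernel X X) (x : X) (y : ℝ) : ℝ :=
  (P x).real {z : X | y < ((z : ℝ) - (x : ℝ))⁻}

/-- The one-step mean drift `μ(x) = 𝔼_x[θ]`. Only its behaviour as `|x| → ∞` is ever used, and
there the balanced tail condition (with exponent `α > 1`) makes `θ` integrable. -/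
def drift (P : Kernel X X) (x : X) : ℝ :=
  ∫ z : X, ((z : ℝ) - (x : ℝ)) ∂(P x)

/-- Balanced tails with exponent `α` and constant `c`: as `y → ∞`, `y^α ℙ_x[θ₊ > y]` and
`y^α ℙ_x[θ₋ > y]` converge to `c`, uniformly over `x ≥ x₀` and uniformly over `x ≤ -x₀`. -/
def BalancedTails (P : Kernel X X) (α c : ℝ) : Prop :=
  ∃ x₀ : ℝ, 0 ≤ x₀ ∧
    TendstoUniformlyOn (fun (y : ℝ) (x : X) => y ^ α * rightTail P x y) (fun _ => c) atTop
      {x : X | x₀ ≤ (x : ℝ)} ∧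
    TendstoUniformlyOn (fun (y : ℝ) (x : X) => y ^ α * leftTail P x y) (fun _ => c) atTop
      {x : X | x₀ ≤ (x : ℝ)} ∧
    TendstoUniformlyOn (fun (y : ℝ) (x : X) => y ^ α * rightTail P x y) (fun _ => c) atTop
      {x : X | (x : ℝ) ≤ -x₀} ∧
    TendstoUniformlyOn (fun (y : ℝ) (x : X) => y ^ α * leftTail P x y) (fun _ => c) atTop
      {x : X | (x : ℝ) ≤ -x₀}

/-- Asymptotic drift: `x^γ μ(x) → b` as `x → +∞` in `X`, and `-|x|^γ μ(x) → b` as `x → -∞`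
in `X`. -/
def AsymptoticDrift (P : Kernel X X) (γ b : ℝ) : Prop :=
  Tendsto (fun x : X => (x : ℝ) ^ γ * drift P x) (comap (fun x : X => (x : ℝ)) atTop) (𝓝 b) ∧
  Tendsto (fun x : X => -(|(x : ℝ)| ^ γ * drift P x)) (comap (fun x : X => (x : ℝ)) atBot) (𝓝 b)

/-- The right-hand side, as a function of `ν`, of the equation for the critical value. -/
def criticalFun (α ν : ℝ) : ℝ :=
  (ν - 1) * (Real.Gamma (1 - α) * Real.Gamma (α - ν) / Real.Gamma (2 - ν)) +
    Real.Gamma ν * ((1 - α + ν) * Real.Gamma (1 - α) / Real.Gamma (2 - α + ν) -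
      Real.Gamma (α - ν) / Real.Gamma α)

end HeavyTailWalk

end

/-! The powers |x|^ν with 0 < ν < α serve as Lyapunov functions. Let R = |x| and let η be the
increment counted positive away from the origin. The function (|1 + u|^ν - 1)/ν - u is ∫ `gOut` over
(0, u⁺) plus ∫ `gIn` over (0, u⁻). By the layer-cake formula and the tails c y^(-α), its mean at u =
η/R is asymptotic to c R^(-α) ∫ (`gOut` + `gIn`) t^(-α) dt, and beta integrals evaluate this as -c
R^(-α) `criticalFun α ν`. The linear term contributes b R^(-γ-1). Hence (`tendsto_lyapunov_drift`)
the mean one-step change of |x|^ν is ν |x|^(ν-γ-1) (b - e c `criticalFun α ν` + o(1)), where e is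
the limit of |x|^(γ+1-α): 1 when γ = α - 1, and 0 when γ < α - 1.

When γ = α - 1, the sign changes exactly where `criticalFun α ν` = b/c. The function (t^ν - 1)/ν is
nondecreasing in ν, which makes `criticalFun` strictly decreasing (`criticalFun_lt`). Its limits are
-π cot(πα/2) at 0 and -∞ at α, so the root ν⋆ exists and is unique. When γ > α - 1, the drift is
negligible on the critical scale: this is the critical case with b = 0, whose root is α - 1. When γ
< α - 1 and b < 0, every |x|^ν with ν < α decreases on average.

Finite moments: a decrease of order |x|^(ν-β), β = γ + 1, bounds the moments of order below ν/β, and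
also of order ν/β when ν/β ≥ 1 (`tsum_powIncr_killed_lt_top_of_lt_one`,
`tsum_powIncr_killed_lt_top_of_one_le`).

Infinite moments: from x the chain needs time of order |x|^(γ+1) to come back, so 𝔼_x[τ^q] is at
least a multiple of |x|^((γ+1)q) (`exists_le_passageMoment`). If |x|^ν is a submartingale with ν ≤
(γ+1)q, a finite q-th moment would force its stopped version to vanish in mean
(`tsum_powIncr_killed_eq_top`). If (γ+1)q ≥ α, a single jump already has infinite mean of
|ξ₁|^((γ+1)q) (`eventually_passageMoment_eq_top`). -/

namespace HeavyTailWalk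

/-! ### The semigroup of a chain killed on leaving a set. -/

section Killed

variable {E : Type*} [MeasurableSpace E]

/-- The semigroup of the chain with kernel `P` killed on leaving `D`:
`killed P D u n x = 𝔼_x[u(ξₙ); ξ₀, …, ξₙ ∈ D]`. -/
noncomputable def killed (P : Kernel E E) (D : Set E) (u : E → ℝ≥0∞) : ℕ → E → ℝ≥0∞
  | 0 => D.indicator u
  | n + 1 => D.indicator fun x => ∫⁻ z, killed P D u n z ∂(P x)

variable {P : Kernel E E} {D : Set E} {u v : E → ℝ≥0∞}

lemma killed_zero : killed P D u 0 = D.indicator u := rfl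

lemma killed_succ (n : ℕ) :
    killed P D u (n + 1) = D.indicator fun x => ∫⁻ z, killed P D u n z ∂(P x) := rfl

lemma killed_of_notMem {x : E} (hx : x ∉ D) (n : ℕ) : killed P D u n x = 0 := by
  cases n <;> simp [killed, hx]

lemma killed_succ_of_mem {x : E} (hx : x ∈ D) (n : ℕ) :
    killed P D u (n + 1) x = ∫⁻ z, killed P D u n z ∂(P x) := by
  simp [killed, hx]

lemma measurable_killed (hD : MeasurableSet D) (hu : Measurable u) (n : ℕ) :
    Measurable (killed P D u n) := by
  induction n with
  | zero => exact hu.indicator hD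
  | succ n ih => exact (Measurable.lintegral_kernel ih).indicator hD

lemma killed_mono (h : ∀ x ∈ D, u x ≤ v x) (n : ℕ) (x : E) :
    killed P D u n x ≤ killed P D v n x := by
  induction n generalizing x with
  | zero => exact indicator_le_indicator' (fun hx => h x hx)
  | succ n ih => exact indicator_le_indicator' fun _ => lintegral_mono ih

lemma killed_killed (m n : ℕ) : killed P D (killed P D u m) n = killed P D u (m + n) := by
  induction n with
  | zero =>
    ext x
    by_cases hx : x ∈ D
    · simp [killed_zero, hx]
    · rw [killed_of_notMem hx, killed_of_notMem hx]
  | succ n ih => rw [killed_succ, ih, ← add_assoc, killed_succ]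

/-- The semigroup can be unfolded at the final time instead of the initial one. -/
lemma killed_succ_eq (n : ℕ) :
    killed P D u (n + 1) = killed P D (fun y => ∫⁻ z, D.indicator u z ∂(P y)) n := by
  have h : killed P D u 1 = D.indicator (fun y => ∫⁻ z, D.indicator u z ∂(P y)) := rfl
  rw [add_comm n 1, ← killed_killed 1 n, h]
  induction n with
  | zero => simp [killed_zero]
  | succ n ih => rw [killed_succ, ih, ← killed_succ]

lemma killed_add (hD : MeasurableSet D) (hu : Measurable u) (n : ℕ) (x : E) :
    killed P D (fun y => u y + v y) n x = killed P D u n x + killed P D v n x := by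
  induction n generalizing x with
  | zero => by_cases hx : x ∈ D <;> simp [killed_zero, hx]
  | succ n ih =>
    by_cases hx : x ∈ D
    · simp only [killed_succ_of_mem hx, ih]
      exact lintegral_add_left (measurable_killed hD hu n) _
    · simp [killed_of_notMem hx]

lemma killed_const_mul (hD : MeasurableSet D) (hu : Measurable u) (k : ℝ≥0∞) (n : ℕ) (x : E) :
    killed P D (fun y => k * u y) n x = k * killed P D u n x := by
  induction n generalizing x with
  | zero => by_cases hx : x ∈ D <;> simp [killed_zero, hx]
  | succ n ih =>
    by_cases hx : x ∈ D
    · simp only [killed_succ_of_mem hx, ih]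
      exact lintegral_const_mul _ (measurable_killed hD hu n)
    · simp [killed_of_notMem hx]

lemma killed_const (k : ℝ≥0∞) (n : ℕ) (x : E) (hD : MeasurableSet D) :
    killed P D (fun _ => k) n x = k * killed P D (fun _ => 1) n x := by
  simpa using killed_const_mul (P := P) hD (measurable_const (a := (1 : ℝ≥0∞))) k n x

lemma killed_tsum (hD : MeasurableSet D) {u : ℕ → E → ℝ≥0∞} (hu : ∀ k, Measurable (u k))
    (n : ℕ) (x : E) :
    killed P D (fun y => ∑' k, u k y) n x = ∑' k, killed P D (u k) n x := by
  induction n generalizing x with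
  | zero => by_cases hx : x ∈ D <;> simp [killed_zero, hx]
  | succ n ih =>
    by_cases hx : x ∈ D
    · simp only [killed_succ_of_mem hx, ih]
      exact lintegral_tsum fun k => (measurable_killed hD (hu k) n).aemeasurable
    · simp [killed_of_notMem hx]

lemma killed_one_antitone [IsMarkovKernel P] (x : E) :
    Antitone fun n => killed P D (fun _ => 1) n x := by
  refine antitone_nat_of_succ_le fun n => ?_
  rw [killed_succ_eq]
  refine killed_mono (fun y _ => ?_) n x
  calc ∫⁻ z, D.indicator (fun _ => 1) z ∂(P y) ≤ ∫⁻ _, 1 ∂(P y) :=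
        lintegral_mono fun z => indicator_le_self _ _ _
    _ ≤ 1 := by simp

end Killed

/-- The increment `(n + 1)^q - n^q` of the `q`-th power. -/
noncomputable def powIncr (q : ℝ) (n : ℕ) : ℝ≥0∞ := ENNReal.ofReal (((n : ℝ) + 1) ^ q - (n : ℝ) ^ q)

lemma sum_powIncr {q : ℝ} (hq : 0 < q) (n : ℕ) :
    ∑ k ∈ Finset.range n, powIncr q k = (n : ℝ≥0∞) ^ q := by
  unfold powIncr
  rw [← ENNReal.ofReal_sum_of_nonneg]
  · have := Finset.sum_range_sub (fun k : ℕ => (k : ℝ) ^ q) n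
    push_cast at this
    rw [this, Real.zero_rpow hq.ne', sub_zero, ← ENNReal.ofReal_rpow_of_nonneg (by positivity) hq.le,
      ENNReal.ofReal_natCast]
  · intro k _
    exact sub_nonneg.2 (Real.rpow_le_rpow (by positivity) (by linarith) hq.le)

lemma tsum_powIncr {q : ℝ} (hq : 0 < q) : ∑' k, powIncr q k = ∞ := by
  refine tendsto_nhds_unique (ENNReal.summable.hasSum.tendsto_sum_nat) ?_
  simp_rw [sum_powIncr hq]
  exact (ENNReal.tendsto_rpow_at_top hq).comp ENNReal.tendsto_nat_nhds_top

/-! ### From the path law to survival probabilities. -/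

section Path

variable {X : Set ℝ}

/-- This is the Markov property at time n. Both integrands depend on finitely many coordinates, so
`Kernel.traj` may be replaced by partial trajectories, and the one up to n + 1 is the one up to n
followed by one kernel step. -/
lemma lintegral_pathLaw_succ (P : Kernel X X) [IsMarkovKernel P] (x : X) {D : Set X}
    (hD : MeasurableSet D) {u : X → ℝ≥0∞} (hu : Measurable u) (n : ℕ) :
    ∫⁻ ξ, {ξ : ℕ → X | ∀ k ≤ n, ξ k ∈ D}.indicator (fun ξ => u (ξ (n + 1))) ξ ∂(pathLaw P x) =
      ∫⁻ ξ, {ξ : ℕ → X | ∀ k ≤ n, ξ k ∈ D}.indicator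
        (fun ξ => ∫⁻ z, u z ∂(P (ξ n))) ξ ∂(pathLaw P x) := by
  unfold pathLaw
  set κ : (n : ℕ) → Kernel ((i : Finset.Iic n) → X) X :=
    fun n => P.comap (fun h : (i : Finset.Iic n) → X => h ⟨n, Finset.mem_Iic.2 le_rfl⟩)
      (measurable_pi_apply _) with hκ
  set x₀ : (i : Finset.Iic 0) → X := fun _ => x
  let A : Set ((i : Finset.Iic n) → X) := {y | ∀ i, y i ∈ D}
  have hA : MeasurableSet A := by
    have : A = ⋂ i, (fun y => y i) ⁻¹' D := by ext; simp [A]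
    rw [this]
    exact MeasurableSet.iInter fun i => measurable_pi_apply i hD
  let B : Set ((i : Finset.Iic (n + 1)) → X) := Preorder.frestrictLe₂ (π := fun _ => X) (Nat.le_succ n) ⁻¹' A
  have hB : MeasurableSet B := (Preorder.measurable_frestrictLe₂ _) hA
  let F : ((i : Finset.Iic (n + 1)) → X) → ℝ≥0∞ :=
    B.indicator fun y => u (y ⟨n + 1, Finset.mem_Iic.2 le_rfl⟩)
  have hF : Measurable F :=
    Measurable.indicator (by fun_prop : Measurable fun y : (i : Finset.Iic (n + 1)) → X =>
      u (y ⟨n + 1, Finset.mem_Iic.2 le_rfl⟩)) hB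
  let G : ((i : Finset.Iic n) → X) → ℝ≥0∞ :=
    A.indicator fun y => ∫⁻ z, u z ∂(P (y ⟨n, Finset.mem_Iic.2 le_rfl⟩))
  have hPu : Measurable fun y => ∫⁻ z, u z ∂(P y) := Measurable.lintegral_kernel hu
  have hG : Measurable G :=
    Measurable.indicator (hPu.comp (by fun_prop : Measurable fun y : (i : Finset.Iic n) → X =>
      y ⟨n, Finset.mem_Iic.2 le_rfl⟩)) hA
  have e1 : ∀ ξ : ℕ → X, {ξ : ℕ → X | ∀ k ≤ n, ξ k ∈ D}.indicator (fun ξ => u (ξ (n + 1))) ξ =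
      F (Preorder.frestrictLe (π := fun _ => X) (n + 1) ξ) := by
    intro ξ
    have : ξ ∈ {ξ : ℕ → X | ∀ k ≤ n, ξ k ∈ D} ↔
        Preorder.frestrictLe (π := fun _ => X) (n + 1) ξ ∈ B := by
      simp [A, B, Preorder.frestrictLe, Preorder.frestrictLe₂]
    by_cases h : ξ ∈ {ξ : ℕ → X | ∀ k ≤ n, ξ k ∈ D}
    · simp only [F, indicator_of_mem h, indicator_of_mem (this.1 h)]
      rfl
    · simp only [F, indicator_of_notMem h, indicator_of_notMem (mt this.2 h)]
  have e2 : ∀ ξ : ℕ → X,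
      {ξ : ℕ → X | ∀ k ≤ n, ξ k ∈ D}.indicator (fun ξ => ∫⁻ z, u z ∂(P (ξ n))) ξ =
      G (Preorder.frestrictLe (π := fun _ => X) n ξ) := by
    intro ξ
    have : ξ ∈ {ξ : ℕ → X | ∀ k ≤ n, ξ k ∈ D} ↔
        Preorder.frestrictLe (π := fun _ => X) n ξ ∈ A := by
      simp [A, Preorder.frestrictLe]
    by_cases h : ξ ∈ {ξ : ℕ → X | ∀ k ≤ n, ξ k ∈ D}
    · simp only [G, indicator_of_mem h, indicator_of_mem (this.1 h)]
      rfl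
    · simp only [G, indicator_of_notMem h, indicator_of_notMem (mt this.2 h)]
  simp_rw [e1, e2]
  rw [← lintegral_map hF (Preorder.measurable_frestrictLe _),
    ← lintegral_map hG (Preorder.measurable_frestrictLe _),
    Kernel.traj_map_frestrictLe_apply, Kernel.traj_map_frestrictLe_apply,
    Kernel.partialTraj_succ_eq_comp (Nat.zero_le n), Kernel.lintegral_comp _ _ _ hF]
  congr 1
  ext y
  have hI : Measurable (IicProdIoc (X := fun _ : ℕ => X) n (n + 1)) := measurable_IicProdIoc
  have hFI : Measurable fun p => F (IicProdIoc (X := fun _ : ℕ => X) n (n + 1) p) := hF.comp hI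
  have hFy : Measurable fun b => F (IicProdIoc (X := fun _ : ℕ => X) n (n + 1) (y, b)) :=
    hFI.comp measurable_prodMk_left
  have := Kernel.IsMarkovKernel.map (κ n)
    (MeasurableEquiv.piSingleton (X := fun _ : ℕ => X) n).measurable
  rw [Kernel.partialTraj_succ_self, Kernel.lintegral_map _ hI _ hF,
    Kernel.lintegral_id_prod hFI, Kernel.lintegral_map _ (MeasurableEquiv.measurable _) _ hFy]
  have e3 : ∀ z : X, F (IicProdIoc (X := fun _ : ℕ => X) n (n + 1)
      (y, MeasurableEquiv.piSingleton (X := fun _ : ℕ => X) n z)) =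
      A.indicator (fun _ => u z) y := by
    intro z
    have : IicProdIoc (X := fun _ : ℕ => X) n (n + 1)
      (y, MeasurableEquiv.piSingleton (X := fun _ : ℕ => X) n z) ∈ B ↔ y ∈ A := by
      have h := congr_fun (frestrictLe₂_comp_IicProdIoc (X := fun _ : ℕ => X) (Nat.le_succ n))
        (y, MeasurableEquiv.piSingleton (X := fun _ : ℕ => X) n z)
      simp only [Function.comp_apply] at h
      simp only [B, mem_preimage]
      rw [h]
    by_cases h : y ∈ A
    · simp only [F, indicator_of_mem h, indicator_of_mem (this.2 h)]
      simp [IicProdIoc_def, MeasurableEquiv.piSingleton]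
    · simp only [F, indicator_of_notMem h, indicator_of_notMem (mt this.1 h)]
  simp_rw [e3]
  by_cases h : y ∈ A
  · simp only [G, indicator_of_mem h]
    rfl
  · simp only [G, indicator_of_notMem h, lintegral_zero]

/-- The induction absorbs the last step of the path into the terminal function, so u must stay
general; this matches the unfolding in `killed_succ_eq`. -/
lemma lintegral_pathLaw_killed (P : Kernel X X) [IsMarkovKernel P] (x : X) {D : Set X}
    (hD : MeasurableSet D) {u : X → ℝ≥0∞} (hu : Measurable u) (n : ℕ) :
    ∫⁻ ξ, {ξ : ℕ → X | ∀ k ≤ n, ξ k ∈ D}.indicator (fun ξ => u (ξ n)) ξ ∂(pathLaw P x) =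
      killed P D u n x := by
  induction n generalizing u with
  | zero =>
    have h0 : ∀ ξ : ℕ → X, {ξ : ℕ → X | ∀ k ≤ 0, ξ k ∈ D}.indicator (fun ξ => u (ξ 0)) ξ =
        D.indicator u (Preorder.frestrictLe (π := fun _ => X) 0 ξ ⟨0, Finset.mem_Iic.2 le_rfl⟩) := by
      intro ξ
      by_cases h : ξ 0 ∈ D <;> simp [h, Preorder.frestrictLe]
    simp_rw [h0]
    have hm : Measurable fun y : (i : Finset.Iic 0) → X =>
        D.indicator u (y ⟨0, Finset.mem_Iic.2 le_rfl⟩) :=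
      (hu.indicator hD).comp (by fun_prop)
    unfold pathLaw
    rw [← lintegral_map hm (Preorder.measurable_frestrictLe _),
      Kernel.traj_map_frestrictLe_apply, Kernel.partialTraj_self, Kernel.id_apply,
      lintegral_dirac' _ hm]
    rfl
  | succ n ih =>
    have h1 : ∀ ξ : ℕ → X, {ξ : ℕ → X | ∀ k ≤ n + 1, ξ k ∈ D}.indicator (fun ξ => u (ξ (n + 1))) ξ =
        {ξ : ℕ → X | ∀ k ≤ n, ξ k ∈ D}.indicator (fun ξ => D.indicator u (ξ (n + 1))) ξ := by
      intro ξ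
      have : (∀ k ≤ n + 1, ξ k ∈ D) ↔ (∀ k ≤ n, ξ k ∈ D) ∧ ξ (n + 1) ∈ D := by
        refine ⟨fun h => ⟨fun k hk => h k (by omega), h _ le_rfl⟩, fun h k hk => ?_⟩
        rcases Nat.lt_or_eq_of_le hk with hk | rfl
        · exact h.1 k (by omega)
        · exact h.2
      by_cases h : ∀ k ≤ n, ξ k ∈ D
      · rw [indicator_of_mem (s := {ξ : ℕ → X | ∀ k ≤ n, ξ k ∈ D}) h]
        by_cases h' : ξ (n + 1) ∈ D
        · rw [indicator_of_mem h', indicator_of_mem (s := {ξ : ℕ → X | ∀ k ≤ n + 1, ξ k ∈ D})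
            (this.2 ⟨h, h'⟩)]
        · rw [indicator_of_notMem h', indicator_of_notMem (s := {ξ : ℕ → X | ∀ k ≤ n + 1, ξ k ∈ D})
            fun H => h' (this.1 H).2]
      · rw [indicator_of_notMem (s := {ξ : ℕ → X | ∀ k ≤ n, ξ k ∈ D}) h,
          indicator_of_notMem (s := {ξ : ℕ → X | ∀ k ≤ n + 1, ξ k ∈ D})
            fun H => h (this.1 H).1]
    simp_rw [h1]
    rw [lintegral_pathLaw_succ P x hD (hu.indicator hD), killed_succ_eq]
    exact ih (Measurable.lintegral_kernel (hu.indicator hD))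

/-- The region `|x| > a` outside which the passage time stops the chain. -/
def outside (X : Set ℝ) (a : ℝ) : Set X := {x | a < |(x : ℝ)|}

lemma measurableSet_outside (a : ℝ) : MeasurableSet (outside X a) :=
  measurableSet_lt measurable_const (by fun_prop)

/-- Telescoping: τ^q is the sum of (n+1)^q - n^q over n < τ, and n < τ means that the path is
outside up to time n. If τ = ∞ both sides are infinite. -/
lemma passageTime_rpow (a : ℝ) {q : ℝ} (hq : 0 < q) (ξ : ℕ → X) :
    passageTime a ξ ^ q =
      ∑' n, powIncr q n * {ξ : ℕ → X | ∀ k ≤ n, ξ k ∈ outside X a}.indicator (fun _ => 1) ξ := by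
  by_cases h : ∃ n, |(ξ n : ℝ)| ≤ a
  · classical
    have hN : passageTime a ξ = (Nat.find h : ℝ≥0∞) := by
      refine le_antisymm (iInf₂_le (Nat.find h) (Nat.find_spec h)) (le_iInf₂ fun n hn => ?_)
      exact_mod_cast Nat.find_min' h hn
    rw [hN, ← sum_powIncr hq, tsum_eq_sum (s := Finset.range (Nat.find h))]
    · refine Finset.sum_congr rfl fun n hn => ?_
      rw [indicator_of_mem, mul_one]
      intro k hk
      exact not_le.1 (Nat.find_min h (lt_of_le_of_lt hk (Finset.mem_range.1 hn)))
    · intro n hn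
      rw [indicator_of_notMem, mul_zero]
      intro hmem
      exact absurd (Nat.find_spec h)
        (not_le.2 (hmem (Nat.find h) (by simpa using hn)))
  · push Not at h
    have h1 : passageTime a ξ = ∞ := by
      simp only [passageTime, iInf_eq_top]
      intro n hn
      exact absurd hn (not_le.2 (h n))
    rw [h1, ENNReal.top_rpow_of_pos hq, ← tsum_powIncr hq]
    refine tsum_congr fun n => ?_
    rw [indicator_of_mem, mul_one]
    exact fun k _ => h k

/-- The passage moments in terms of the survival probabilities of the killed chain. -/
lemma passageMoment_eq_tsum (P : Kernel X X) [IsMarkovKernel P] {q : ℝ} (hq : 0 < q) (a : ℝ)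
    (x : X) :
    passageMoment P q a x = ∑' n, powIncr q n * killed P (outside X a) (fun _ => 1) n x := by
  have hm : ∀ n : ℕ, MeasurableSet {ξ : ℕ → X | ∀ k ≤ n, ξ k ∈ outside X a} := by
    intro n
    have : {ξ : ℕ → X | ∀ k ≤ n, ξ k ∈ outside X a} =
        ⋂ k, ⋂ (_ : k ≤ n), (fun ξ : ℕ → X => ξ k) ⁻¹' outside X a := by ext; simp
    rw [this]
    exact MeasurableSet.iInter fun k => MeasurableSet.iInter fun _ =>
      measurable_pi_apply k (measurableSet_outside a)
  have hm' : ∀ n : ℕ, Measurable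
      ({ξ : ℕ → X | ∀ k ≤ n, ξ k ∈ outside X a}.indicator fun _ => (1 : ℝ≥0∞)) := fun n =>
    measurable_const.indicator (hm n)
  unfold passageMoment
  simp_rw [passageTime_rpow a hq]
  rw [lintegral_tsum fun n => ((hm' n).const_mul _).aemeasurable]
  refine tsum_congr fun n => ?_
  rw [lintegral_const_mul _ (hm' n), ← lintegral_pathLaw_killed P x (measurableSet_outside a)
    measurable_const]

end Path

/-- For q ≤ 1 the bound follows from n (n+1)^(q-1) ≤ n^q, and for q ≥ 1 from Bernoulli's inequality
at -1/(n+1). Raising q to p costs nothing because n + 1 ≥ 1. -/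
lemma powIncr_le {q p : ℝ} (hqp : q ≤ p) (n : ℕ) :
    powIncr q n ≤ ENNReal.ofReal (max 1 q * ((n : ℝ) + 1) ^ (p - 1)) := by
  refine ENNReal.ofReal_le_ofReal ?_
  have hn : (0 : ℝ) < (n : ℝ) + 1 := by positivity
  have h1 : ((n : ℝ) + 1) ^ q - (n : ℝ) ^ q ≤ max 1 q * ((n : ℝ) + 1) ^ (q - 1) := by
    have hsplit : ((n : ℝ) + 1) ^ q = ((n : ℝ) + 1) * ((n : ℝ) + 1) ^ (q - 1) := by
      rw [Real.rpow_sub_one hn.ne']; field_simp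
    have hpos : 0 ≤ ((n : ℝ) + 1) ^ (q - 1) := by positivity
    rcases le_total q 1 with hq1 | hq1
    · rw [max_eq_left hq1]
      have : (n : ℝ) * ((n : ℝ) + 1) ^ (q - 1) ≤ (n : ℝ) ^ q := by
        rcases Nat.eq_zero_or_pos n with rfl | hn0
        · simpa using Real.rpow_nonneg le_rfl q
        · have hn0' : (0 : ℝ) < n := by exact_mod_cast hn0
          have h2 : ((n : ℝ) + 1) ^ (q - 1) ≤ (n : ℝ) ^ (q - 1) :=
            Real.rpow_le_rpow_of_nonpos hn0' (by linarith) (by linarith)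
          have h3 : (n : ℝ) ^ q = n * (n : ℝ) ^ (q - 1) := by
            rw [Real.rpow_sub_one hn0'.ne']; field_simp
          rw [h3]; gcongr
      rw [hsplit]; linarith
    · rw [max_eq_right hq1]
      have hb := one_add_mul_self_le_rpow_one_add (s := -(1 / ((n : ℝ) + 1)))
        (by rw [neg_le_neg_iff, div_le_one hn]; linarith [n.cast_nonneg (α := ℝ)]) hq1
      have h4 : 1 + -(1 / ((n : ℝ) + 1)) = (n : ℝ) / ((n : ℝ) + 1) := by field_simp; ring
      rw [h4, Real.div_rpow (by positivity) hn.le, le_div_iff₀ (by positivity), hsplit] at hb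
      rw [hsplit]
      have h5 : (1 + q * -(1 / ((n : ℝ) + 1))) * (((n : ℝ) + 1) * ((n : ℝ) + 1) ^ (q - 1)) =
        ((n : ℝ) + 1) * ((n : ℝ) + 1) ^ (q - 1) - q * ((n : ℝ) + 1) ^ (q - 1) := by
        field_simp
        ring
      linarith
  refine h1.trans ?_
  gcongr
  · linarith [n.cast_nonneg (α := ℝ)]

/-- Midpoint convexity of t^q at n and n + 2. -/
lemma powIncr_mono {q : ℝ} (hq : 1 ≤ q) : Monotone (powIncr q) := by
  refine monotone_nat_of_le_succ fun n => ENNReal.ofReal_le_ofReal ?_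
  have h := (convexOn_rpow hq).2 (show (n : ℝ) ∈ Ici 0 by simp)
    (show (n : ℝ) + 2 ∈ Ici 0 by simp only [mem_Ici]; positivity)
    (show (0 : ℝ) ≤ 1 / 2 by norm_num) (show (0 : ℝ) ≤ 1 / 2 by norm_num) (by norm_num)
  have e : (1 / 2 : ℝ) • (n : ℝ) + (1 / 2 : ℝ) • ((n : ℝ) + 2) = (n : ℝ) + 1 := by
    simp only [smul_eq_mul]; ring
  rw [e] at h
  simp only [smul_eq_mul] at h
  push_cast
  have e2 : (n : ℝ) + 1 + 1 = n + 2 := by ring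
  rw [e2]; linarith

/-! ### Lyapunov criteria for moments of exit times. -/

section Criteria

variable {E : Type*} [MeasurableSpace E] {P : Kernel E E} {D : Set E}

/-- Telescoping for a time-dependent supermartingale W with running cost g. The inequality is
additive because subtraction is not available in `ℝ≥0∞`. -/
lemma sum_killed_add_le (hD : MeasurableSet D) {W g : ℕ → E → ℝ≥0∞} (hW : ∀ n, Measurable (W n))
    (h : ∀ n, ∀ x ∈ D, ∫⁻ z, W (n + 1) z ∂(P x) + g n x ≤ W n x) (n : ℕ) (x : E) :
    ∑ k ∈ Finset.range n, killed P D (g k) k x + killed P D (W n) n x ≤ W 0 x := by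
  induction n with
  | zero =>
    rw [Finset.sum_range_zero, zero_add]
    exact indicator_le_self _ _ _
  | succ n ih =>
    refine le_trans ?_ ih
    rw [Finset.sum_range_succ, add_assoc]
    gcongr
    rw [add_comm, killed_succ_eq, ← killed_add hD (Measurable.lintegral_kernel ((hW _).indicator hD))]
    refine killed_mono (fun y hy => le_trans ?_ (h n y hy)) n x
    gcongr
    exact indicator_le_self _ _ _

lemma tsum_killed_le (hD : MeasurableSet D) {W g : ℕ → E → ℝ≥0∞} (hW : ∀ n, Measurable (W n))
    (h : ∀ n, ∀ x ∈ D, ∫⁻ z, W (n + 1) z ∂(P x) + g n x ≤ W n x) (x : E) :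
    ∑' k, killed P D (g k) k x ≤ W 0 x := by
  rw [ENNReal.tsum_eq_iSup_nat]
  exact iSup_le fun n => le_self_add.trans (sum_killed_add_le hD hW h n x)

/-- Finiteness of moments of the exit time from a Lyapunov function `r ^ ν` with drift of order
`r ^ (ν - β)`, for moments of order less than `ν / β < 1`. -/
lemma tsum_powIncr_killed_lt_top_of_lt_one (hD : MeasurableSet D) {r : E → ℝ} (hr : Measurable r)
    (hrD : ∀ x ∈ D, 0 < r x) {ν β ε q : ℝ} (hν : 0 < ν) (hβ : ν < β) (hε : 0 < ε)
    (hqν : q < ν / β)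
    (h : ∀ x ∈ D, ∫⁻ z, ENNReal.ofReal (r z ^ ν) ∂(P x) + ENNReal.ofReal (ε * r x ^ (ν - β)) ≤
      ENNReal.ofReal (r x ^ ν)) (x : E) :
    ∑' n, powIncr q n * killed P D (fun _ => 1) n x < ∞ := by
  have hβ0 : 0 < β := hν.trans hβ
  have hq1 : q < 1 := hqν.trans ((div_lt_one hβ0).2 hβ)
  -- This s solves q - 1 = -s + (1-q)ν/(β-ν), and s > 1 is equivalent to q < ν/β.
  set s : ℝ := (1 - q) * β / (β - ν) with hs
  have hs1 : 1 < s := by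
    rw [hs, lt_div_iff₀ (by linarith)]
    rw [lt_div_iff₀ hβ0] at hqν
    linarith
  have hmν : Measurable fun x => ENNReal.ofReal (r x ^ ν) := by fun_prop
  have hmβ : Measurable fun x => ENNReal.ofReal (r x ^ (ν - β)) := by fun_prop
  -- Either r^(ν-β) already dominates (n+1)^(q-1), or r is so large that (n+1)^(-s) r^ν does. The
  -- first term is summable along the chain by the drift, the second because 𝔼[r^ν] never grows and
  -- s > 1.
  have key : ∀ n : ℕ, ∀ y ∈ D, powIncr q n ≤ ENNReal.ofReal (r y ^ (ν - β)) +
      ENNReal.ofReal (((n : ℝ) + 1) ^ (-s)) * ENNReal.ofReal (r y ^ ν) := by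
    intro n y hy
    have hn : (0 : ℝ) < (n : ℝ) + 1 := by positivity
    have hry := hrD y hy
    refine (powIncr_le le_rfl n).trans ?_
    rw [max_eq_left hq1.le, one_mul, ← ENNReal.ofReal_mul (by positivity),
      ← ENNReal.ofReal_add (by positivity) (by positivity)]
    refine ENNReal.ofReal_le_ofReal ?_
    rcases le_or_gt (((n : ℝ) + 1) ^ (q - 1)) (r y ^ (ν - β)) with hle | hlt
    · exact hle.trans (le_add_of_nonneg_right (by positivity))
    · refine le_trans ?_ (le_add_of_nonneg_left (by positivity))
      have h1 : (r y ^ (ν - β)) ^ (ν / (β - ν)) < (((n : ℝ) + 1) ^ (q - 1)) ^ (ν / (β - ν)) :=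
        Real.rpow_lt_rpow (by positivity) hlt (div_pos hν (by linarith))
      rw [← Real.rpow_mul hry.le, ← Real.rpow_mul hn.le] at h1
      have e1 : (ν - β) * (ν / (β - ν)) = -ν := by
        have : β - ν ≠ 0 := by linarith
        field_simp; ring
      rw [e1, Real.rpow_neg hry.le, inv_lt_comm₀ (by positivity) (by positivity),
        ← Real.rpow_neg hn.le] at h1
      calc ((n : ℝ) + 1) ^ (q - 1)
          = ((n : ℝ) + 1) ^ (-s) * ((n : ℝ) + 1) ^ (-((q - 1) * (ν / (β - ν)))) := by
            rw [← Real.rpow_add hn]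
            congr 1
            have : β - ν ≠ 0 := by linarith
            rw [hs]; field_simp; ring
        _ ≤ _ := by gcongr
  have hdrift := tsum_killed_le (P := P) hD (W := fun _ x => ENNReal.ofReal (r x ^ ν))
    (g := fun _ x => ENNReal.ofReal (ε * r x ^ (ν - β))) (fun _ => hmν) (fun _ => h) x
  have hmono : ∀ n, killed P D (fun x => ENNReal.ofReal (r x ^ ν)) n x ≤ ENNReal.ofReal (r x ^ ν) :=
    fun n => le_add_self.trans (sum_killed_add_le (P := P) hD
      (W := fun _ x => ENNReal.ofReal (r x ^ ν))
      (g := fun _ x => ENNReal.ofReal (ε * r x ^ (ν - β))) (fun _ => hmν) (fun _ => h) n x)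
  have hfin1 : ∑' n, killed P D (fun x => ENNReal.ofReal (r x ^ (ν - β))) n x < ∞ := by
    have e : ∀ n, killed P D (fun x => ENNReal.ofReal (ε * r x ^ (ν - β))) n x =
        ENNReal.ofReal ε * killed P D (fun x => ENNReal.ofReal (r x ^ (ν - β))) n x := by
      intro n
      rw [← killed_const_mul hD hmβ]
      simp_rw [ENNReal.ofReal_mul hε.le]
    simp_rw [e] at hdrift
    rw [ENNReal.tsum_mul_left] at hdrift
    by_contra hcon
    rw [not_lt, top_le_iff] at hcon
    rw [hcon, ENNReal.mul_top (by simpa using hε)] at hdrift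
    exact absurd hdrift (by simp)
  have hfin2 : ∑' n : ℕ, ENNReal.ofReal (((n : ℝ) + 1) ^ (-s)) < ∞ := by
    have hsum : Summable fun n : ℕ => ((n : ℝ) + 1) ^ (-s) := by
      have := (summable_nat_add_iff 1).2 (Real.summable_nat_rpow.2 (show -s < -1 by linarith))
      simpa using this
    rw [← ENNReal.ofReal_tsum_of_nonneg (fun n => by positivity) hsum]
    exact ENNReal.ofReal_lt_top
  calc ∑' n, powIncr q n * killed P D (fun _ => 1) n x
      ≤ ∑' n, (killed P D (fun x => ENNReal.ofReal (r x ^ (ν - β))) n x +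
          ENNReal.ofReal (((n : ℝ) + 1) ^ (-s)) * ENNReal.ofReal (r x ^ ν)) := by
        refine ENNReal.tsum_le_tsum fun n => ?_
        rw [← killed_const _ _ _ hD]
        refine (killed_mono (key n) n x).trans ?_
        rw [killed_add hD hmβ, killed_const_mul hD hmν]
        gcongr
        exact hmono n
    _ = _ := ENNReal.tsum_add
    _ < ∞ := by
        rw [ENNReal.tsum_mul_right]
        exact ENNReal.add_lt_top.2 ⟨hfin1, ENNReal.mul_lt_top hfin2 ENNReal.ofReal_lt_top⟩

/-- With K = (g+s)^(p-1) g^(1-p), this bounds the change of (g+s)^p by K times the change of g^p, so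
a mean decrease of g^p passes to the time-shifted function. It is convexity of t^p at the points
g₁/g and 1, with weights g/(g+s) and s/(g+s). -/
lemma add_rpow_tangent {p g g₁ s : ℝ} (hp : 1 ≤ p) (hg : 0 < g) (hg₁ : 0 ≤ g₁) (hs : 0 ≤ s) :
    (g₁ + s) ^ p + (g + s) ^ (p - 1) * g ^ (1 - p) * g ^ p ≤
      (g + s) ^ p + (g + s) ^ (p - 1) * g ^ (1 - p) * g₁ ^ p := by
  have hgs : 0 < g + s := by linarith
  have h := (convexOn_rpow hp).2 (show g₁ / g ∈ Ici 0 by simp only [mem_Ici]; positivity)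
    (show (1 : ℝ) ∈ Ici 0 by simp) (show 0 ≤ g / (g + s) by positivity)
    (show 0 ≤ s / (g + s) by positivity) (by field_simp)
  have e : (g / (g + s)) • (g₁ / g) + (s / (g + s)) • (1 : ℝ) = (g₁ + s) / (g + s) := by
    simp only [smul_eq_mul]; field_simp
  rw [e] at h
  simp only [smul_eq_mul, Real.one_rpow, mul_one] at h
  rw [Real.div_rpow (by positivity) hgs.le, Real.div_rpow hg₁ hg.le] at h
  have e1 : (g + s) ^ p = (g + s) * (g + s) ^ (p - 1) := by
    rw [Real.rpow_sub_one hgs.ne']; field_simp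
  have e2 : g ^ (1 - p) * g ^ p = g := by rw [← Real.rpow_add hg]; simp
  have e3 : g ^ (1 - p) = g / g ^ p := by rw [Real.rpow_sub hg, Real.rpow_one]
  have hA : 0 < (g + s) ^ (p - 1) := by positivity
  rw [div_le_iff₀ (by positivity), e1] at h
  have e4 : (g / (g + s) * (g₁ ^ p / g ^ p) + s / (g + s)) * ((g + s) * (g + s) ^ (p - 1)) =
      (g + s) ^ (p - 1) * (g / g ^ p) * g₁ ^ p + s * (g + s) ^ (p - 1) := by
    field_simp
  rw [e4] at h
  rw [mul_assoc _ _ (g ^ p), e2, e1, e3]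
  linarith

/-- Finiteness of moments of the exit time from a Lyapunov function `r ^ ν` with drift of order
`r ^ (ν - β)`, for moments of order at most `ν / β`, when `ν / β ≥ 1`. -/
lemma tsum_powIncr_killed_lt_top_of_one_le (hD : MeasurableSet D) {r : E → ℝ} (hr : Measurable r)
    (hr0 : ∀ x, 0 ≤ r x) (hrD : ∀ x ∈ D, 0 < r x) {ν β ε q : ℝ} (hβ : 0 < β) (hβν : β ≤ ν)
    (hε : 0 < ε) (hqν : q ≤ ν / β)
    (h : ∀ x ∈ D, ∫⁻ z, ENNReal.ofReal (r z ^ ν) ∂(P x) + ENNReal.ofReal (ε * r x ^ (ν - β)) ≤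
      ENNReal.ofReal (r x ^ ν)) (x : E) [IsMarkovKernel P] :
    ∑' n, powIncr q n * killed P D (fun _ => 1) n x < ∞ := by
  set p : ℝ := ν / β with hp
  have hp1 : 1 ≤ p := (one_le_div hβ).2 hβν
  have hpν : β * p = ν := by rw [hp]; field_simp
  -- Advancing the clock in W by κ costs at most pκ (g+s)^(p-1) by Bernoulli. With pκ = ε/2 this
  -- uses half of the spatial drift; the other half pays for the summand (n+1)^(p-1).
  set κ : ℝ := ε / 2 / p with hκ
  have hκ0 : 0 < κ := by positivity
  have hκp : p * κ = ε / 2 := by rw [hκ]; field_simp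
  -- A space-time Lyapunov function: r^β decreases at unit order per step, hence can be traded
  -- against time linearly.
  set W : ℕ → E → ℝ≥0∞ := fun n x => ENNReal.ofReal ((r x ^ β + κ * n) ^ p) with hWdef
  have hW : ∀ n, Measurable (W n) := fun n => by fun_prop
  have hstep : ∀ n : ℕ, ∀ y ∈ D, ∫⁻ z, W (n + 1) z ∂(P y) +
      ENNReal.ofReal (ε / 2 * κ ^ (p - 1)) * ENNReal.ofReal (((n : ℝ) + 1) ^ (p - 1)) ≤ W n y := by
    intro n y hy
    have hry := hrD y hy
    set g := r y ^ β with hg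
    have hg0 : 0 < g := by positivity
    set s := κ * ((n + 1 : ℕ) : ℝ) with hs
    have hs0 : 0 < s := by positivity
    set K := (g + s) ^ (p - 1) * g ^ (1 - p) with hK
    have hK0 : 0 < K := by positivity
    have hgp : ∀ z, (r z ^ β) ^ p = r z ^ ν := fun z => by rw [← Real.rpow_mul (hr0 z), hpν]
    have hKg : K * r y ^ (ν - β) = (g + s) ^ (p - 1) := by
      have : r y ^ (ν - β) = g ^ (p - 1) := by
        rw [hg, ← Real.rpow_mul hry.le]; congr 1; rw [mul_sub, hpν, mul_one]
      rw [this, hK, mul_assoc, ← Real.rpow_add hg0]; simp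
    -- The tangent inequality integrated, with K r^ν kept on the left so that no subtraction occurs;
    -- it is finite and is cancelled in `hstep1`.
    have hint : ∫⁻ z, W (n + 1) z ∂(P y) + ENNReal.ofReal (K * r y ^ ν) ≤
        ENNReal.ofReal ((g + s) ^ p) + ENNReal.ofReal K * ∫⁻ z, ENNReal.ofReal (r z ^ ν) ∂(P y) := by
      calc _ = ∫⁻ z, (W (n + 1) z + ENNReal.ofReal (K * r y ^ ν)) ∂(P y) := by
            rw [lintegral_add_left (hW _)]; simp
        _ ≤ ∫⁻ z, (ENNReal.ofReal ((g + s) ^ p) +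
              ENNReal.ofReal K * ENNReal.ofReal (r z ^ ν)) ∂(P y) := by
            refine lintegral_mono fun z => ?_
            have hrz := hr0 z
            simp only [hWdef]
            rw [← ENNReal.ofReal_mul hK0.le, ← ENNReal.ofReal_add (by positivity) (by positivity),
              ← ENNReal.ofReal_add (by positivity) (by positivity)]
            refine ENNReal.ofReal_le_ofReal ?_
            have := add_rpow_tangent hp1 hg0 (Real.rpow_nonneg hrz β) hs0.le
            rwa [hgp z, hg, hgp y] at this
        _ = _ := by
            rw [lintegral_add_left measurable_const, lintegral_const_mul _ (by fun_prop)]; simp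
    have hG0 : 0 < g + s := by positivity
    have hstep1 : ∫⁻ z, W (n + 1) z ∂(P y) + ENNReal.ofReal (ε * (g + s) ^ (p - 1)) ≤
        ENNReal.ofReal ((g + s) ^ p) := by
      have h2 := mul_le_mul_right (h y hy) (ENNReal.ofReal K)
      rw [mul_add, ← ENNReal.ofReal_mul hK0.le, ← ENNReal.ofReal_mul hK0.le] at h2
      have e : K * (ε * r y ^ (ν - β)) = ε * (g + s) ^ (p - 1) := by rw [← hKg]; ring
      rw [e] at h2
      refine (ENNReal.add_le_add_iff_right (ENNReal.ofReal_ne_top (r := K * r y ^ ν))).1 ?_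
      calc _ = (∫⁻ z, W (n + 1) z ∂(P y) + ENNReal.ofReal (K * r y ^ ν)) +
            ENNReal.ofReal (ε * (g + s) ^ (p - 1)) := by ring
        _ ≤ (ENNReal.ofReal ((g + s) ^ p) +
            ENNReal.ofReal K * ∫⁻ z, ENNReal.ofReal (r z ^ ν) ∂(P y)) +
            ENNReal.ofReal (ε * (g + s) ^ (p - 1)) := by gcongr
        _ ≤ _ := by rw [add_assoc]; gcongr
    have hbern : (g + s) ^ p ≤ (g + κ * n) ^ p + ε / 2 * (g + s) ^ (p - 1) := by
      have hsκ : s = κ * n + κ := by rw [hs]; push_cast; ring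
      have hb := one_add_mul_self_le_rpow_one_add (s := -(κ / (g + s)))
        (by
          rw [neg_le_neg_iff, div_le_one hG0]
          have : 0 ≤ κ * n := by positivity
          linarith) hp1
      have h4 : 1 + -(κ / (g + s)) = (g + κ * n) / (g + s) := by
        rw [hsκ] at hG0 ⊢; field_simp; ring
      rw [h4, Real.div_rpow (by positivity) hG0.le, le_div_iff₀ (by positivity)] at hb
      have hsplit : (g + s) ^ p = (g + s) * (g + s) ^ (p - 1) := by
        rw [Real.rpow_sub_one hG0.ne']; field_simp
      have h5 : (1 + p * -(κ / (g + s))) * (g + s) ^ p =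
          (g + s) ^ p - p * κ * (g + s) ^ (p - 1) := by
        rw [hsplit]; field_simp; ring
      rw [h5, hκp] at hb
      linarith
    have hlow : κ ^ (p - 1) * ((n : ℝ) + 1) ^ (p - 1) ≤ (g + s) ^ (p - 1) := by
      rw [← Real.mul_rpow hκ0.le (by positivity)]
      refine Real.rpow_le_rpow (by positivity) ?_ (by linarith)
      rw [hs]; push_cast; linarith
    refine (ENNReal.add_le_add_iff_right
      (ENNReal.ofReal_ne_top (r := ε / 2 * (g + s) ^ (p - 1)))).1 ?_
    calc _ ≤ ∫⁻ z, W (n + 1) z ∂(P y) + (ENNReal.ofReal (ε / 2 * (g + s) ^ (p - 1)) +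
          ENNReal.ofReal (ε / 2 * (g + s) ^ (p - 1))) := by
          rw [add_assoc]
          gcongr
          rw [← ENNReal.ofReal_mul (by positivity)]
          refine ENNReal.ofReal_le_ofReal ?_
          rw [mul_assoc]; gcongr
      _ = ∫⁻ z, W (n + 1) z ∂(P y) + ENNReal.ofReal (ε * (g + s) ^ (p - 1)) := by
          rw [← ENNReal.ofReal_add (by positivity) (by positivity)]; congr 2; ring
      _ ≤ _ := hstep1
      _ ≤ _ := by
          rw [hWdef, ← ENNReal.ofReal_add (by positivity) (by positivity)]
          exact ENNReal.ofReal_le_ofReal hbern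
  have hsum := tsum_killed_le (P := P) hD hW hstep x
  set c := ENNReal.ofReal (ε / 2 * κ ^ (p - 1)) with hc
  have hc0 : c ≠ 0 := by rw [hc]; simp only [ne_eq, ENNReal.ofReal_eq_zero, not_le]; positivity
  have e : ∀ n : ℕ, killed P D (fun _ => c * ENNReal.ofReal (((n : ℝ) + 1) ^ (p - 1))) n x =
      c * (ENNReal.ofReal (((n : ℝ) + 1) ^ (p - 1)) * killed P D (fun _ => 1) n x) := fun n => by
    rw [killed_const _ _ _ hD, mul_assoc]
  simp_rw [e] at hsum
  rw [ENNReal.tsum_mul_left] at hsum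
  have hfin : ∑' n : ℕ, ENNReal.ofReal (((n : ℝ) + 1) ^ (p - 1)) * killed P D (fun _ => 1) n x < ∞ := by
    by_contra hcon
    rw [not_lt, top_le_iff] at hcon
    rw [hcon, ENNReal.mul_top hc0] at hsum
    exact absurd hsum (by simp [hWdef])
  calc _ ≤ ∑' n : ℕ, ENNReal.ofReal (max 1 q) * (ENNReal.ofReal (((n : ℝ) + 1) ^ (p - 1)) *
          killed P D (fun _ => 1) n x) := by
        refine ENNReal.tsum_le_tsum fun n => ?_
        rw [← mul_assoc, ← ENNReal.ofReal_mul (by positivity)]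
        gcongr
        exact powIncr_le hqν n
    _ < ∞ := by
        rw [ENNReal.tsum_mul_left]
        exact ENNReal.mul_lt_top ENNReal.ofReal_lt_top hfin

/-- Lower bound for survival probabilities from a test function that grows slowly on average. -/
lemma one_le_killed_add [IsMarkovKernel P] (hD : MeasurableSet D) {φ : E → ℝ≥0∞} {η : ℝ≥0∞} (hφD : ∀ y ∉ D, 1 ≤ φ y)
    (h : ∀ y, φ y < 1 → ∫⁻ z, φ z ∂(P y) ≤ φ y + η) (n : ℕ) (y : E) :
    1 ≤ killed P D (fun _ => 1) n y + φ y + n * η := by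
  induction n generalizing y with
  | zero =>
    by_cases hy : y ∈ D
    · simp [killed_zero, hy]
    · simpa [killed_zero, hy] using hφD y hy
  | succ n ih =>
    rcases le_or_gt 1 (φ y) with h1 | h1
    · exact h1.trans (le_add_self.trans le_self_add)
    · have hy : y ∈ D := by
        by_contra hy
        exact absurd (hφD y hy) (not_le.2 h1)
      rw [killed_succ_of_mem hy]
      have hm := measurable_killed (P := P) hD (measurable_const (a := (1 : ℝ≥0∞))) n
      calc (1 : ℝ≥0∞) = ∫⁻ _, 1 ∂(P y) := by simp
        _ ≤ ∫⁻ z, (killed P D (fun _ => 1) n z + φ z + n * η) ∂(P y) := lintegral_mono ih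
        _ = ∫⁻ z, killed P D (fun _ => 1) n z ∂(P y) + ∫⁻ z, φ z ∂(P y) + n * η := by
            rw [lintegral_add_right _ measurable_const, lintegral_add_left hm]; simp
        _ ≤ ∫⁻ z, killed P D (fun _ => 1) n z ∂(P y) + (φ y + η) + n * η := by
            gcongr; exact h y h1
        _ = _ := by push_cast; ring

lemma rpow_div_two_le_tsum_powIncr [IsMarkovKernel P] {q : ℝ} (hq : 0 < q) {n : ℕ} {y : E}
    (h : 1 / 2 ≤ killed P D (fun _ => 1) n y) :
    (n : ℝ≥0∞) ^ q / 2 ≤ ∑' k, powIncr q k * killed P D (fun _ => 1) k y := by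
  rw [← sum_powIncr hq, div_eq_mul_inv, Finset.sum_mul]
  refine le_trans (Finset.sum_le_sum fun k hk => ?_) (ENNReal.sum_le_tsum (Finset.range n))
  gcongr
  rw [← one_div]
  exact h.trans (killed_one_antitone y (Finset.mem_range.1 hk).le)

/-- Infinite moments from a submartingale dominated by the moment function. -/
lemma tsum_powIncr_killed_eq_top [IsMarkovKernel P] (hD : MeasurableSet D) {q : ℝ} (hq : 0 < q)
    {v : E → ℝ≥0∞} (hvD : ∀ x ∉ D, v x = 0)
    (hv : ∀ x ∈ D, v x ≤ ∫⁻ z, v z ∂(P x)) {C : ℝ≥0∞} (hC : C ≠ ∞)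
    (hvC : ∀ y ∈ D, v y ≤ C * ∑' k, powIncr q k * killed P D (fun _ => 1) k y) {x : E}
    (hx : v x ≠ 0) :
    ∑' k, powIncr q k * killed P D (fun _ => 1) k x = ∞ := by
  by_contra hfin
  have hm := fun k => measurable_killed (P := P) hD (measurable_const (a := (1 : ℝ≥0∞))) k
  -- Since v vanishes off D, the submartingale property survives the killing.
  have hsub : ∀ n y, v y ≤ killed P D v n y := by
    intro n
    induction n with
    | zero =>
      intro y
      by_cases hy : y ∈ D
      · simp [killed_zero, hy]
      · simp [hvD y hy]
    | succ n ih =>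
      intro y
      by_cases hy : y ∈ D
      · rw [killed_succ_of_mem hy]
        exact (hv y hy).trans (lintegral_mono ih)
      · simp [hvD y hy]
  -- By the semigroup property, the moment function evaluated at the surviving ξₙ is the same series
  -- with shifted survival probabilities.
  have hbound : ∀ n, v x ≤ C * ∑' k, powIncr q k * killed P D (fun _ => 1) (k + n) x := by
    intro n
    refine ((hsub n x).trans (killed_mono hvC n x)).trans_eq ?_
    rw [killed_const_mul hD (Measurable.tsum fun k => (hm k).const_mul _),
      killed_tsum hD fun k => (hm k).const_mul _]
    congr 1
    refine tsum_congr fun k => ?_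
    rw [killed_const_mul hD (hm k), killed_killed]
  -- A positive limit of the survival probabilities would make the series diverge, since the
  -- increments sum to ∞.
  have hlim0 : Tendsto (fun n => killed P D (fun _ => 1) n x) atTop (𝓝 0) := by
    have hanti := killed_one_antitone (P := P) (D := D) x
    have hl := tendsto_atTop_iInf hanti
    have : ⨅ n, killed P D (fun _ => 1) n x = 0 := by
      by_contra hne
      refine hfin (top_le_iff.1 ?_)
      calc (∞ : ℝ≥0∞) = (∑' k, powIncr q k) * ⨅ n, killed P D (fun _ => 1) n x := by
            rw [tsum_powIncr hq, ENNReal.top_mul hne]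
        _ = ∑' k, powIncr q k * ⨅ n, killed P D (fun _ => 1) n x := ENNReal.tsum_mul_right.symm
        _ ≤ _ := ENNReal.tsum_le_tsum fun k => by gcongr; exact iInf_le _ k
    rwa [this] at hl
  -- Dominated convergence for counting measure; the majorant is the unshifted series, finite by
  -- assumption.
  have hlim : Tendsto (fun n => C * ∑' k, powIncr q k * killed P D (fun _ => 1) (k + n) x) atTop
      (𝓝 (C * ∑' _ : ℕ, (0 : ℝ≥0∞))) := by
    refine ENNReal.Tendsto.const_mul ?_ (Or.inr hC)
    simp_rw [← lintegral_count]
    refine tendsto_lintegral_of_dominated_convergence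
      (fun k => powIncr q k * killed P D (fun _ => 1) k x) (fun n => measurable_from_nat)
      (fun n => Eventually.of_forall fun k => ?_) (by rwa [lintegral_count])
      (Eventually.of_forall fun k => ?_)
    · exact mul_le_mul_right (killed_one_antitone x (Nat.le_add_right k n)) _
    · have := ENNReal.Tendsto.const_mul (a := powIncr q k)
        (hlim0.comp (tendsto_add_atTop_nat k)) (Or.inr ENNReal.ofReal_ne_top)
      simpa [Function.comp_def, add_comm] using this
  have := ge_of_tendsto' hlim hbound
  simp only [tsum_zero, mul_zero, nonpos_iff_eq_zero] at this
  exact hx this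

/-- After one step the remaining exit time is shorter, so its moment is smaller on average. In the
series this is an index shift, harmless because the increments are nondecreasing for q ≥ 1. -/
lemma lintegral_tsum_powIncr_le (hD : MeasurableSet D) {q : ℝ} (hq : 1 ≤ q) {x : E} (hx : x ∈ D) :
    ∫⁻ z, ∑' k, powIncr q k * killed P D (fun _ => 1) k z ∂(P x) ≤
      ∑' k, powIncr q k * killed P D (fun _ => 1) k x := by
  have hm := fun k => measurable_killed (P := P) hD (measurable_const (a := (1 : ℝ≥0∞))) k
  rw [lintegral_tsum fun k => ((hm k).const_mul _).aemeasurable]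
  refine le_trans (ENNReal.tsum_le_tsum fun k => ?_)
    (ENNReal.tsum_comp_le_tsum_of_injective (add_left_injective 1) _)
  rw [lintegral_const_mul _ (hm k), killed_succ_of_mem hx]
  gcongr
  exact powIncr_mono hq (Nat.le_succ k)

end Criteria

/-! ### Beta integrals and the evaluation of the stable jump integral. -/

section BetaIntegrals

/-- Both claims are read off from the normalisation of the beta density. -/
lemma integrableOn_beta {a b : ℝ} (ha : 0 < a) (hb : 0 < b) :
    IntegrableOn (fun x : ℝ => x ^ (a - 1) * (1 - x) ^ (b - 1)) (Ioo 0 1) ∧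
      ∫ x in Ioo (0 : ℝ) 1, x ^ (a - 1) * (1 - x) ^ (b - 1) = beta a b := by
  have hB := beta_pos ha hb
  have h1 := lintegral_betaPDF_eq_one ha hb
  rw [lintegral_betaPDF] at h1
  have hnn : 0 ≤ᵐ[volume.restrict (Ioo (0 : ℝ) 1)]
      fun x => 1 / beta a b * x ^ (a - 1) * (1 - x) ^ (b - 1) := by
    refine ae_restrict_of_forall_mem measurableSet_Ioo fun x hx => ?_
    have := hx.1
    have : 0 < 1 - x := by linarith [hx.2]
    simp only [Pi.zero_apply]
    positivity
  have hmeas : AEStronglyMeasurable (fun x => 1 / beta a b * x ^ (a - 1) * (1 - x) ^ (b - 1))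
      (volume.restrict (Ioo (0 : ℝ) 1)) := Measurable.aestronglyMeasurable (by fun_prop)
  have hint : IntegrableOn (fun x => 1 / beta a b * x ^ (a - 1) * (1 - x) ^ (b - 1))
      (Ioo (0 : ℝ) 1) := by
    refine ⟨hmeas, ?_⟩
    rw [hasFiniteIntegral_iff_ofReal hnn, h1]
    simp
  have hval := integral_eq_lintegral_of_nonneg_ae hnn hmeas
  rw [h1, ENNReal.toReal_one] at hval
  have e : (fun x : ℝ => x ^ (a - 1) * (1 - x) ^ (b - 1)) =
      fun x => beta a b * (1 / beta a b * x ^ (a - 1) * (1 - x) ^ (b - 1)) := by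
    ext x; field_simp
  rw [e]
  refine ⟨hint.const_mul _, ?_⟩
  rw [integral_const_mul, hval, mul_one]

lemma image_div_one_sub : (fun x : ℝ => x / (1 - x)) '' Ioo 0 1 = Ioi 0 := by
  ext t
  constructor
  · rintro ⟨x, hx, rfl⟩
    exact div_pos hx.1 (by linarith [hx.2])
  · intro ht
    have ht : (0 : ℝ) < t := ht
    refine ⟨t / (1 + t), ⟨by positivity, by rw [div_lt_one (by positivity)]; linarith⟩, ?_⟩
    field_simp
    ring

/-- The substitution t = x/(1-x) carries the integral over (0, 1) to (0, ∞). -/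
lemma integrableOn_beta_Ioi {a b : ℝ} (ha : 0 < a) (hb : 0 < b) :
    IntegrableOn (fun t : ℝ => t ^ (a - 1) * (1 + t) ^ (-(a + b))) (Ioi 0) ∧
      ∫ t in Ioi (0 : ℝ), t ^ (a - 1) * (1 + t) ^ (-(a + b)) = beta a b := by
  have hd : ∀ x ∈ Ioo (0 : ℝ) 1,
      HasDerivWithinAt (fun x : ℝ => x / (1 - x)) (1 / (1 - x) ^ 2) (Ioo 0 1) x := by
    intro x hx
    have h1 : (1 - x) ≠ 0 := by linarith [hx.2]
    have := ((hasDerivAt_id x).div ((hasDerivAt_const x (1 : ℝ)).sub (hasDerivAt_id x)) h1)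
    refine (this.congr_deriv ?_).hasDerivWithinAt
    simp
  have hinj : InjOn (fun x : ℝ => x / (1 - x)) (Ioo 0 1) := by
    intro x hx y hy hxy
    have h1 : (1 - x) ≠ 0 := by linarith [hx.2]
    have h2 : (1 - y) ≠ 0 := by linarith [hy.2]
    simp only at hxy
    rw [div_eq_div_iff h1 h2] at hxy
    linarith
  have e : ∀ x ∈ Ioo (0 : ℝ) 1, |1 / (1 - x) ^ 2| •
      ((x / (1 - x)) ^ (a - 1) * (1 + x / (1 - x)) ^ (-(a + b))) =
      x ^ (a - 1) * (1 - x) ^ (b - 1) := by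
    intro x hx
    have h1 : 0 < 1 - x := by linarith [hx.2]
    have h2 : 1 + x / (1 - x) = (1 - x)⁻¹ := by field_simp; ring
    rw [h2, Real.div_rpow hx.1.le h1.le, Real.inv_rpow h1.le, Real.rpow_neg h1.le, inv_inv,
      abs_of_pos (by positivity), smul_eq_mul, ← Real.rpow_natCast (1 - x) 2]
    have h3 : (1 - x) ^ (b - 1) =
        (1 - x) ^ (a + b) / ((1 - x) ^ ((2 : ℕ) : ℝ) * (1 - x) ^ (a - 1)) := by
      rw [← Real.rpow_add h1, ← Real.rpow_sub h1]; congr 1; push_cast; ring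
    rw [h3]
    field_simp
  obtain ⟨hi, hv⟩ := integrableOn_beta ha hb
  rw [← image_div_one_sub, integrableOn_image_iff_integrableOn_abs_deriv_smul measurableSet_Ioo hd
    hinj, integral_image_eq_integral_abs_deriv_smul measurableSet_Ioo hd hinj,
    setIntegral_congr_fun measurableSet_Ioo e]
  exact ⟨hi.congr_fun (fun x hx => (e x hx).symm) measurableSet_Ioo, hv⟩

/-- Derivative in `t` of `((1 + t)^ν - 1 - ν t) / ν`. -/
noncomputable def gOut (ν t : ℝ) : ℝ := (1 + t) ^ (ν - 1) - 1

/-- Derivative in `t` of `(|1 - t|^ν - 1 + ν t) / ν`. -/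
noncomputable def gIn (ν t : ℝ) : ℝ :=
  if t < 1 then 1 - (1 - t) ^ (ν - 1) else 1 + (t - 1) ^ (ν - 1)

@[fun_prop]
lemma measurable_gOut (ν : ℝ) : Measurable (gOut ν) := by unfold gOut; fun_prop

@[fun_prop]
lemma measurable_gIn (ν : ℝ) : Measurable (gIn ν) :=
  Measurable.ite measurableSet_Iio (by fun_prop) (by fun_prop)

variable {α ν : ℝ}

/-- Since |ν - 1| < 1, the power lies between (1+t)^(-1) and 1 + t. The linear bound makes the
integral against t^(-α) converge at 0, as α < 2. -/
lemma abs_gOut_le (hν : 0 < ν) (hν2 : ν < 2) {t : ℝ} (ht : 0 < t) : |gOut ν t| ≤ t := by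
  have h1 : (1 : ℝ) ≤ 1 + t := by linarith
  have hu : (1 + t) ^ (ν - 1) ≤ (1 + t) ^ (1 : ℝ) := Real.rpow_le_rpow_of_exponent_le h1 (by linarith)
  have hl : (1 + t) ^ (-1 : ℝ) ≤ (1 + t) ^ (ν - 1) :=
    Real.rpow_le_rpow_of_exponent_le h1 (by linarith)
  rw [Real.rpow_one] at hu
  rw [Real.rpow_neg_one] at hl
  have : 1 - t ≤ (1 + t)⁻¹ := by
    rw [← one_div, le_div_iff₀ (by linarith)]; nlinarith
  rw [gOut, abs_le]
  constructor <;> linarith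

lemma abs_gOut_le_of_one_le (hν2 : ν < 2) {t : ℝ} (ht : 1 ≤ t) :
    |gOut ν t| ≤ 2 * t ^ (ν - 1) + 2 := by
  have ht0 : 0 < t := by linarith
  have h6 : 0 < t ^ (ν - 1) := by positivity
  have h2 : (1 + t) ^ (ν - 1) ≤ 2 * t ^ (ν - 1) + 1 := by
    rcases le_total ν 1 with h | h
    · have := Real.rpow_le_one_of_one_le_of_nonpos (x := 1 + t) (by linarith) (by linarith : ν - 1 ≤ 0)
      linarith
    · have h3 : (1 + t) ^ (ν - 1) ≤ (2 * t) ^ (ν - 1) :=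
        Real.rpow_le_rpow (by linarith) (by linarith) (by linarith)
      rw [Real.mul_rpow (by norm_num) ht0.le] at h3
      have h4 : (2 : ℝ) ^ (ν - 1) ≤ 2 ^ (1 : ℝ) :=
        Real.rpow_le_rpow_of_exponent_le (by norm_num) (by linarith)
      rw [Real.rpow_one] at h4
      nlinarith
  have h5 : 0 < (1 + t) ^ (ν - 1) := by positivity
  rw [gOut, abs_le]
  constructor <;> linarith

lemma integrableOn_gOut (hα1 : 1 < α) (hα2 : α < 2) (hν : 0 < ν) (hνα : ν < α) :
    IntegrableOn (fun t => gOut ν t * t ^ (-α)) (Ioi 0) := by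
  rw [← Ioc_union_Ioi_eq_Ioi (zero_le_one : (0 : ℝ) ≤ 1)]
  refine IntegrableOn.union ?_ ?_
  · have h1 : IntegrableOn (fun t : ℝ => t ^ (1 - α)) (Ioc 0 1) := by
      rw [integrableOn_Ioc_iff_integrableOn_Ioo,
        intervalIntegral.integrableOn_Ioo_rpow_iff zero_lt_one]
      linarith
    refine h1.mono' (Measurable.aestronglyMeasurable (by fun_prop)) ?_
    refine ae_restrict_of_forall_mem measurableSet_Ioc fun t ht => ?_
    have ht0 := ht.1
    rw [Real.norm_eq_abs, abs_mul, abs_of_pos (Real.rpow_pos_of_pos ht0 _),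
      Real.rpow_sub ht0, Real.rpow_one, Real.rpow_neg ht0.le, div_eq_mul_inv]
    gcongr
    exact abs_gOut_le hν (by linarith) ht0
  · have h1 : IntegrableOn (fun t : ℝ => 2 * t ^ (ν - 1 - α) + 2 * t ^ (-α)) (Ioi 1) :=
      ((integrableOn_Ioi_rpow_of_lt (by linarith) one_pos).const_mul 2).add
        ((integrableOn_Ioi_rpow_of_lt (by linarith) one_pos).const_mul 2)
    refine h1.mono' (Measurable.aestronglyMeasurable (by fun_prop)) ?_
    refine ae_restrict_of_forall_mem measurableSet_Ioi fun t ht => ?_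
    have ht1 : (1 : ℝ) < t := ht
    have ht0 : 0 < t := by linarith
    rw [Real.norm_eq_abs, abs_mul, abs_of_pos (Real.rpow_pos_of_pos ht0 _), sub_eq_add_neg (ν - 1) α,
      Real.rpow_add ht0, ← mul_assoc, ← add_mul]
    gcongr
    exact abs_gOut_le_of_one_le (by linarith) ht1.le

/-- Integration by parts with F = `gOut` t^(1-α)/(1-α). F vanishes at 0 by the linear bound and at ∞
because ν < α and 1 < α; what remains is a beta integral. -/
lemma integral_gOut (hα1 : 1 < α) (hα2 : α < 2) (hν : 0 < ν) (hνα : ν < α) :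
    ∫ t in Ioi (0 : ℝ), gOut ν t * t ^ (-α) = (ν - 1) / (α - 1) * beta (2 - α) (α - ν) := by
  obtain ⟨hbi, hbv⟩ := integrableOn_beta_Ioi (a := 2 - α) (b := α - ν) (by linarith) (by linarith)
  have hAi := integrableOn_gOut hα1 hα2 hν hνα
  have hα0 : 1 - α ≠ 0 := by linarith
  set F : ℝ → ℝ := fun t => gOut ν t * t ^ (1 - α) / (1 - α) with hF
  set f' : ℝ → ℝ := fun t => gOut ν t * t ^ (-α) +
    (ν - 1) / (1 - α) * (t ^ (2 - α - 1) * (1 + t) ^ (-(2 - α + (α - ν)))) with hf'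
  have hderiv : ∀ t ∈ Ioi (0 : ℝ), HasDerivAt F (f' t) t := by
    intro t ht
    have ht0 : (0 : ℝ) < t := ht
    have d1 : HasDerivAt (gOut ν) ((ν - 1) * (1 + t) ^ (ν - 1 - 1)) t := by
      have := (((hasDerivAt_id t).const_add 1).rpow_const (p := ν - 1)
        (Or.inl (by simp only [id]; linarith))).sub_const 1
      refine this.congr_deriv ?_
      simp
    have d2 := Real.hasDerivAt_rpow_const (x := t) (p := 1 - α) (Or.inl ht0.ne')
    refine ((d1.mul d2).div_const (1 - α)).congr_deriv ?_
    rw [hf']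
    have e1 : 1 - α - 1 = -α := by ring
    have e2 : 2 - α - 1 = 1 - α := by ring
    have e3 : -(2 - α + (α - ν)) = ν - 1 - 1 := by ring
    simp only [e1, e2, e3]
    field_simp
    ring
  have hFabs : ∀ t, 0 < t → |F t| ≤ t ^ (2 - α) / (α - 1) := by
    intro t ht
    rw [hF]
    simp only
    rw [abs_div, abs_mul, abs_of_pos (Real.rpow_pos_of_pos ht _), abs_of_neg (by linarith : 1 - α < 0),
      neg_sub, show (2 : ℝ) - α = 1 + (1 - α) by ring, Real.rpow_add ht, Real.rpow_one]
    have : 0 < α - 1 := by linarith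
    gcongr
    exact abs_gOut_le hν (by linarith) ht
  have hα0' : 0 < α - 1 := by linarith
  have hF0 : F 0 = 0 := by simp [hF, gOut]
  have hcont : ContinuousWithinAt F (Ici 0) 0 := by
    have h1 : Tendsto (fun t : ℝ => t ^ (2 - α) / (α - 1)) (𝓝[≥] 0) (𝓝 0) := by
      have : ContinuousAt (fun t : ℝ => t ^ (2 - α) / (α - 1)) 0 :=
        (Real.continuousAt_rpow_const 0 (2 - α) (Or.inr (by linarith))).div_const _
      have h := this.tendsto.mono_left (nhdsWithin_le_nhds (s := Ici 0))
      rwa [Real.zero_rpow (by linarith), zero_div] at h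
    rw [ContinuousWithinAt, hF0]
    refine squeeze_zero_norm' ?_ h1
    filter_upwards [self_mem_nhdsWithin] with t ht
    rcases eq_or_lt_of_le (show (0 : ℝ) ≤ t from ht) with rfl | ht
    · rw [hF0, norm_zero]; positivity
    · exact hFabs t ht
  have hlim : Tendsto F atTop (𝓝 0) := by
    have h2 : Tendsto (fun t : ℝ => (2 * t ^ (ν - α) + 2 * t ^ (1 - α)) / (α - 1)) atTop
        (𝓝 ((2 * 0 + 2 * 0) / (α - 1))) := by
      refine Tendsto.div_const (Tendsto.add (Tendsto.const_mul _ ?_) (Tendsto.const_mul _ ?_)) _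
      · simpa using tendsto_rpow_neg_atTop (y := α - ν) (by linarith)
      · simpa using tendsto_rpow_neg_atTop (y := α - 1) (by linarith)
    rw [mul_zero, add_zero, zero_div] at h2
    refine squeeze_zero_norm' ?_ h2
    filter_upwards [eventually_ge_atTop 1] with t ht
    have ht0 : 0 < t := by linarith
    rw [hF, Real.norm_eq_abs]
    simp only
    rw [abs_div, abs_mul, abs_of_pos (Real.rpow_pos_of_pos ht0 _),
      abs_of_neg (by linarith : 1 - α < 0), neg_sub,
      show ν - α = (ν - 1) + (1 - α) by ring, Real.rpow_add ht0, ← mul_assoc, ← add_mul]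
    gcongr
    exact abs_gOut_le_of_one_le (by linarith) ht
  have hint := integral_Ioi_of_hasDerivAt_of_tendsto hcont hderiv
    (hAi.add (hbi.const_mul _)) hlim
  rw [hf', integral_add hAi (hbi.const_mul _), integral_const_mul, hbv, hF0, sub_zero] at hint
  have e : (ν - 1) / (1 - α) = -((ν - 1) / (α - 1)) := by
    rw [← div_neg, neg_sub]
  rw [e] at hint
  linarith

lemma one_sub_rpow_mem_Icc (hν : 0 < ν) (hν2 : ν < 2) {t : ℝ} (ht0 : 0 ≤ t) (ht1 : t ≤ 1) :
    1 - (1 - t) ^ ν ∈ Icc 0 (2 * t) := by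
  have h0 : 0 ≤ 1 - t := by linarith
  have h1 : (1 - t) ^ ν ≤ 1 := Real.rpow_le_one h0 (by linarith) hν.le
  have h2 : (1 - t) ^ (2 : ℝ) ≤ (1 - t) ^ ν := by
    rcases eq_or_lt_of_le h0 with h | h
    · rw [← h, Real.zero_rpow hν.ne', Real.zero_rpow two_ne_zero]
    · exact Real.rpow_le_rpow_of_exponent_ge h (by linarith) hν2.le
  rw [Real.rpow_two] at h2
  constructor <;> nlinarith

/-- Integration by parts, with boundary term 1/(1-α) at t = 1. The exponent is ν and not the ν - 1
of `gIn`: differentiating the latter would give (1-t)^(ν-2), which is not integrable at 1 when ν <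
1. -/
lemma integral_one_sub_rpow (hα1 : 1 < α) (hα2 : α < 2) (hν : 0 < ν) (hν2 : ν < 2) :
    IntegrableOn (fun t : ℝ => (1 - (1 - t) ^ ν) * t ^ (-α)) (Ioo 0 1) ∧
      ∫ t in Ioo (0 : ℝ) 1, (1 - (1 - t) ^ ν) * t ^ (-α) =
        1 / (1 - α) + ν / (α - 1) * beta (2 - α) ν := by
  obtain ⟨hbi, hbv⟩ := integrableOn_beta (a := 2 - α) (b := ν) (by linarith) hν
  have hα0 : 1 - α ≠ 0 := by linarith
  have hα0' : 0 < α - 1 := by linarith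
  have hCi : IntegrableOn (fun t : ℝ => (1 - (1 - t) ^ ν) * t ^ (-α)) (Ioo 0 1) := by
    have h1 : IntegrableOn (fun t : ℝ => 2 * t ^ (1 - α)) (Ioo 0 1) :=
      ((intervalIntegral.integrableOn_Ioo_rpow_iff zero_lt_one).2 (by linarith)).const_mul 2
    refine h1.mono' (Measurable.aestronglyMeasurable (by fun_prop)) ?_
    refine ae_restrict_of_forall_mem measurableSet_Ioo fun t ht => ?_
    have h := one_sub_rpow_mem_Icc hν hν2 ht.1.le ht.2.le
    have ht0 := ht.1
    rw [Real.norm_eq_abs, abs_mul, abs_of_pos (Real.rpow_pos_of_pos ht0 _),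
      Real.rpow_sub ht0, Real.rpow_one, Real.rpow_neg ht0.le, div_eq_mul_inv, ← mul_assoc,
      abs_of_nonneg h.1]
    gcongr
    exact h.2
  refine ⟨hCi, ?_⟩
  set F : ℝ → ℝ := fun t => (1 - (1 - t) ^ ν) * t ^ (1 - α) / (1 - α) with hF
  set f' : ℝ → ℝ := fun t => (1 - (1 - t) ^ ν) * t ^ (-α) +
    ν / (1 - α) * (t ^ (2 - α - 1) * (1 - t) ^ (ν - 1)) with hf'
  have hderiv : ∀ t ∈ Ioo (0 : ℝ) 1, HasDerivAt F (f' t) t := by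
    intro t ht
    have ht0 : (0 : ℝ) < t := ht.1
    have ht1 : 0 < 1 - t := by linarith [ht.2]
    have d1 : HasDerivAt (fun t : ℝ => 1 - (1 - t) ^ ν) (ν * (1 - t) ^ (ν - 1)) t := by
      have := (((hasDerivAt_id t).const_sub 1).rpow_const (p := ν)
        (Or.inl (by simp only [id]; linarith))).const_sub 1
      refine this.congr_deriv ?_
      simp
    have d2 := Real.hasDerivAt_rpow_const (x := t) (p := 1 - α) (Or.inl ht0.ne')
    refine ((d1.mul d2).div_const (1 - α)).congr_deriv ?_
    rw [hf']
    have e1 : 1 - α - 1 = -α := by ring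
    have e2 : 2 - α - 1 = 1 - α := by ring
    simp only [e1, e2]
    field_simp
    ring
  have hF0 : F 0 = 0 := by simp [hF]
  have hF1 : F 1 = 1 / (1 - α) := by simp [hF, Real.zero_rpow hν.ne']
  have hcont : ContinuousOn F (Icc 0 1) := by
    intro t ht
    rcases eq_or_lt_of_le ht.1 with rfl | ht0
    · have h1 : Tendsto (fun t : ℝ => 2 * t ^ (2 - α) / (α - 1)) (𝓝[Icc 0 1] 0) (𝓝 0) := by
        have : ContinuousAt (fun t : ℝ => 2 * t ^ (2 - α) / (α - 1)) 0 :=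
          ((Real.continuousAt_rpow_const 0 (2 - α) (Or.inr (by linarith))).const_mul 2).div_const _
        have h := this.tendsto.mono_left (nhdsWithin_le_nhds (s := Icc 0 1))
        rwa [Real.zero_rpow (by linarith), mul_zero, zero_div] at h
      rw [ContinuousWithinAt, hF0]
      refine squeeze_zero_norm' ?_ h1
      filter_upwards [self_mem_nhdsWithin] with t ht
      rcases eq_or_lt_of_le ht.1 with rfl | ht0
      · rw [hF0, norm_zero]; positivity
      · have h := one_sub_rpow_mem_Icc hν hν2 ht.1 ht.2
        rw [hF, Real.norm_eq_abs]
        simp only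
        rw [abs_div, abs_mul, abs_of_pos (Real.rpow_pos_of_pos ht0 _), abs_of_nonneg h.1,
          abs_of_neg (by linarith : 1 - α < 0), neg_sub, show (2 : ℝ) - α = 1 + (1 - α) by ring,
          Real.rpow_add ht0, Real.rpow_one, ← mul_assoc]
        gcongr
        exact h.2
    · refine ContinuousAt.continuousWithinAt ?_
      refine ContinuousAt.div_const (ContinuousAt.mul (continuousAt_const.sub ?_) ?_) _
      · exact (continuousAt_const.sub continuousAt_id).rpow_const (Or.inr hν.le)
      · exact continuousAt_id.rpow_const (Or.inl ht0.ne')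
  have hint := intervalIntegral.integral_eq_sub_of_hasDerivAt_of_le zero_le_one hcont hderiv
    (by
      rw [intervalIntegrable_iff_integrableOn_Ioo_of_le zero_le_one]
      exact hCi.add (hbi.const_mul _))
  rw [intervalIntegral.integral_of_le zero_le_one, integral_Ioc_eq_integral_Ioo, hf',
    integral_add hCi (hbi.const_mul _), integral_const_mul, hbv, hF0, hF1, sub_zero] at hint
  have e : ν / (1 - α) = -(ν / (α - 1)) := by
    rw [← div_neg, neg_sub]
  rw [e] at hint
  linarith

/-- On (0, 1), 1 - (1-t)^(ν-1) = (1 - (1-t)^ν) - t (1-t)^(ν-1), which reduces to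
`integral_one_sub_rpow` and a beta integral. On (1, ∞) the shift t = s + 1 gives another beta
integral, and the terms ±1/(α-1) cancel. -/
lemma integral_gIn (hα1 : 1 < α) (hα2 : α < 2) (hν : 0 < ν) (hνα : ν < α) :
    IntegrableOn (fun t => gIn ν t * t ^ (-α)) (Ioi 0) ∧
      ∫ t in Ioi (0 : ℝ), gIn ν t * t ^ (-α) =
        (ν / (α - 1) - 1) * beta (2 - α) ν + beta ν (α - ν) := by
  obtain ⟨hbi, hbv⟩ := integrableOn_beta (a := 2 - α) (b := ν) (by linarith) hν
  obtain ⟨hCi, hCv⟩ := integral_one_sub_rpow hα1 hα2 hν (by linarith)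
  obtain ⟨hdi, hdv⟩ := integrableOn_beta_Ioi (a := ν) (b := α - ν) hν (by linarith)
  have e01 : EqOn (fun t : ℝ => (1 - (1 - t) ^ ν) * t ^ (-α) - t ^ (2 - α - 1) * (1 - t) ^ (ν - 1))
      (fun t => gIn ν t * t ^ (-α)) (Ioo 0 1) := by
    intro t ht
    have ht1 : 0 < 1 - t := by linarith [ht.2]
    simp only [gIn, if_pos ht.2]
    have h1 : (1 - t) ^ ν = (1 - t) * (1 - t) ^ (ν - 1) := by
      rw [Real.rpow_sub_one ht1.ne']; field_simp
    have h2 : t ^ (2 - α - 1) = t * t ^ (-α) := by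
      rw [show 2 - α - 1 = 1 + -α by ring, Real.rpow_add ht.1, Real.rpow_one]
    rw [h1, h2]
    ring
  have h01i : IntegrableOn (fun t => gIn ν t * t ^ (-α)) (Ioo 0 1) :=
    IntegrableOn.congr_fun (hCi.sub hbi) e01 measurableSet_Ioo
  have h01v : ∫ t in Ioo (0 : ℝ) 1, gIn ν t * t ^ (-α) =
      1 / (1 - α) + ν / (α - 1) * beta (2 - α) ν - beta (2 - α) ν := by
    rw [← setIntegral_congr_fun measurableSet_Ioo e01, integral_sub hCi hbi, hCv, hbv]
  have himg : (fun s : ℝ => s + 1) '' Ioi 0 = Ioi 1 := by simp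
  have hd : ∀ x ∈ Ioi (0 : ℝ), HasDerivWithinAt (fun s : ℝ => s + 1) 1 (Ioi 0) x := fun x _ =>
    ((hasDerivAt_id x).add_const 1).hasDerivWithinAt
  have hinj : InjOn (fun s : ℝ => s + 1) (Ioi 0) := (add_left_injective 1).injOn
  have e1 : EqOn (fun s : ℝ => |(1 : ℝ)| • ((s + 1 - 1) ^ (ν - 1) * (s + 1) ^ (-α)))
      (fun s => s ^ (ν - 1) * (1 + s) ^ (-(ν + (α - ν)))) (Ioi 0) := by
    intro s _
    simp only [abs_one, one_smul, add_sub_cancel_right, add_sub_cancel]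
    rw [add_comm s 1]
  have hgi : IntegrableOn (fun t : ℝ => (t - 1) ^ (ν - 1) * t ^ (-α)) (Ioi 1) := by
    rw [← himg, integrableOn_image_iff_integrableOn_abs_deriv_smul measurableSet_Ioi hd hinj]
    exact IntegrableOn.congr_fun hdi e1.symm measurableSet_Ioi
  have hgv : ∫ t in Ioi (1 : ℝ), (t - 1) ^ (ν - 1) * t ^ (-α) = beta ν (α - ν) := by
    rw [← himg, integral_image_eq_integral_abs_deriv_smul measurableSet_Ioi hd hinj,
      setIntegral_congr_fun measurableSet_Ioi e1, hdv]
  have hri : IntegrableOn (fun t : ℝ => t ^ (-α)) (Ioi 1) :=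
    integrableOn_Ioi_rpow_of_lt (by linarith) one_pos
  have e2 : EqOn (fun t : ℝ => t ^ (-α) + (t - 1) ^ (ν - 1) * t ^ (-α))
      (fun t => gIn ν t * t ^ (-α)) (Ioi 1) := by
    intro t ht
    simp only [gIn, if_neg (not_lt.2 (le_of_lt (show (1 : ℝ) < t from ht)))]
    ring
  have h1i : IntegrableOn (fun t => gIn ν t * t ^ (-α)) (Ioi 1) :=
    IntegrableOn.congr_fun (hri.add hgi) e2 measurableSet_Ioi
  have h1v : ∫ t in Ioi (1 : ℝ), gIn ν t * t ^ (-α) = 1 / (α - 1) + beta ν (α - ν) := by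
    rw [← setIntegral_congr_fun measurableSet_Ioi e2, integral_add hri hgi, hgv,
      integral_Ioi_rpow_of_lt (by linarith) one_pos, Real.one_rpow,
      show -α + 1 = -(α - 1) by ring, neg_div_neg_eq]
  have h01i' := (integrableOn_Ioc_iff_integrableOn_Ioo (μ := volume)).2 h01i
  rw [← Ioc_union_Ioi_eq_Ioi (zero_le_one : (0 : ℝ) ≤ 1)]
  refine ⟨h01i'.union h1i, ?_⟩
  rw [setIntegral_union (Ioc_disjoint_Ioi le_rfl) measurableSet_Ioi h01i' h1i,
    integral_Ioc_eq_integral_Ioo, h01v, h1v]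
  have e : 1 / (1 - α) = -(1 / (α - 1)) := by rw [← div_neg, neg_sub]
  rw [e]
  ring

/-- The normalised integral of the stable Lévy measure against `|1 + u|^ν - 1 - ν u`. -/
lemma integral_gOut_add_integral_gIn (hα1 : 1 < α) (hα2 : α < 2) (hν : 0 < ν) (hνα : ν < α) :
    (∫ t in Ioi (0 : ℝ), gOut ν t * t ^ (-α)) + ∫ t in Ioi (0 : ℝ), gIn ν t * t ^ (-α) =
      -criticalFun α ν := by
  rw [integral_gOut hα1 hα2 hν hνα, (integral_gIn hα1 hα2 hν hνα).2]
  have h1 : Real.Gamma (2 - α) = (1 - α) * Real.Gamma (1 - α) := by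
    rw [show 2 - α = (1 - α) + 1 by ring, Real.Gamma_add_one (by linarith)]
  have hα0 : α - 1 ≠ 0 := by linarith
  unfold beta criticalFun
  rw [h1, show 2 - α + (α - ν) = 2 - ν by ring, show ν + (α - ν) = α by ring]
  field_simp
  ring

end BetaIntegrals

/-! ### The critical function: continuity, a root and boundary limits. -/

section CriticalFun

variable {α : ℝ}

lemma continuousAt_Gamma_of_pos {s : ℝ} (hs : 0 < s) : ContinuousAt Real.Gamma s :=
  (Real.differentiableAt_Gamma fun m => by
    have : (0 : ℝ) ≤ m := m.cast_nonneg
    linarith).continuousAt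

lemma continuousOn_criticalFun (hα2 : α < 2) :
    ContinuousOn (criticalFun α) (Ioo 0 α) := by
  have hG := @continuousAt_Gamma_of_pos
  intro ν hν
  have h1 : ContinuousAt (fun ν => Real.Gamma (α - ν)) ν :=
    ContinuousAt.comp (g := Real.Gamma) (hG (by linarith [hν.2])) (by fun_prop)
  have h2 : ContinuousAt (fun ν => Real.Gamma (2 - ν)) ν :=
    ContinuousAt.comp (g := Real.Gamma) (hG (by linarith [hν.2])) (by fun_prop)
  have h3 : ContinuousAt (fun ν => Real.Gamma (2 - α + ν)) ν :=
    ContinuousAt.comp (g := Real.Gamma) (hG (by linarith [hν.1])) (by fun_prop)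
  have h4 := hG hν.1
  have h2' : Real.Gamma (2 - ν) ≠ 0 := (Real.Gamma_pos_of_pos (by linarith [hν.2])).ne'
  have h3' : Real.Gamma (2 - α + ν) ≠ 0 := (Real.Gamma_pos_of_pos (by linarith [hν.1])).ne'
  have h5 : ContinuousAt (fun ν : ℝ => ν - 1) ν := by fun_prop
  have h6 : ContinuousAt (fun ν : ℝ => (1 - α + ν) * Real.Gamma (1 - α)) ν := by fun_prop
  exact ((h5.mul ((h1.const_mul _).div h2 h2')).add
    (h4.mul ((h6.div h3 h3').sub (h1.div_const _)))).continuousWithinAt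

/-- This identifies the critical exponent for zero drift. At ν = α - 1 the factor 1 - α + ν
vanishes, and the functional equation of Γ cancels the two other terms. -/
lemma criticalFun_sub_one (hα1 : 1 < α) (hα2 : α < 2) : criticalFun α (α - 1) = 0 := by
  have h1 : Real.Gamma (2 - α) = (1 - α) * Real.Gamma (1 - α) := by
    rw [show 2 - α = (1 - α) + 1 by ring, Real.Gamma_add_one (by linarith)]
  have h2 : Real.Gamma (3 - α) = (2 - α) * Real.Gamma (2 - α) := by
    rw [show 3 - α = (2 - α) + 1 by ring, Real.Gamma_add_one (by linarith)]
  have h3 : Real.Gamma α = (α - 1) * Real.Gamma (α - 1) := by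
    conv_lhs => rw [show α = (α - 1) + 1 by ring, Real.Gamma_add_one (by linarith)]
  have hg1 : Real.Gamma (2 - α) ≠ 0 := (Real.Gamma_pos_of_pos (by linarith)).ne'
  have hg2 : Real.Gamma (α - 1) ≠ 0 := (Real.Gamma_pos_of_pos (by linarith)).ne'
  rw [h1] at hg1
  have hg3 : Real.Gamma (1 - α) ≠ 0 := right_ne_zero_of_mul hg1
  have ha : 1 - α ≠ 0 := by linarith
  have hb : α - 1 ≠ 0 := by linarith
  have hc : 2 - α ≠ 0 := by linarith
  unfold criticalFun
  rw [show α - (α - 1) = 1 by ring, show 2 - (α - 1) = 3 - α by ring,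
    show 1 - α + (α - 1) = 0 by ring, h2, h1, h3, Real.Gamma_one]
  field_simp
  ring

/-- The pole of Γ(ν) at 0 meets a zero of its cofactor. Writing Γ(ν) = Γ(ν+1)/ν and using the
reflection formula turns the product into a bounded factor times a difference quotient of π /
sin(π(α-ν)), and double-angle formulas simplify the limit. -/
lemma tendsto_criticalFun_left (hα1 : 1 < α) (hα2 : α < 2) :
    Tendsto (criticalFun α) (𝓝[>] 0) (𝓝 (-(Real.pi * Real.cot (Real.pi * α / 2)))) := by
  have hG := @continuousAt_Gamma_of_pos
  have hsin : Real.sin (Real.pi * α) ≠ 0 := by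
    have h := Real.sin_neg_of_neg_of_neg_pi_lt (x := Real.pi * (α - 2))
      (mul_neg_of_pos_of_neg Real.pi_pos (by linarith)) (by nlinarith [Real.pi_pos])
    rw [show Real.pi * (α - 2) = Real.pi * α - 2 * Real.pi by ring, Real.sin_sub_two_pi] at h
    exact h.ne
  have hrefl : ∀ ν, Real.Gamma (α - ν) * Real.Gamma (1 - α + ν) =
      Real.pi / Real.sin (Real.pi * (α - ν)) := fun ν => by
    rw [← Real.Gamma_mul_Gamma_one_sub, show 1 - (α - ν) = 1 - α + ν by ring]
  have hrefl0 : Real.Gamma α * Real.Gamma (1 - α) = Real.pi / Real.sin (Real.pi * α) :=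
    Real.Gamma_mul_Gamma_one_sub α
  have hgα : Real.Gamma α ≠ 0 := (Real.Gamma_pos_of_pos (by linarith)).ne'
  have hg1 : Real.Gamma (1 - α) ≠ 0 := by
    intro h
    rw [h, mul_zero] at hrefl0
    exact absurd hrefl0.symm (div_ne_zero Real.pi_ne_zero hsin)
  -- the function `π / sin (π (α - ν))`
  have hder : HasDerivAt (fun ν => Real.pi / Real.sin (Real.pi * (α - ν)))
      (Real.pi ^ 2 * Real.cos (Real.pi * α) / Real.sin (Real.pi * α) ^ 2) 0 := by
    have h1 : HasDerivAt (fun ν : ℝ => Real.pi * (α - ν)) (-Real.pi) 0 := by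
      simpa using ((hasDerivAt_id (0 : ℝ)).const_sub α).const_mul Real.pi
    have h2 := (hasDerivAt_const (0 : ℝ) Real.pi).div h1.sin (by simpa using hsin)
    refine h2.congr_deriv ?_
    simp only [sub_zero]
    ring
  have hslope : Tendsto (fun ν => ν⁻¹ * (Real.pi / Real.sin (Real.pi * α) -
      Real.pi / Real.sin (Real.pi * (α - ν)))) (𝓝[>] 0)
      (𝓝 (-(Real.pi ^ 2 * Real.cos (Real.pi * α) / Real.sin (Real.pi * α) ^ 2))) := by
    have := (hasDerivAt_iff_tendsto_slope_zero.1 hder).mono_left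
      (nhdsWithin_mono (0 : ℝ) (fun x (hx : 0 < x) => hx.ne'))
    refine this.neg.congr fun ν => ?_
    simp only [zero_add, sub_zero, smul_eq_mul]
    ring
  have hlim : ∀ {f : ℝ → ℝ} {y : ℝ}, ContinuousAt f 0 → f 0 = y → Tendsto f (𝓝[>] 0) (𝓝 y) :=
    fun hf h => h ▸ hf.tendsto.mono_left nhdsWithin_le_nhds
  have h1 : ContinuousAt (fun ν => Real.Gamma (α - ν)) 0 :=
    ContinuousAt.comp (g := Real.Gamma) (hG (by linarith)) (by fun_prop)
  have h2 : ContinuousAt (fun ν => Real.Gamma (2 - ν)) 0 :=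
    ContinuousAt.comp (g := Real.Gamma) (hG (by linarith)) (by fun_prop)
  have h3 : ContinuousAt (fun ν => Real.Gamma (2 - α + ν)) 0 :=
    ContinuousAt.comp (g := Real.Gamma) (hG (by linarith)) (by fun_prop)
  have h4 : ContinuousAt (fun ν => Real.Gamma (ν + 1)) 0 :=
    ContinuousAt.comp (g := Real.Gamma) (hG (by linarith)) (by fun_prop)
  have h2' : Real.Gamma (2 - (0 : ℝ)) ≠ 0 := (Real.Gamma_pos_of_pos (by linarith)).ne'
  have h3' : Real.Gamma (2 - α + 0) ≠ 0 := (Real.Gamma_pos_of_pos (by linarith)).ne'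
  have hΓ2 : Real.Gamma 2 = 1 := by
    rw [show (2 : ℝ) = 1 + 1 by norm_num, Real.Gamma_add_one one_ne_zero, Real.Gamma_one, one_mul]
  have h2α : Real.Gamma (2 - α) = (1 - α) * Real.Gamma (1 - α) := by
    rw [show 2 - α = (1 - α) + 1 by ring, Real.Gamma_add_one (by linarith)]
  have hA : Tendsto (fun ν => (ν - 1) * (Real.Gamma (1 - α) * Real.Gamma (α - ν) / Real.Gamma (2 - ν)))
      (𝓝[>] 0) (𝓝 (-(Real.pi / Real.sin (Real.pi * α)))) := by
    refine hlim (ContinuousAt.mul (by fun_prop) ((h1.const_mul _).div h2 h2')) ?_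
    rw [← hrefl0, sub_zero, sub_zero, hΓ2]; ring
  have hK : Tendsto (fun ν => Real.Gamma (ν + 1) * ((1 - α + ν) / Real.Gamma (2 - α + ν)) /
      Real.Gamma α) (𝓝[>] 0) (𝓝 (Real.sin (Real.pi * α) / Real.pi)) := by
    refine hlim ((h4.mul (ContinuousAt.div (by fun_prop) h3 h3')).div_const _) ?_
    have : Real.sin (Real.pi * α) / Real.pi = (Real.Gamma α * Real.Gamma (1 - α))⁻¹ := by
      rw [hrefl0, inv_div]
    rw [this, zero_add, Real.Gamma_one, add_zero, add_zero, h2α]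
    have : 1 - α ≠ 0 := by linarith
    field_simp
  have hsum := hA.add (hK.mul hslope)
  have hval : -(Real.pi / Real.sin (Real.pi * α)) + Real.sin (Real.pi * α) / Real.pi *
      -(Real.pi ^ 2 * Real.cos (Real.pi * α) / Real.sin (Real.pi * α) ^ 2) =
      -(Real.pi * Real.cot (Real.pi * α / 2)) := by
    have e1 : Real.sin (Real.pi * α) =
        2 * Real.sin (Real.pi * α / 2) * Real.cos (Real.pi * α / 2) := by
      rw [← Real.sin_two_mul]; congr 1; ring
    have e2 : Real.cos (Real.pi * α) = 2 * Real.cos (Real.pi * α / 2) ^ 2 - 1 := by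
      rw [← Real.cos_two_mul]; congr 1; ring
    rw [Real.cot_eq_cos_div_sin]
    rw [e1] at hsin ⊢
    rw [e2]
    have hs : Real.sin (Real.pi * α / 2) ≠ 0 := fun h => hsin (by rw [h]; ring)
    have hc : Real.cos (Real.pi * α / 2) ≠ 0 := fun h => hsin (by rw [h]; ring)
    have := Real.pi_ne_zero
    field_simp
    ring
  rw [hval] at hsum
  refine hsum.congr' ?_
  -- For ν < α - 1 the factor 1 - α + ν is nonzero, so Γ(2-α+ν) = (1-α+ν)Γ(1-α+ν) may be divided
  -- through.
  filter_upwards [Ioo_mem_nhdsGT (show (0 : ℝ) < α - 1 by linarith)] with ν hν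
  unfold criticalFun
  congr 1
  have hν0 : ν ≠ 0 := hν.1.ne'
  have hne : 1 - α + ν ≠ 0 := by linarith [hν.2]
  have g1 : Real.Gamma (ν + 1) = ν * Real.Gamma ν := Real.Gamma_add_one hν0
  have g2 : Real.Gamma (2 - α + ν) = (1 - α + ν) * Real.Gamma (1 - α + ν) := by
    rw [show 2 - α + ν = (1 - α + ν) + 1 by ring, Real.Gamma_add_one hne]
  have g3 : Real.Gamma (1 - α + ν) ≠ 0 := by
    have : Real.Gamma (2 - α + ν) ≠ 0 := (Real.Gamma_pos_of_pos (by linarith [hν.1])).ne'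
    rw [g2] at this
    exact right_ne_zero_of_mul this
  rw [← hrefl0, ← hrefl ν, g1, g2]
  field_simp

/-- Collecting the terms in Γ(α-ν), which tends to +∞, their coefficient tends to -2 while the rest
stays bounded. -/
lemma tendsto_criticalFun_right (hα1 : 1 < α) (hα2 : α < 2) :
    Tendsto (criticalFun α) (𝓝[<] α) atBot := by
  have hG := @continuousAt_Gamma_of_pos
  have hgα : 0 < Real.Gamma α := Real.Gamma_pos_of_pos (by linarith)
  have h2α : Real.Gamma (2 - α) = (1 - α) * Real.Gamma (1 - α) := by
    rw [show 2 - α = (1 - α) + 1 by ring, Real.Gamma_add_one (by linarith)]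
  have h2αp : 0 < Real.Gamma (2 - α) := Real.Gamma_pos_of_pos (by linarith)
  have h2 : ContinuousAt (fun ν => Real.Gamma (2 - ν)) α :=
    ContinuousAt.comp (g := Real.Gamma) (hG (by linarith)) (by fun_prop)
  have h3 : ContinuousAt (fun ν => Real.Gamma (2 - α + ν)) α :=
    ContinuousAt.comp (g := Real.Gamma) (hG (by linarith)) (by fun_prop)
  have h4 := hG (s := α) (by linarith)
  have h3' : Real.Gamma (2 - α + α) ≠ 0 := (Real.Gamma_pos_of_pos (by linarith)).ne'
  have hlim : ∀ {f : ℝ → ℝ} {y : ℝ}, ContinuousAt f α → f α = y → Tendsto f (𝓝[<] α) (𝓝 y) :=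
    fun hf h => h ▸ hf.tendsto.mono_left nhdsWithin_le_nhds
  have hcoef : Tendsto (fun ν => (ν - 1) * Real.Gamma (1 - α) / Real.Gamma (2 - ν) -
      Real.Gamma ν / Real.Gamma α) (𝓝[<] α) (𝓝 (-2)) := by
    refine hlim ((ContinuousAt.div (by fun_prop) h2 h2αp.ne').sub (h4.div_const _)) ?_
    rw [div_self hgα.ne', h2α]
    rw [h2α] at h2αp
    have hne : Real.Gamma (1 - α) ≠ 0 := right_ne_zero_of_mul h2αp.ne'
    have : 1 - α ≠ 0 := by linarith
    field_simp
    ring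
  have hrest : Tendsto (fun ν => Real.Gamma ν * ((1 - α + ν) * Real.Gamma (1 - α) /
      Real.Gamma (2 - α + ν))) (𝓝[<] α) (𝓝 (Real.Gamma α * ((1 - α + α) * Real.Gamma (1 - α) /
      Real.Gamma (2 - α + α)))) :=
    hlim (h4.mul (ContinuousAt.div (by fun_prop) h3 h3')) rfl
  have hGtop : Tendsto (fun ν => Real.Gamma (α - ν)) (𝓝[<] α) atTop := by
    have h1 : ContinuousAt (fun ν => Real.Gamma (α - ν + 1)) α :=
      ContinuousAt.comp (g := Real.Gamma) (hG (by linarith)) (by fun_prop)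
    have h1' : Tendsto (fun ν => Real.Gamma (α - ν + 1)) (𝓝[<] α) (𝓝 1) :=
      hlim h1 (by simp)
    have hinv : Tendsto (fun ν : ℝ => (α - ν)⁻¹) (𝓝[<] α) atTop := by
      refine tendsto_inv_nhdsGT_zero.comp (tendsto_nhdsWithin_iff.2 ⟨?_, ?_⟩)
      · have : ContinuousAt (fun ν : ℝ => α - ν) α := by fun_prop
        exact hlim this (by simp)
      · filter_upwards [self_mem_nhdsWithin] with ν hν
        exact sub_pos.2 (show ν < α from hν)
    refine (h1'.pos_mul_atTop one_pos hinv).congr' ?_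
    filter_upwards [self_mem_nhdsWithin] with ν hν
    have : α - ν ≠ 0 := (sub_pos.2 (show ν < α from hν)).ne'
    rw [Real.Gamma_add_one this]
    field_simp
  refine ((hcoef.neg_mul_atTop (by norm_num) hGtop).atBot_add hrest).congr fun ν => ?_
  unfold criticalFun
  ring

/-- The critical equation has a solution when the drift is below the transience threshold. -/
lemma exists_criticalFun_eq (hα1 : 1 < α) (hα2 : α < 2) {y : ℝ}
    (hy : y + Real.pi * Real.cot (Real.pi * α / 2) < 0) :
    ∃ ν ∈ Ioo 0 α, criticalFun α ν = y := by
  have h1 := (tendsto_criticalFun_left hα1 hα2).eventually (lt_mem_nhds (show y < _ by linarith))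
  have h2 := (tendsto_criticalFun_right hα1 hα2).eventually (eventually_lt_atBot y)
  obtain ⟨ν₁, h1, hν₁⟩ := (h1.and (Ioo_mem_nhdsGT (show (0 : ℝ) < α by linarith))).exists
  obtain ⟨ν₂, h2, hν₂⟩ := (h2.and (Ioo_mem_nhdsLT (show (0 : ℝ) < α by linarith))).exists
  obtain ⟨ν, hν, h⟩ := isPreconnected_Ioo.intermediate_value hν₂ hν₁
    (continuousOn_criticalFun hα2) ⟨h2.le, h1.le⟩
  exact ⟨ν, hν, h⟩

end CriticalFun

/-- Layer-cake formula for a function `g` of arbitrary sign. -/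
lemma integral_comp_intervalIntegral {Ω : Type*} [MeasurableSpace Ω] {ρ : Measure Ω}
    [IsFiniteMeasure ρ] {f : Ω → ℝ} (hf : Measurable f) (hf0 : ∀ ω, 0 ≤ f ω) {g : ℝ → ℝ}
    (hg : Measurable g)
    (hint : IntegrableOn (fun t => g t * ρ.real {ω | t < f ω}) (Ioi 0)) :
    Integrable (fun ω => ∫ t in (0 : ℝ)..f ω, g t) ρ ∧
      ∫ ω, (∫ t in (0 : ℝ)..f ω, g t) ∂ρ = ∫ t in Ioi (0 : ℝ), g t * ρ.real {ω | t < f ω} := by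
  set F : Ω → ℝ → ℝ := fun ω t => {p : Ω × ℝ | p.2 < f p.1}.indicator (fun p => g p.2) (ω, t) with hF
  have hms : MeasurableSet {p : Ω × ℝ | p.2 < f p.1} :=
    measurableSet_lt measurable_snd (hf.comp measurable_fst)
  have hFm : Measurable (Function.uncurry F) := (hg.comp measurable_snd).indicator hms
  have hFt : ∀ t, (fun ω => F ω t) = {ω | t < f ω}.indicator fun _ => g t := by
    intro t; ext ω; simp [hF, indicator]
  have hmt : ∀ t, MeasurableSet {ω | t < f ω} := fun t => measurableSet_lt measurable_const hf
  have hFi : Integrable (Function.uncurry F) (ρ.prod (volume.restrict (Ioi 0))) := by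
    rw [integrable_prod_iff' hFm.aestronglyMeasurable]
    constructor
    · refine Eventually.of_forall fun t => ?_
      have : (fun ω => Function.uncurry F (ω, t)) = {ω | t < f ω}.indicator fun _ => g t := hFt t
      rw [this]
      exact (integrable_const _).indicator (hmt t)
    · have : (fun t => ∫ ω, ‖Function.uncurry F (ω, t)‖ ∂ρ) =
          fun t => ‖g t * ρ.real {ω | t < f ω}‖ := by
        ext t
        have h1 : (fun ω => ‖Function.uncurry F (ω, t)‖) = {ω | t < f ω}.indicator fun _ => ‖g t‖ := by
          ext ω
          have := congr_fun (hFt t) ω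
          simp only [Function.uncurry]
          rw [this, norm_indicator_eq_indicator_norm]
        rw [h1, integral_indicator_const _ (hmt t), smul_eq_mul, norm_mul,
          Real.norm_of_nonneg measureReal_nonneg, mul_comm]
      rw [this]
      exact hint.norm
  have hFω : ∀ ω, ∫ t in Ioi (0 : ℝ), F ω t = ∫ t in (0 : ℝ)..f ω, g t := by
    intro ω
    have : F ω = (Iio (f ω)).indicator g := by ext t; simp [hF, indicator]
    rw [this, setIntegral_indicator measurableSet_Iio, intervalIntegral.integral_of_le (hf0 ω),
      integral_Ioc_eq_integral_Ioo, Ioi_inter_Iio]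
  refine ⟨?_, ?_⟩
  · simp_rw [← hFω]
    exact hFi.integral_prod_left
  · simp_rw [← hFω]
    rw [integral_integral_swap hFi]
    congr 1
    ext t
    rw [hFt, integral_indicator_const _ (hmt t), smul_eq_mul, mul_comm]

/-! ### Integrals against uniformly regular tails. -/

section Tails

variable {ι : Type*} {l : Filter ι} {Ω : Type*} [MeasurableSpace Ω] {α c : ℝ}

/-- Along the filter `l`, the tails of `f i` under `ρ i` are uniformly asymptotic to `c y ^ (-α)`. -/
def UniformTail (l : Filter ι) (ρ : ι → Measure Ω) (f : ι → Ω → ℝ) (α c : ℝ) : Prop :=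
  ∀ ε > 0, ∃ Y : ℝ, ∀ᶠ i in l, ∀ y ≥ Y, |y ^ α * (ρ i).real {ω | y < f i ω} - c| ≤ ε

variable {ρ : ι → Measure Ω} {f : ι → Ω → ℝ}

/-- The asymptotics cover y ≥ max Y 1, and below that level a probability is at most 1. The bound
for all y > 0 supplies the dominating function in `UniformTail.tendsto_integral`. -/
lemma UniformTail.exists_bound (h : UniformTail l ρ f α c) [∀ i, IsProbabilityMeasure (ρ i)]
    (hα : 0 < α) (hc : 0 < c) :
    ∃ C > 0, ∀ᶠ i in l, ∀ y > 0, (ρ i).real {ω | y < f i ω} ≤ C * y ^ (-α) := by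
  obtain ⟨Y, hY⟩ := h 1 one_pos
  refine ⟨c + 1 + (max Y 1) ^ α, by positivity, ?_⟩
  filter_upwards [hY] with i hi y hy
  rw [Real.rpow_neg hy.le, ← div_eq_mul_inv, le_div_iff₀ (by positivity), mul_comm]
  rcases le_total (max Y 1) y with hy1 | hy1
  · have h1 := (abs_le.1 (hi y (le_trans (le_max_left _ _) hy1))).2
    have : 0 < (max Y 1) ^ α := by positivity
    linarith
  · have h1 : y ^ α ≤ (max Y 1) ^ α := Real.rpow_le_rpow hy.le hy1 hα.le
    have h2 : (ρ i).real {ω | y < f i ω} ≤ 1 := measureReal_le_one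
    have h3 : 0 ≤ (ρ i).real {ω | y < f i ω} := measureReal_nonneg
    have : 0 < y ^ α := by positivity
    nlinarith

/-- Asymptotics of `𝔼[G(f / R)]` as `R → ∞`, where `G(s) = ∫₀ˢ g`. -/
lemma UniformTail.tendsto_integral [l.IsCountablyGenerated] [∀ i, IsProbabilityMeasure (ρ i)]
    (h : UniformTail l ρ f α c) (hα : 0 < α) (hc : 0 < c) (hf : ∀ i, Measurable (f i))
    (hf0 : ∀ i ω, 0 ≤ f i ω) {R : ι → ℝ} (hR : Tendsto R l atTop) {g : ℝ → ℝ} (hg : Measurable g)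
    (hgi : IntegrableOn (fun t => g t * t ^ (-α)) (Ioi 0)) :
    (∀ᶠ i in l, Integrable (fun ω => ∫ t in (0 : ℝ)..f i ω / R i, g t) (ρ i)) ∧
      Tendsto (fun i => R i ^ α * ∫ ω, (∫ t in (0 : ℝ)..f i ω / R i, g t) ∂(ρ i)) l
        (𝓝 (c * ∫ t in Ioi (0 : ℝ), g t * t ^ (-α))) := by
  obtain ⟨C, hC, hbound⟩ := h.exists_bound hα hc
  have hset : ∀ i t, 0 < R i → {ω | t < f i ω / R i} = {ω | R i * t < f i ω} := by
    intro i t hRi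
    ext ω
    simp only [mem_ofPred_eq]
    rw [lt_div_iff₀ hRi, mul_comm]
  have hanti : ∀ i, Measurable fun t => (ρ i).real {ω | t < f i ω / R i} := by
    intro i
    refine Antitone.measurable fun s t hst => measureReal_mono fun ω hω => ?_
    exact lt_of_le_of_lt hst hω
  have hdom : ∀ᶠ i in l, ∀ t ∈ Ioi (0 : ℝ),
      ‖R i ^ α * (g t * (ρ i).real {ω | t < f i ω / R i})‖ ≤ C * ‖g t * t ^ (-α)‖ := by
    filter_upwards [hbound, hR.eventually_gt_atTop 0] with i hi hRi t ht
    have ht : 0 < t := ht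
    rw [hset i t hRi]
    have h1 := hi (R i * t) (by positivity)
    rw [Real.mul_rpow hRi.le ht.le, Real.rpow_neg hRi.le] at h1
    have h2 : R i ^ α * (ρ i).real {ω | R i * t < f i ω} ≤ C * t ^ (-α) := by
      have h3 := mul_le_mul_of_nonneg_left h1 (Real.rpow_nonneg hRi.le α)
      have : R i ^ α ≠ 0 := by positivity
      calc _ ≤ _ := h3
        _ = _ := by field_simp
    rw [Real.norm_eq_abs, Real.norm_eq_abs, abs_mul, abs_mul, abs_mul,
      abs_of_nonneg (Real.rpow_nonneg hRi.le α), abs_of_nonneg measureReal_nonneg,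
      abs_of_nonneg (Real.rpow_nonneg ht.le (-α))]
    calc R i ^ α * (|g t| * (ρ i).real {ω | R i * t < f i ω})
        = |g t| * (R i ^ α * (ρ i).real {ω | R i * t < f i ω}) := by ring
      _ ≤ |g t| * (C * t ^ (-α)) := by gcongr
      _ = _ := by ring
  have hmeas : ∀ i, Measurable fun t => R i ^ α * (g t * (ρ i).real {ω | t < f i ω / R i}) :=
    fun i => (hg.mul (hanti i)).const_mul _
  have hcake : ∀ᶠ i in l, Integrable (fun ω => ∫ t in (0 : ℝ)..f i ω / R i, g t) (ρ i) ∧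
      ∫ ω, (∫ t in (0 : ℝ)..f i ω / R i, g t) ∂(ρ i) =
        ∫ t in Ioi (0 : ℝ), g t * (ρ i).real {ω | t < f i ω / R i} := by
    filter_upwards [hdom, hR.eventually_gt_atTop 0] with i hi hRi
    refine integral_comp_intervalIntegral ((hf i).div_const _)
      (fun ω => div_nonneg (hf0 i ω) hRi.le) hg ?_
    have : IntegrableOn (fun t => R i ^ α * (g t * (ρ i).real {ω | t < f i ω / R i})) (Ioi 0) :=
      (hgi.norm.const_mul C).mono' (hmeas i).aestronglyMeasurable
        (ae_restrict_of_forall_mem measurableSet_Ioi hi)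
    have h2 := this.const_mul (R i ^ α)⁻¹
    refine h2.congr (Eventually.of_forall fun t => ?_)
    have : R i ^ α ≠ 0 := by positivity
    simp only
    field_simp
  refine ⟨hcake.mono fun i hi => hi.1, ?_⟩
  have hlim : Tendsto (fun i => ∫ t in Ioi (0 : ℝ),
      R i ^ α * (g t * (ρ i).real {ω | t < f i ω / R i})) l
      (𝓝 (∫ t in Ioi (0 : ℝ), c * (g t * t ^ (-α)))) := by
    refine tendsto_integral_filter_of_dominated_convergence (fun t => C * ‖g t * t ^ (-α)‖)
      (Eventually.of_forall fun i => (hmeas i).aestronglyMeasurable)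
      (hdom.mono fun i hi => ae_restrict_of_forall_mem measurableSet_Ioi hi)
      (hgi.norm.const_mul C) (ae_restrict_of_forall_mem measurableSet_Ioi fun t ht => ?_)
    have ht : 0 < t := ht
    -- Pointwise limit of the integrand: for fixed t > 0 the level R t eventually exceeds the
    -- threshold of uniformity.
    have htail : Tendsto (fun i => (R i * t) ^ α * (ρ i).real {ω | R i * t < f i ω}) l (𝓝 c) := by
      rw [Metric.tendsto_nhds]
      intro ε hε
      obtain ⟨Y, hY⟩ := h (ε / 2) (by positivity)
      filter_upwards [hY, (hR.atTop_mul_const ht).eventually_ge_atTop Y] with i hi hiY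
      rw [Real.dist_eq]
      exact (hi _ hiY).trans_lt (by linarith)
    have := (htail.const_mul (g t * t ^ (-α)))
    rw [mul_comm c]
    refine this.congr' ?_
    filter_upwards [hR.eventually_gt_atTop 0] with i hRi
    rw [hset i t hRi, Real.mul_rpow hRi.le ht.le, Real.rpow_neg ht.le]
    have : t ^ α ≠ 0 := by positivity
    field_simp
  rw [integral_const_mul] at hlim
  refine hlim.congr' (hcake.mono fun i hi => ?_)
  rw [integral_const_mul, ← hi.2]

end Tails

/-! ### Primitives of `gOut` and `gIn`. -/

section Potential

variable {α ν : ℝ}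

lemma intervalIntegrable_of_mul_rpow {g : ℝ → ℝ} (hg : Measurable g) (hα : 0 < α)
    (hgi : IntegrableOn (fun t => g t * t ^ (-α)) (Ioi 0)) {s : ℝ} (hs : 0 ≤ s) :
    IntervalIntegrable g volume 0 s := by
  rw [intervalIntegrable_iff_integrableOn_Ioc_of_le hs]
  have h1 : IntegrableOn (fun t => s ^ α * ‖g t * t ^ (-α)‖) (Ioc 0 s) :=
    (hgi.mono_set Ioc_subset_Ioi_self).norm.const_mul _
  refine h1.mono' hg.aestronglyMeasurable (ae_restrict_of_forall_mem measurableSet_Ioc fun t ht => ?_)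
  have ht0 := ht.1
  rw [norm_mul, Real.norm_of_nonneg (Real.rpow_nonneg ht0.le _), Real.rpow_neg ht0.le]
  have h2 : t ^ α ≤ s ^ α := Real.rpow_le_rpow ht0.le ht.2 hα.le
  have h3 : 0 < t ^ α := by positivity
  have h4 : 1 ≤ s ^ α * (t ^ α)⁻¹ := by
    rw [← div_eq_mul_inv, one_le_div h3]; exact h2
  calc ‖g t‖ = ‖g t‖ * 1 := (mul_one _).symm
    _ ≤ ‖g t‖ * (s ^ α * (t ^ α)⁻¹) := by gcongr
    _ = _ := by ring

lemma intervalIntegral_gOut (hα1 : 1 < α) (hα2 : α < 2) (hν : 0 < ν) (hνα : ν < α) {s : ℝ}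
    (hs : 0 ≤ s) : ∫ t in (0 : ℝ)..s, gOut ν t = ((1 + s) ^ ν - 1) / ν - s := by
  have h := intervalIntegral.integral_eq_sub_of_hasDerivAt_of_le
    (f := fun s : ℝ => ((1 + s) ^ ν - 1) / ν - s) (f' := gOut ν) hs ?_ ?_
    (intervalIntegrable_of_mul_rpow (measurable_gOut ν) (by linarith)
      (integrableOn_gOut hα1 hα2 hν hνα) hs)
  · rw [h]; simp
  · refine (ContinuousOn.div_const (ContinuousOn.sub ?_ continuousOn_const) _).sub continuousOn_id
    exact ContinuousOn.rpow_const (by fun_prop) fun _ _ => Or.inr hν.le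
  · intro t ht
    have h1 := ((((hasDerivAt_id t).const_add 1).rpow_const (p := ν)
        (Or.inl (by simp only [id]; linarith [ht.1]))).sub_const 1).div_const ν |>.sub (hasDerivAt_id t)
    refine h1.congr_deriv ?_
    simp only [id, gOut]
    field_simp

/-- For ν ≤ 1 the primitive is not differentiable at t = 1, where the jump reaches the origin, so
the fundamental theorem is used off that point. -/
lemma intervalIntegral_gIn (hα1 : 1 < α) (hα2 : α < 2) (hν : 0 < ν) (hνα : ν < α) {s : ℝ}
    (hs : 0 ≤ s) : ∫ t in (0 : ℝ)..s, gIn ν t = (|1 - s| ^ ν - 1) / ν + s := by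
  have h := integral_eq_of_hasDerivAt_off_countable_of_le
    (fun s : ℝ => (|1 - s| ^ ν - 1) / ν + s) (gIn ν) hs (countable_singleton 1) ?_ ?_
    (intervalIntegrable_of_mul_rpow (measurable_gIn ν) (by linarith)
      (integral_gIn hα1 hα2 hν hνα).1 hs)
  · rw [h]; simp
  · refine (ContinuousOn.div_const (ContinuousOn.sub ?_ continuousOn_const) _).add continuousOn_id
    exact ContinuousOn.rpow_const (by fun_prop) fun _ _ => Or.inr hν.le
  · intro t ht
    have ht1 : t ≠ 1 := fun h => ht.2 (by simp [h])
    rcases lt_or_gt_of_ne ht1 with h1 | h1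
    · have h2 := ((((hasDerivAt_id t).const_sub 1).rpow_const (p := ν)
        (Or.inl (by simp only [id]; linarith))).sub_const 1).div_const ν |>.add (hasDerivAt_id t)
      have h3 : HasDerivAt (fun s : ℝ => ((1 - s) ^ ν - 1) / ν + s) (gIn ν t) t := by
        refine h2.congr_deriv ?_
        simp only [id, gIn, if_pos h1]
        field_simp
        ring
      refine h3.congr_of_eventuallyEq ?_
      filter_upwards [Iio_mem_nhds h1] with s hs
      rw [abs_of_pos (sub_pos.2 (show s < 1 from hs))]
    · have h2 := ((((hasDerivAt_id t).sub_const 1).rpow_const (p := ν)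
        (Or.inl (by simp only [id]; linarith))).sub_const 1).div_const ν |>.add (hasDerivAt_id t)
      have h3 : HasDerivAt (fun s : ℝ => ((s - 1) ^ ν - 1) / ν + s) (gIn ν t) t := by
        refine h2.congr_deriv ?_
        simp only [id, gIn, if_neg h1.not_gt]
        field_simp
        ring
      refine h3.congr_of_eventuallyEq ?_
      filter_upwards [Ioi_mem_nhds h1] with s hs
      rw [abs_of_neg (sub_neg.2 (show 1 < s from hs)), neg_sub]

/-- Splitting `|1 + u|^ν - 1 - ν u` into the contributions of outward and inward jumps. -/
lemma rpow_abs_one_add (hα1 : 1 < α) (hα2 : α < 2) (hν : 0 < ν) (hνα : ν < α) (u : ℝ) :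
    (|1 + u| ^ ν - 1) / ν = u + (∫ t in (0 : ℝ)..u⁺, gOut ν t) + ∫ t in (0 : ℝ)..u⁻, gIn ν t := by
  rw [intervalIntegral_gOut hα1 hα2 hν hνα (posPart_nonneg u),
    intervalIntegral_gIn hα1 hα2 hν hνα (negPart_nonneg u)]
  rcases le_total 0 u with h | h
  · rw [posPart_of_nonneg h, negPart_eq_zero.2 h, abs_of_nonneg (by linarith)]
    simp
  · rw [negPart_of_nonpos h, posPart_eq_zero.2 h]
    simp

end Potential

/-! ### Mean change of powers, monotonicity in the exponent, truncated second moments. -/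

section Drift

variable {ι : Type*} {l : Filter ι} [l.IsCountablyGenerated] {Ω : Type*} [MeasurableSpace Ω]
  {α c ν : ℝ} {ρ : ι → Measure Ω} [∀ i, IsProbabilityMeasure (ρ i)] {f : ι → Ω → ℝ} {R : ι → ℝ}

/-- The choice g = 1 is excluded because t^(-α) is not integrable at 0. Cutting g off below 1 leaves
the primitive (s-1)⁺, which differs from s by at most 1. -/
lemma UniformTail.integrable (hR : Tendsto R l atTop) (hα1 : 1 < α) (hα2 : α < 2) (hc : 0 < c)
    (hf : ∀ i, Measurable (f i)) (hf0 : ∀ i ω, 0 ≤ f i ω) (h : UniformTail l ρ f α c) :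
    ∀ᶠ i in l, Integrable (f i) (ρ i) := by
  set g : ℝ → ℝ := (Ici 1).indicator fun _ => 1 with hg
  have hgm : Measurable g := measurable_const.indicator measurableSet_Ici
  have hgi : IntegrableOn (fun t => g t * t ^ (-α)) (Ioi 0) := by
    have h1 : IntegrableOn (fun t : ℝ => t ^ (-α)) (Ici 1) :=
      (integrableOn_Ici_iff_integrableOn_Ioi).2 (integrableOn_Ioi_rpow_of_lt (by linarith) one_pos)
    have h2 : (fun t => g t * t ^ (-α)) = (Ici 1).indicator fun t : ℝ => t ^ (-α) := by
      ext t
      by_cases ht : t ∈ Ici (1 : ℝ) <;> simp [hg, ht]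
    rw [h2]
    exact ((integrable_indicator_iff measurableSet_Ici).2 h1).integrableOn
  have h1 := (h.tendsto_integral (by linarith) hc hf hf0 hR hgm hgi).1
  filter_upwards [h1, hR.eventually_gt_atTop 0] with i hi hRi
  refine ((hi.add (integrable_const 1)).const_mul (R i)).mono' (hf i).aestronglyMeasurable
    (Eventually.of_forall fun ω => ?_)
  rw [Real.norm_of_nonneg (hf0 i ω), ← div_le_iff₀' hRi]
  set s := f i ω / R i
  have hs : 0 ≤ s := div_nonneg (hf0 i ω) hRi.le
  have : max (s - 1) 0 ≤ ∫ t in (0 : ℝ)..s, g t := by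
    rw [intervalIntegral.integral_of_le hs, hg, setIntegral_indicator measurableSet_Ici]
    rcases le_total s 1 with h | h
    · rw [max_eq_right (by linarith)]
      exact integral_nonneg fun _ => zero_le_one
    · rw [max_eq_left (by linarith)]
      have : Ioc 0 s ∩ Ici 1 = Icc 1 s := by
        ext t; simp only [mem_inter_iff, mem_Ioc, mem_Ici, mem_Icc]; constructor
        · rintro ⟨⟨_, h2⟩, h3⟩; exact ⟨h3, h2⟩
        · rintro ⟨h2, h3⟩; exact ⟨⟨by linarith, h3⟩, h2⟩
      rw [this]
      simp [h]
  have := le_max_left (s - 1) 0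
  simp only [Pi.add_apply]
  linarith

/-- Asymptotics of `𝔼|1 + η/R|^ν`, where both tails of `η` are asymptotic to `c y^(-α)`. -/
lemma tendsto_integral_rpow_abs (hR : Tendsto R l atTop) (hα1 : 1 < α) (hα2 : α < 2) (hc : 0 < c)
    (hf : ∀ i, Measurable (f i)) (hp : UniformTail l ρ (fun i ω => (f i ω)⁺) α c)
    (hn : UniformTail l ρ (fun i ω => (f i ω)⁻) α c) (hν : 0 < ν) (hνα : ν < α) :
    (∀ᶠ i in l, Integrable (f i) (ρ i) ∧ Integrable (fun ω => |1 + f i ω / R i| ^ ν) (ρ i)) ∧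
    Tendsto (fun i => R i ^ α * (∫ ω, (|1 + f i ω / R i| ^ ν - 1) / ν ∂(ρ i) -
      (∫ ω, f i ω ∂(ρ i)) / R i)) l (𝓝 (-(c * criticalFun α ν))) := by
  have hp' : ∀ i, Measurable fun ω => (f i ω)⁺ := fun i => (hf i).posPart
  have hn' : ∀ i, Measurable fun ω => (f i ω)⁻ := fun i => (hf i).negPart
  have hp0 : ∀ i ω, 0 ≤ (f i ω)⁺ := fun i ω => posPart_nonneg _
  have hn0 : ∀ i ω, 0 ≤ (f i ω)⁻ := fun i ω => negPart_nonneg _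
  have hip := hp.integrable hR hα1 hα2 hc hp' hp0
  have hin := hn.integrable hR hα1 hα2 hc hn' hn0
  obtain ⟨hop, hopl⟩ := hp.tendsto_integral (by linarith) hc hp' hp0 hR (measurable_gOut ν)
    (integrableOn_gOut hα1 hα2 hν hνα)
  obtain ⟨hnp, hnpl⟩ := hn.tendsto_integral (by linarith) hc hn' hn0 hR (measurable_gIn ν)
    (integral_gIn hα1 hα2 hν hνα).1
  have hsplit : ∀ᶠ i in l, ∀ ω, (|1 + f i ω / R i| ^ ν - 1) / ν = f i ω / R i +
      (∫ t in (0 : ℝ)..(f i ω)⁺ / R i, gOut ν t) + ∫ t in (0 : ℝ)..(f i ω)⁻ / R i, gIn ν t := by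
    filter_upwards [hR.eventually_gt_atTop 0] with i hRi ω
    have h1 : (f i ω / R i)⁺ = (f i ω)⁺ / R i := by
      simp only [posPart_def]
      rw [← max_div_div_right hRi.le, zero_div]
    have h2 : (f i ω / R i)⁻ = (f i ω)⁻ / R i := by
      simp only [negPart_def]
      rw [← max_div_div_right hRi.le, zero_div, neg_div]
    rw [rpow_abs_one_add hα1 hα2 hν hνα, h1, h2]
  have hfi : ∀ᶠ i in l, Integrable (f i) (ρ i) := by
    filter_upwards [hip, hin] with i h1 h2
    refine (h1.sub h2).congr (Eventually.of_forall fun ω => ?_)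
    exact posPart_sub_negPart (f i ω)
  constructor
  · filter_upwards [hfi, hop, hnp, hsplit] with i h1 h2 h3 h4
    refine ⟨h1, ?_⟩
    have h5 := ((((h1.div_const (R i)).add h2).add h3).mul_const ν).add (integrable_const 1)
    refine h5.congr (Eventually.of_forall fun ω => ?_)
    have := h4 ω
    simp only [Pi.add_apply]
    rw [← this]
    field_simp
    ring
  · have hsum := hopl.add hnpl
    rw [← mul_add, integral_gOut_add_integral_gIn hα1 hα2 hν hνα, mul_neg] at hsum
    refine hsum.congr' ?_
    filter_upwards [hfi, hop, hnp, hsplit] with i h1 h2 h3 h4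
    simp_rw [h4]
    have h12 : Integrable (fun ω => f i ω / R i +
        ∫ t in (0 : ℝ)..(f i ω)⁺ / R i, gOut ν t) (ρ i) := (h1.div_const (R i)).add h2
    rw [integral_add h12 h3, integral_add (h1.div_const (R i)) h2, integral_div]
    ring

/-- With s = t^ν₁ and r = ν₂/ν₁ > 1, the difference is (s^r - 1 - r(s-1))/ν₂, which is nonnegative
by Bernoulli. It is strictly positive at t = 2, and a second use of Bernoulli, at s/s₀, shows that
it is no smaller for t ≥ 2. -/
lemma exists_pos_le_rpow_sub_rpow {ν₁ ν₂ : ℝ} (h1 : 0 < ν₁) (h12 : ν₁ < ν₂) :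
    ∃ κ > 0, ∀ t ≥ (0 : ℝ), 0 ≤ (t ^ ν₂ - 1) / ν₂ - (t ^ ν₁ - 1) / ν₁ ∧
      (2 ≤ t → κ ≤ (t ^ ν₂ - 1) / ν₂ - (t ^ ν₁ - 1) / ν₁) := by
  have h2 : 0 < ν₂ := h1.trans h12
  set r := ν₂ / ν₁ with hr
  have hr1 : 1 < r := (one_lt_div h1).2 h12
  set s₀ : ℝ := 2 ^ ν₁ with hs₀
  have hs₀1 : 1 < s₀ := Real.one_lt_rpow (by norm_num) h1
  have hs₀0 : 0 < s₀ := by linarith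
  have hform : ∀ t ≥ (0 : ℝ), (t ^ ν₂ - 1) / ν₂ - (t ^ ν₁ - 1) / ν₁ =
      ((t ^ ν₁) ^ r - 1 - r * (t ^ ν₁ - 1)) / ν₂ := by
    intro t ht
    rw [← Real.rpow_mul ht, hr, show ν₁ * (ν₂ / ν₁) = ν₂ by field_simp]
    field_simp
  have hstrict := one_add_mul_self_lt_rpow_one_add (s := s₀ - 1) (by linarith) (by linarith) hr1
  rw [add_sub_cancel] at hstrict
  refine ⟨(s₀ ^ r - 1 - r * (s₀ - 1)) / ν₂, div_pos (by linarith) h2, fun t ht => ?_⟩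
  rw [hform t ht]
  have hs : 0 ≤ t ^ ν₁ := by positivity
  constructor
  · have := one_add_mul_self_le_rpow_one_add (s := t ^ ν₁ - 1) (by linarith) hr1.le
    rw [add_sub_cancel] at this
    exact div_nonneg (by linarith) h2.le
  · intro ht2
    have hss : s₀ ≤ t ^ ν₁ := Real.rpow_le_rpow (by norm_num) ht2 h1.le
    set s := t ^ ν₁
    have h3 := one_add_mul_self_le_rpow_one_add (s := s / s₀ - 1)
      (by have : 0 ≤ s / s₀ := by positivity
          linarith) hr1.le
    rw [add_sub_cancel, Real.div_rpow hs hs₀0.le, le_div_iff₀ (by positivity)] at h3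
    have h4 : s₀ ≤ s₀ ^ r := by
      have := Real.rpow_le_rpow_of_exponent_le hs₀1.le hr1.le
      rwa [Real.rpow_one] at this
    have h5 : r * (s - s₀) * 1 ≤ r * (s - s₀) * (s₀ ^ r / s₀) := by
      have : 0 ≤ s - s₀ := by linarith
      gcongr
      rwa [one_le_div hs₀0]
    have h6 : (1 + r * (s / s₀ - 1)) * s₀ ^ r = s₀ ^ r + r * (s - s₀) * (s₀ ^ r / s₀) := by
      field_simp
    gcongr ?_ / ν₂
    linarith

/-- Monotonicity of the critical function: `(t^ν - 1) / ν` increases with `ν`. -/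
lemma criticalFun_lt [l.NeBot] (hR : Tendsto R l atTop) (hα1 : 1 < α) (hα2 : α < 2) (hc : 0 < c)
    (hf : ∀ i, Measurable (f i)) (hp : UniformTail l ρ (fun i ω => (f i ω)⁺) α c)
    (hn : UniformTail l ρ (fun i ω => (f i ω)⁻) α c) {ν₁ ν₂ : ℝ} (h1 : 0 < ν₁) (h12 : ν₁ < ν₂)
    (h2 : ν₂ < α) : criticalFun α ν₂ < criticalFun α ν₁ := by
  obtain ⟨κ, hκ, hκt⟩ := exists_pos_le_rpow_sub_rpow h1 h12
  obtain ⟨hi1, hl1⟩ := tendsto_integral_rpow_abs hR hα1 hα2 hc hf hp hn h1 (h12.trans h2)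
  obtain ⟨hi2, hl2⟩ := tendsto_integral_rpow_abs hR hα1 hα2 hc hf hp hn (h1.trans h12) h2
  -- An outward jump larger than R gives |1 + η/R| > 2, where the two potentials differ by at least
  -- κ. Such jumps have probability about c R^(-α), so a gap κc survives in the limit and makes the
  -- inequality strict.
  have htail : Tendsto (fun i => κ * (R i ^ α * (ρ i).real {ω | R i < (f i ω)⁺})) l (𝓝 (κ * c)) := by
    refine Tendsto.const_mul _ ?_
    rw [Metric.tendsto_nhds]
    intro ε hε
    obtain ⟨Y, hY⟩ := hp (ε / 2) (by positivity)
    filter_upwards [hY, hR.eventually_ge_atTop Y] with i hi hiY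
    rw [Real.dist_eq]
    exact (hi _ hiY).trans_lt (by linarith)
  have hle := le_of_tendsto_of_tendsto htail (hl2.sub hl1) ?_
  · have : 0 < c * (criticalFun α ν₁ - criticalFun α ν₂) := by
      have := mul_pos hκ hc
      linarith
    linarith [pos_of_mul_pos_right this hc.le]
  · filter_upwards [hi1, hi2, hR.eventually_gt_atTop 0] with i h1i h2i hRi
    have hS : MeasurableSet {ω | R i < (f i ω)⁺} := measurableSet_lt measurable_const (hf i).posPart
    have e1 := (h1i.2.sub (integrable_const 1)).div_const ν₁
    have e2 := (h2i.2.sub (integrable_const 1)).div_const ν₂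
    have hint : κ * (ρ i).real {ω | R i < (f i ω)⁺} ≤
        ∫ ω, (|1 + f i ω / R i| ^ ν₂ - 1) / ν₂ ∂(ρ i) -
        ∫ ω, (|1 + f i ω / R i| ^ ν₁ - 1) / ν₁ ∂(ρ i) := by
      have h3 : κ * (ρ i).real {ω | R i < (f i ω)⁺} =
          ∫ ω, {ω | R i < (f i ω)⁺}.indicator (fun _ => κ) ω ∂(ρ i) := by
        rw [integral_indicator_const _ hS, smul_eq_mul, mul_comm]
      rw [h3]
      refine le_trans (integral_mono ((integrable_const κ).indicator hS) (e2.sub e1) fun ω => ?_)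
        (integral_sub e2 e1).le
      have h4 := hκt |1 + f i ω / R i| (abs_nonneg _)
      simp only [Pi.sub_apply]
      by_cases hω : R i < (f i ω)⁺
      · rw [indicator_of_mem (s := {ω | R i < (f i ω)⁺}) hω]
        refine h4.2 ?_
        have h5 : R i < f i ω := by
          rcases le_total (f i ω) 0 with h | h
          · rw [posPart_eq_zero.2 h] at hω; linarith
          · rwa [posPart_of_nonneg h] at hω
        have h6 : 1 < f i ω / R i := (one_lt_div hRi).2 h5
        rw [abs_of_nonneg (by linarith)]
        linarith
      · rw [indicator_of_notMem (s := {ω | R i < (f i ω)⁺}) hω]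
        exact h4.1
    have := mul_le_mul_of_nonneg_left hint (Real.rpow_nonneg hRi.le α)
    linarith

/-- Truncated second moments of the increments. -/
lemma exists_integral_min_le (hR : Tendsto R l atTop) (hα1 : 1 < α) (hα2 : α < 2) (hc : 0 < c)
    (hf : ∀ i, Measurable (f i)) (hp : UniformTail l ρ (fun i ω => (f i ω)⁺) α c)
    (hn : UniformTail l ρ (fun i ω => (f i ω)⁻) α c) :
    ∃ K, ∀ᶠ i in l, Integrable (fun ω => min (|f i ω| / R i) ((|f i ω| / R i) ^ 2)) (ρ i) ∧
      ∫ ω, min (|f i ω| / R i) ((|f i ω| / R i) ^ 2) ∂(ρ i) ≤ K * R i ^ (-α) := by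
  -- The a.e. derivative of min(s, s²): linear at 0 and bounded at ∞, hence integrable against
  -- t^(-α) for 1 < α < 2.
  set g : ℝ → ℝ := fun t => if t < 1 then 2 * t else 1 with hg
  have hgm : Measurable g := Measurable.ite measurableSet_Iio (by fun_prop) (by fun_prop)
  have hgi : IntegrableOn (fun t => g t * t ^ (-α)) (Ioi 0) := by
    rw [← Ioc_union_Ioi_eq_Ioi (zero_le_one : (0 : ℝ) ≤ 1)]
    refine IntegrableOn.union ((integrableOn_Ioc_iff_integrableOn_Ioo).2 ?_) ?_
    · have h1 : IntegrableOn (fun t : ℝ => 2 * t ^ (1 - α)) (Ioo 0 1) :=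
        ((intervalIntegral.integrableOn_Ioo_rpow_iff zero_lt_one).2 (by linarith)).const_mul 2
      refine h1.congr_fun (fun t ht => ?_) measurableSet_Ioo
      simp only [hg, if_pos ht.2]
      rw [sub_eq_add_neg, Real.rpow_add ht.1, Real.rpow_one]
      ring
    · refine (integrableOn_Ioi_rpow_of_lt (a := -α) (by linarith) one_pos).congr_fun
        (fun t ht => ?_) measurableSet_Ioi
      simp only [hg, if_neg (not_lt.2 (le_of_lt (show (1 : ℝ) < t from ht))), one_mul]
  have hG : ∀ s ≥ (0 : ℝ), ∫ t in (0 : ℝ)..s, g t = min s (s ^ 2) := by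
    have hle : ∀ s ∈ Icc (0 : ℝ) 1, ∫ t in (0 : ℝ)..s, g t = s ^ 2 := by
      intro s hs
      rw [intervalIntegral.integral_of_le hs.1, integral_Ioc_eq_integral_Ioo,
        setIntegral_congr_fun (g := fun t => 2 * t) measurableSet_Ioo
          fun t ht => by simp only [hg, if_pos (ht.2.trans_le hs.2)],
        ← integral_Ioc_eq_integral_Ioo, ← intervalIntegral.integral_of_le hs.1,
        intervalIntegral.integral_const_mul, integral_id]
      ring
    intro s hs
    rcases le_total s 1 with h | h
    · rw [hle s ⟨hs, h⟩, min_eq_right (by nlinarith)]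
    · have hi : ∀ s ≥ (0 : ℝ), IntervalIntegrable g volume 0 s := fun s hs =>
        intervalIntegrable_of_mul_rpow hgm (by linarith) hgi hs
      rw [← intervalIntegral.integral_add_adjacent_intervals (hi 1 zero_le_one)
        ((hi 1 zero_le_one).symm.trans (hi s hs)), hle 1 ⟨zero_le_one, le_rfl⟩,
        intervalIntegral.integral_of_le h,
        setIntegral_congr_fun (g := fun _ => 1) measurableSet_Ioc
          fun t ht => by simp only [hg, if_neg (not_lt.2 ht.1.le)],
        ← intervalIntegral.integral_of_le h, min_eq_left (by nlinarith)]
      simp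
  obtain ⟨hpi, hpl⟩ := hp.tendsto_integral (by linarith) hc (fun i => (hf i).posPart)
    (fun i ω => posPart_nonneg _) hR hgm hgi
  obtain ⟨hni, hnl⟩ := hn.tendsto_integral (by linarith) hc (fun i => (hf i).negPart)
    (fun i ω => negPart_nonneg _) hR hgm hgi
  have hb := (hpl.add hnl).eventually (ge_mem_nhds (lt_add_one _))
  refine ⟨c * (∫ t in Ioi (0 : ℝ), g t * t ^ (-α)) + c * (∫ t in Ioi (0 : ℝ), g t * t ^ (-α)) + 1, ?_⟩
  filter_upwards [hpi, hni, hb, hR.eventually_gt_atTop 0] with i h1 h2 h3 hRi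
  have hsplit : ∀ ω, min (|f i ω| / R i) ((|f i ω| / R i) ^ 2) =
      (∫ t in (0 : ℝ)..(f i ω)⁺ / R i, g t) + ∫ t in (0 : ℝ)..(f i ω)⁻ / R i, g t := by
    intro ω
    rw [hG _ (div_nonneg (posPart_nonneg _) hRi.le), hG _ (div_nonneg (negPart_nonneg _) hRi.le)]
    rcases le_total 0 (f i ω) with h | h
    · rw [posPart_of_nonneg h, negPart_eq_zero.2 h, abs_of_nonneg h]; simp
    · rw [negPart_of_nonpos h, posPart_eq_zero.2 h, abs_of_nonpos h]; simp
  simp_rw [hsplit]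
  refine ⟨h1.add h2, ?_⟩
  rw [integral_add h1 h2, Real.rpow_neg hRi.le, ← div_eq_mul_inv, le_div_iff₀ (by positivity)]
  refine le_trans (le_of_eq ?_) h3
  ring

end Drift

/-! ### Outward increments and Lyapunov estimates for the chain. -/

section Outward

variable {X : Set ℝ}

/-- The increment from `x` to `z`, counted positive when it points away from the origin. -/
noncomputable def outward (x z : X) : ℝ :=
  if 0 ≤ (x : ℝ) then (z : ℝ) - x else (x : ℝ) - z

/-- The filter `|x| → ∞` on the state space. -/
def absAtTop (X : Set ℝ) : Filter X := comap (fun x : X => |(x : ℝ)|) atTop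

instance : (absAtTop X).IsCountablyGenerated := by unfold absAtTop; infer_instance

lemma tendsto_abs_absAtTop : Tendsto (fun x : X => |(x : ℝ)|) (absAtTop X) atTop := tendsto_comap

lemma eventually_absAtTop {p : X → Prop} :
    (∀ᶠ x in absAtTop X, p x) ↔ ∃ A, ∀ x : X, A ≤ |(x : ℝ)| → p x := by
  unfold absAtTop
  rw [eventually_comap, eventually_atTop]
  exact ⟨fun ⟨A, h⟩ => ⟨A, fun x hx => h _ hx x rfl⟩, fun ⟨A, h⟩ => ⟨A, fun b hb x hx => h x (hx ▸ hb)⟩⟩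

lemma absAtTop_neBot (hX : ¬ Bornology.IsBounded X) : (absAtTop X).NeBot := by
  refine ⟨fun h => hX ?_⟩
  have : ∀ᶠ x in absAtTop X, False := by rw [h]; exact eventually_bot
  obtain ⟨A, hA⟩ := eventually_absAtTop.1 this
  rw [isBounded_iff_forall_norm_le]
  refine ⟨A, fun x hx => ?_⟩
  by_contra hlt
  exact hA ⟨x, hx⟩ (not_le.1 hlt).le

lemma measurable_outward (x : X) : Measurable (outward x) := by
  unfold outward
  split_ifs <;> fun_prop

lemma abs_outward (x z : X) : |outward x z| = |(z : ℝ) - x| := by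
  unfold outward
  split_ifs
  · rfl
  · exact abs_sub_comm _ _

/-- This is the purpose of `outward`: after normalisation by |x| the two half-lines obey the same
formula. -/
lemma abs_one_add_outward_div {x : X} (hx : 0 < |(x : ℝ)|) (z : X) :
    |1 + outward x z / (|(x : ℝ)|)| = |(z : ℝ)| / |(x : ℝ)| := by
  have h : 1 + outward x z / |(x : ℝ)| = (|(x : ℝ)| + outward x z) / |(x : ℝ)| := by field_simp
  rw [h, abs_div, abs_abs]
  congr 1
  unfold outward
  split_ifs with h0
  · rw [abs_of_nonneg h0]; congr 1; ring
  · rw [abs_of_neg (not_le.1 h0), show -(x : ℝ) + (x - z) = -z by ring, abs_neg]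

variable {P : Kernel X X} {α c γ b : ℝ}

/-- For x < 0 the outward increment is -θ, so positive and negative parts are exchanged and the left
tail of θ controls the outward jumps. -/
lemma BalancedTails.uniformTail (hT : BalancedTails P α c) :
    UniformTail (absAtTop X) (fun x => P x) (fun x z => (outward x z)⁺) α c ∧
      UniformTail (absAtTop X) (fun x => P x) (fun x z => (outward x z)⁻) α c := by
  obtain ⟨x₀, hx₀, h1, h2, h3, h4⟩ := hT
  have hpos : ∀ x : X, 0 ≤ (x : ℝ) → outward x = fun z : X => (z : ℝ) - x := fun x hx => by
    ext z; simp [outward, hx]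
  have hneg : ∀ x : X, (x : ℝ) < 0 → outward x = fun z : X => -((z : ℝ) - x) := fun x hx => by
    ext z; simp [outward, not_le.2 hx]
  rw [Metric.tendstoUniformlyOn_iff] at h1 h2 h3 h4
  constructor
  · intro ε hε
    obtain ⟨Y, hY⟩ := eventually_atTop.1 ((h1 ε hε).and (h4 ε hε))
    refine ⟨Y, eventually_absAtTop.2 ⟨x₀ , fun x hx y hy => ?_⟩⟩
    rcases le_or_gt 0 (x : ℝ) with h | h
    · change |y ^ α * (P x).real {z | y < (outward x z)⁺} - c| ≤ ε
      have := (hY y hy).1 x (by rwa [abs_of_nonneg h] at hx)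
      rw [dist_comm, Real.dist_eq] at this
      rw [hpos x h]
      exact this.le
    · change |y ^ α * (P x).real {z | y < (outward x z)⁺} - c| ≤ ε
      have := (hY y hy).2 x (by
        rw [abs_of_neg h] at hx
        simp only [mem_ofPred_eq]; linarith)
      rw [dist_comm, Real.dist_eq] at this
      rw [hneg x h]
      simp only [posPart_neg]
      exact this.le
  · intro ε hε
    obtain ⟨Y, hY⟩ := eventually_atTop.1 ((h2 ε hε).and (h3 ε hε))
    refine ⟨Y, eventually_absAtTop.2 ⟨x₀ , fun x hx y hy => ?_⟩⟩
    rcases le_or_gt 0 (x : ℝ) with h | h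
    · change |y ^ α * (P x).real {z | y < (outward x z)⁻} - c| ≤ ε
      have := (hY y hy).1 x (by rwa [abs_of_nonneg h] at hx)
      rw [dist_comm, Real.dist_eq] at this
      rw [hpos x h]
      exact this.le
    · change |y ^ α * (P x).real {z | y < (outward x z)⁻} - c| ≤ ε
      have := (hY y hy).2 x (by
        rw [abs_of_neg h] at hx
        simp only [mem_ofPred_eq]; linarith)
      rw [dist_comm, Real.dist_eq] at this
      rw [hneg x h]
      simp only [negPart_neg]
      exact this.le

lemma AsymptoticDrift.tendsto_outward (hD : AsymptoticDrift P γ b) :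
    Tendsto (fun x : X => |(x : ℝ)| ^ γ * ∫ z, outward x z ∂(P x)) (absAtTop X) (𝓝 b) := by
  obtain ⟨h1, h2⟩ := hD
  rw [Metric.tendsto_nhds] at h1 h2 ⊢
  intro ε hε
  have h1 := h1 ε hε
  have h2 := h2 ε hε
  rw [eventually_comap, eventually_atTop] at h1
  rw [eventually_comap, eventually_atBot] at h2
  obtain ⟨A, hA⟩ := h1
  obtain ⟨B, hB⟩ := h2
  refine eventually_absAtTop.2 ⟨max A (-B), fun x hx => ?_⟩
  rcases le_or_gt 0 (x : ℝ) with h | h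
  · have h3 := hA x (by rw [abs_of_nonneg h] at hx; exact (le_max_left _ _).trans hx) x rfl
    have h4 : ∫ z, outward x z ∂(P x) = drift P x := by simp [outward, h, drift]
    rw [h4, abs_of_nonneg h]
    exact h3
  · have h3 := hB x (by
      rw [abs_of_neg h] at hx; linarith [(le_max_right A (-B)).trans hx]) x rfl
    have h4 : ∫ z, outward x z ∂(P x) = -drift P x := by
      unfold drift
      rw [← integral_neg]
      simp [outward, not_le.2 h]
    rw [h4, mul_neg]
    exact h3

variable [IsMarkovKernel P] {ν : ℝ}

/-- Asymptotics of the drift of the Lyapunov functions `|x|^ν`. -/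
lemma tendsto_lyapunov_drift (hα : α ∈ Ioo (1 : ℝ) 2) (hc : 0 < c) (hT : BalancedTails P α c)
    (hD : AsymptoticDrift P γ b) (hν : 0 < ν) (hνα : ν < α) {e : ℝ}
    (he : Tendsto (fun x : X => |(x : ℝ)| ^ (γ + 1 - α)) (absAtTop X) (𝓝 e)) :
    (∀ᶠ x : X in absAtTop X, Integrable (fun z : X => |(z : ℝ)| ^ ν) (P x)) ∧
    Tendsto (fun x : X => |(x : ℝ)| ^ (γ + 1 - ν) * (∫ z : X, |(z : ℝ)| ^ ν ∂(P x) - |(x : ℝ)| ^ ν))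
      (absAtTop X) (𝓝 (ν * (b - e * (c * criticalFun α ν)))) := by
  obtain ⟨hp, hn⟩ := hT.uniformTail
  obtain ⟨hi, hl⟩ := tendsto_integral_rpow_abs tendsto_abs_absAtTop hα.1 hα.2 hc
    measurable_outward hp hn hν hνα
  have hpos := (tendsto_abs_absAtTop (X := X)).eventually_gt_atTop 0
  have hz : ∀ᶠ x : X in absAtTop X, Integrable (fun z : X => |(z : ℝ)| ^ ν) (P x) ∧
      ∫ z, (|1 + outward x z / (|(x : ℝ)|)| ^ ν - 1) / ν ∂(P x) =
        (∫ z : X, |(z : ℝ)| ^ ν ∂(P x) - |(x : ℝ)| ^ ν) / |(x : ℝ)| ^ ν / ν := by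
    filter_upwards [hi, hpos] with x hix hx
    have hxν : |(x : ℝ)| ^ ν ≠ 0 := by positivity
    have h1 : ∀ z, |1 + outward x z / (|(x : ℝ)|)| ^ ν = |(z : ℝ)| ^ ν / |(x : ℝ)| ^ ν := fun z => by
      rw [abs_one_add_outward_div hx, Real.div_rpow (abs_nonneg _) (abs_nonneg _)]
    have h2 : Integrable (fun z : X => |(z : ℝ)| ^ ν) (P x) := by
      refine (hix.2.mul_const (|(x : ℝ)| ^ ν)).congr (Eventually.of_forall fun z => ?_)
      simp only [h1 z]
      field_simp
    refine ⟨h2, ?_⟩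
    simp_rw [h1]
    rw [integral_div, integral_sub (h2.div_const _) (integrable_const _), integral_div]
    simp only [integral_const, probReal_univ, one_smul]
    field_simp
  refine ⟨hz.mono fun x hx => hx.1, ?_⟩
  -- Jumps contribute at order |x|^(-α) and the mean increment at order |x|^(-γ-1); e is the
  -- limiting ratio of these scales.
  have hlim := ((he.mul hl).add hD.tendsto_outward).const_mul ν
  have hval : ν * (e * -(c * criticalFun α ν) + b) = ν * (b - e * (c * criticalFun α ν)) := by ring
  rw [hval] at hlim
  refine hlim.congr' ?_
  filter_upwards [hz, hpos] with x hx hx0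
  rw [hx.2]
  have e1 : |(x : ℝ)| ^ (γ + 1 - α) = |(x : ℝ)| ^ γ * |(x : ℝ)| / |(x : ℝ)| ^ α := by
    rw [Real.rpow_sub hx0, Real.rpow_add hx0, Real.rpow_one]
  have e2 : |(x : ℝ)| ^ (γ + 1 - ν) = |(x : ℝ)| ^ γ * |(x : ℝ)| / |(x : ℝ)| ^ ν := by
    rw [Real.rpow_sub hx0, Real.rpow_add hx0, Real.rpow_one]
  rw [e1, e2]
  have h1 : |(x : ℝ)| ^ α ≠ 0 := by positivity
  have h2 : |(x : ℝ)| ^ ν ≠ 0 := by positivity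
  field_simp
  ring

lemma eventually_lyapunov_decrease (hα : α ∈ Ioo (1 : ℝ) 2) (hc : 0 < c)
    (hT : BalancedTails P α c) (hD : AsymptoticDrift P γ b) (hν : 0 < ν) (hνα : ν < α) {e : ℝ}
    (he : Tendsto (fun x : X => |(x : ℝ)| ^ (γ + 1 - α)) (absAtTop X) (𝓝 e))
    (hneg : b - e * (c * criticalFun α ν) < 0) :
    ∃ ε > 0, ∀ᶠ x : X in absAtTop X, ∫⁻ z : X, ENNReal.ofReal (|(z : ℝ)| ^ ν) ∂(P x) +
      ENNReal.ofReal (ε * |(x : ℝ)| ^ (ν - (γ + 1))) ≤ ENNReal.ofReal (|(x : ℝ)| ^ ν) := by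
  obtain ⟨hi, hl⟩ := tendsto_lyapunov_drift hα hc hT hD hν hνα he
  set L := ν * (b - e * (c * criticalFun α ν)) with hL
  have hL0 : L < 0 := mul_neg_of_pos_of_neg hν hneg
  -- Half of the limit L < 0 is kept as the guaranteed decrease, leaving room for the convergence
  -- error.
  refine ⟨-L / 2, by linarith, ?_⟩
  filter_upwards [hi, hl.eventually (ge_mem_nhds (show L < L / 2 by linarith)),
    (tendsto_abs_absAtTop (X := X)).eventually_gt_atTop 0] with x hix hlx hx
  rw [← ofReal_integral_eq_lintegral_ofReal hix (Eventually.of_forall fun z => by positivity),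
    ← ENNReal.ofReal_add (integral_nonneg fun z => by positivity)
      (mul_nonneg (by linarith) (by positivity))]
  refine ENNReal.ofReal_le_ofReal ?_
  have h1 : |(x : ℝ)| ^ (ν - (γ + 1)) * |(x : ℝ)| ^ (γ + 1 - ν) = 1 := by
    rw [← Real.rpow_add hx]; simp
  have h2 := mul_le_mul_of_nonneg_left hlx (Real.rpow_nonneg hx.le (ν - (γ + 1)))
  rw [← mul_assoc, h1, one_mul] at h2
  linarith

lemma eventually_lyapunov_increase (hα : α ∈ Ioo (1 : ℝ) 2) (hc : 0 < c)
    (hT : BalancedTails P α c) (hD : AsymptoticDrift P γ b) (hν : 0 < ν) (hνα : ν < α) {e : ℝ}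
    (he : Tendsto (fun x : X => |(x : ℝ)| ^ (γ + 1 - α)) (absAtTop X) (𝓝 e))
    (hpos : 0 < b - e * (c * criticalFun α ν)) :
    ∀ᶠ x : X in absAtTop X,
      ENNReal.ofReal (|(x : ℝ)| ^ ν) ≤ ∫⁻ z : X, ENNReal.ofReal (|(z : ℝ)| ^ ν) ∂(P x) := by
  obtain ⟨hi, hl⟩ := tendsto_lyapunov_drift hα hc hT hD hν hνα he
  filter_upwards [hi, hl.eventually (lt_mem_nhds (mul_pos hν hpos)),
    (tendsto_abs_absAtTop (X := X)).eventually_gt_atTop 0] with x hix hlx hx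
  rw [← ofReal_integral_eq_lintegral_ofReal hix (Eventually.of_forall fun z => by positivity)]
  refine ENNReal.ofReal_le_ofReal ?_
  have := pos_of_mul_pos_right hlx (Real.rpow_nonneg hx.le _)
  linarith

/-- The bump `min (1, 4 (z - x)² / x²)` around `x`. -/
noncomputable def bump (x z : ℝ) : ℝ := min 1 (4 * (z - x) ^ 2 / x ^ 2)

/-- Put r = |z-y|/|x|. For r ≤ 1 this is the exact expansion of the square at y, with remainder 4r².
For r ≥ 1 the bump is at most 1 and the linear term is at least -4r, so 5r compensates. -/
lemma bump_le {x y z : ℝ} (hx : x ≠ 0) (hy : |y - x| < |x| / 2) :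
    bump x z ≤ bump x y + 8 * (y - x) * (z - y) / x ^ 2 +
      5 * min (|z - y| / |x|) ((|z - y| / |x|) ^ 2) := by
  have hx0 : 0 < |x| := abs_pos.2 hx
  have hxx : x ^ 2 = |x| ^ 2 := (sq_abs x).symm
  have hby : bump x y = 4 * (y - x) ^ 2 / x ^ 2 := by
    refine min_eq_right ?_
    rw [div_le_one (by positivity), hxx, ← sq_abs (y - x)]
    nlinarith [abs_nonneg (y - x)]
  rw [hby]
  set r := |z - y| / |x| with hr
  have hr0 : 0 ≤ r := by positivity
  rcases le_total r 1 with h | h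
  · rw [min_eq_right (by nlinarith : r ^ 2 ≤ r)]
    refine (min_le_right _ _).trans ?_
    have e : 4 * (z - x) ^ 2 / x ^ 2 = 4 * (y - x) ^ 2 / x ^ 2 + 8 * (y - x) * (z - y) / x ^ 2 +
        4 * r ^ 2 := by
      rw [hr, div_pow, sq_abs, sq_abs]; field_simp; ring
    rw [e]
    nlinarith
  · rw [min_eq_left (by nlinarith : r ≤ r ^ 2)]
    refine (min_le_left _ _).trans ?_
    have h1 : 0 ≤ 4 * (y - x) ^ 2 / x ^ 2 := by positivity
    have h2 : -(4 * r) ≤ 8 * (y - x) * (z - y) / x ^ 2 := by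
      have h3 : |8 * (y - x) * (z - y) / x ^ 2| ≤ 4 * r := by
        rw [abs_div, abs_mul, abs_mul, hxx, abs_of_pos (by positivity : (0 : ℝ) < |x| ^ 2), hr,
          abs_of_pos (by norm_num : (0 : ℝ) < 8), div_le_iff₀ (by positivity)]
        have : 4 * (|z - y| / |x|) * |x| ^ 2 = 4 * |z - y| * |x| := by field_simp
        rw [this]
        nlinarith [abs_nonneg (z - y)]
      exact (abs_le.1 h3).1
    linarith

lemma bump_nonneg (x z : ℝ) : 0 ≤ bump x z := le_min zero_le_one (by positivity)

/-- The bump around `x` grows by at most a multiple of `|x|^(-β)` per step. -/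
lemma exists_integral_bump_le (hα : α ∈ Ioo (1 : ℝ) 2) (hc : 0 < c) (hγ : 0 ≤ γ)
    (hγα : γ ≤ α - 1) (hT : BalancedTails P α c) (hD : AsymptoticDrift P γ b) :
    ∃ K > 0, ∃ A > 0, ∀ x y : X, A ≤ |(x : ℝ)| → |(y : ℝ) - x| < |(x : ℝ)| / 2 →
      ∫ z : X, bump x z ∂(P y) ≤ bump x y + K * |(x : ℝ)| ^ (-(γ + 1)) := by
  obtain ⟨hp, hn⟩ := hT.uniformTail
  obtain ⟨K₁, h1⟩ := exists_integral_min_le tendsto_abs_absAtTop hα.1 hα.2 hc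
    measurable_outward hp hn
  have h2 := (tendsto_integral_rpow_abs tendsto_abs_absAtTop hα.1 hα.2 hc
    measurable_outward hp hn one_pos hα.1).1
  have h3 := (continuous_abs.continuousAt.tendsto.comp hD.tendsto_outward).eventually
    (ge_mem_nhds (lt_add_one _))
  obtain ⟨A, hA⟩ := eventually_absAtTop.1 (h1.and (h2.and h3))
  set K₂ := |b| + 1 with hK₂
  have hK₂0 : 0 < K₂ := by positivity
  -- The first part comes from the mean increment: 4 = 8/2 as |y - x| < |x|/2, and 2^γ as |y| ≥
  -- |x|/2. The second is the truncated second moment: 5 from `bump_le`, 4 from replacing the scale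
  -- |x| by |y|, and 2^α from |y| ≥ |x|/2. Taking |x| ≥ 2A ensures |y| ≥ A.
  refine ⟨4 * (2 ^ γ * K₂) + 5 * (4 * (max K₁ 1 * 2 ^ α)), by positivity,
    max (2 * A) 1, by positivity, fun x y hx hxy => ?_⟩
  have hx1 : 1 ≤ |(x : ℝ)| := (le_max_right _ _).trans hx
  have hx0 : 0 < |(x : ℝ)| := by linarith
  have hylo : |(x : ℝ)| / 2 ≤ |(y : ℝ)| := by
    have := abs_sub_abs_le_abs_sub (x : ℝ) y
    rw [abs_sub_comm] at this
    linarith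
  have hyhi : |(y : ℝ)| ≤ 2 * |(x : ℝ)| := by
    have := abs_sub_abs_le_abs_sub (y : ℝ) x
    linarith
  have hy0 : 0 < |(y : ℝ)| := by linarith
  obtain ⟨⟨hmi, hml⟩, ⟨hoi, _⟩, hdr⟩ := hA y (by linarith [(le_max_left (2 * A) 1).trans hx])
  simp only [Function.comp_apply] at hdr
  -- integrability of the increment and its mean
  have hsub : Integrable (fun z : X => (z : ℝ) - y) (P y) := by
    rw [← integrable_norm_iff (by fun_prop)]
    refine hoi.norm.congr (Eventually.of_forall fun z => ?_)
    simp only [Real.norm_eq_abs, abs_outward]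
  have hmean : |∫ z : X, ((z : ℝ) - y) ∂(P y)| ≤ 2 ^ γ * K₂ * |(x : ℝ)| ^ (-γ) := by
    have e1 : |∫ z : X, ((z : ℝ) - y) ∂(P y)| = |∫ z, outward y z ∂(P y)| := by
      unfold outward
      split_ifs
      · rfl
      · rw [← abs_neg, ← integral_neg]; simp
    rw [abs_mul, abs_of_pos (by positivity : 0 < |(y : ℝ)| ^ γ)] at hdr
    rw [e1]
    have h4 : |(x : ℝ)| ^ γ ≤ 2 ^ γ * |(y : ℝ)| ^ γ := by
      rw [← Real.mul_rpow (by norm_num) hy0.le]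
      exact Real.rpow_le_rpow hx0.le (by linarith) hγ
    rw [Real.rpow_neg hx0.le, ← div_eq_mul_inv, le_div_iff₀ (by positivity)]
    have h5 : 0 ≤ |∫ z, outward y z ∂(P y)| := abs_nonneg _
    calc _ ≤ |∫ z, outward y z ∂(P y)| * (2 ^ γ * |(y : ℝ)| ^ γ) := by gcongr
      _ = 2 ^ γ * (|(y : ℝ)| ^ γ * |∫ z, outward y z ∂(P y)|) := by ring
      _ ≤ 2 ^ γ * K₂ := by gcongr
  -- truncated second moment, on the scale of `x` instead of `y`
  have hmin : ∀ z : X, min (|(z : ℝ) - y| / |(x : ℝ)|) ((|(z : ℝ) - y| / |(x : ℝ)|) ^ 2) ≤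
      4 * min (|outward y z| / |(y : ℝ)|) ((|outward y z| / |(y : ℝ)|) ^ 2) := by
    intro z
    rw [abs_outward]
    set d := |(z : ℝ) - y|
    have hd : 0 ≤ d := abs_nonneg _
    have h4 : d / |(x : ℝ)| ≤ 2 * (d / |(y : ℝ)|) := by
      rw [div_le_iff₀ hx0]
      have : 2 * (d / |(y : ℝ)|) * |(x : ℝ)| = d * (2 * |(x : ℝ)| / |(y : ℝ)|) := by ring
      rw [this]
      refine le_mul_of_one_le_right hd ?_
      rwa [one_le_div hy0]
    have h5 : 0 ≤ d / |(x : ℝ)| := by positivity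
    have h6 : 0 ≤ d / |(y : ℝ)| := by positivity
    rw [mul_min_of_nonneg _ _ (by norm_num : (0 : ℝ) ≤ 4)]
    refine min_le_min (by linarith) ?_
    nlinarith
  have hmi' : Integrable (fun z : X => min (|(z : ℝ) - y| / |(x : ℝ)|)
      ((|(z : ℝ) - y| / |(x : ℝ)|) ^ 2)) (P y) := by
    refine (hmi.const_mul 4).mono' (by fun_prop) (Eventually.of_forall fun z => ?_)
    rw [Real.norm_of_nonneg (by positivity)]
    exact hmin z
  have hmv : ∫ z : X, min (|(z : ℝ) - y| / |(x : ℝ)|) ((|(z : ℝ) - y| / |(x : ℝ)|) ^ 2) ∂(P y) ≤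
      4 * (max K₁ 1 * 2 ^ α) * |(x : ℝ)| ^ (-(γ + 1)) := by
    -- Since γ + 1 ≤ α and |x| ≥ 1, the jump term of order |x|^(-α) is absorbed into |x|^(-(γ+1)).
    have h4 : |(y : ℝ)| ^ (-α) ≤ 2 ^ α * |(x : ℝ)| ^ (-(γ + 1)) := by
      calc |(y : ℝ)| ^ (-α) ≤ (|(x : ℝ)| / 2) ^ (-α) :=
            Real.rpow_le_rpow_of_nonpos (by positivity) hylo (by linarith [hα.1])
        _ = 2 ^ α * |(x : ℝ)| ^ (-α) := by
            rw [Real.div_rpow hx0.le (by norm_num), Real.rpow_neg (by norm_num : (0 : ℝ) ≤ 2)]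
            field_simp
        _ ≤ _ := by
            refine mul_le_mul_of_nonneg_left ?_ (by positivity)
            exact Real.rpow_le_rpow_of_exponent_le hx1 (by linarith)
    calc _ ≤ ∫ z, 4 * min (|outward y z| / |(y : ℝ)|) ((|outward y z| / |(y : ℝ)|) ^ 2) ∂(P y) :=
          integral_mono hmi' (hmi.const_mul 4) hmin
      _ = 4 * ∫ z, min (|outward y z| / |(y : ℝ)|) ((|outward y z| / |(y : ℝ)|) ^ 2) ∂(P y) :=
          integral_const_mul _ _
      _ ≤ 4 * (max K₁ 1 * |(y : ℝ)| ^ (-α)) := by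
          gcongr
          exact hml.trans (by gcongr; exact le_max_left _ _)
      _ ≤ 4 * (max K₁ 1 * (2 ^ α * |(x : ℝ)| ^ (-(γ + 1)))) := by gcongr
      _ = _ := by ring
  have hx' : (x : ℝ) ≠ 0 := abs_pos.1 hx0
  have hlin : Integrable (fun z : X => 8 * ((y : ℝ) - x) * ((z : ℝ) - y) / (x : ℝ) ^ 2) (P y) :=
    (hsub.const_mul _).div_const _
  have hlinv : ∫ z : X, 8 * ((y : ℝ) - x) * ((z : ℝ) - y) / (x : ℝ) ^ 2 ∂(P y) ≤
      4 * (2 ^ γ * K₂) * |(x : ℝ)| ^ (-(γ + 1)) := by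
    rw [integral_div, integral_const_mul]
    refine (le_abs_self _).trans ?_
    rw [abs_div, abs_mul, abs_mul, ← sq_abs (x : ℝ), abs_of_pos (by positivity : 0 < |(x : ℝ)| ^ 2),
      abs_of_pos (by norm_num : (0 : ℝ) < 8), div_le_iff₀ (by positivity), neg_add,
      Real.rpow_add hx0, Real.rpow_neg_one]
    calc 8 * |(y : ℝ) - x| * |∫ z : X, ((z : ℝ) - y) ∂(P y)|
        ≤ 8 * (|(x : ℝ)| / 2) * (2 ^ γ * K₂ * |(x : ℝ)| ^ (-γ)) := by gcongr
      _ = _ := by field_simp; ring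
  have hbi : Integrable (fun z : X => bump x z) (P y) := by
    refine (integrable_const (1 : ℝ)).mono' ?_ (Eventually.of_forall fun z => ?_)
    · unfold bump; fun_prop
    · rw [Real.norm_of_nonneg (bump_nonneg _ _)]; exact min_le_left _ _
  have hconst := integrable_const (μ := P y) (bump x y)
  calc ∫ z : X, bump x z ∂(P y) ≤ ∫ z : X, (bump x y + 8 * ((y : ℝ) - x) * ((z : ℝ) - y) / (x : ℝ) ^ 2 +
        5 * min (|(z : ℝ) - y| / |(x : ℝ)|) ((|(z : ℝ) - y| / |(x : ℝ)|) ^ 2)) ∂(P y) :=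
        integral_mono hbi ((hconst.add hlin).add (hmi'.const_mul 5)) fun z => bump_le hx' hxy
    _ = bump x y + ∫ z : X, 8 * ((y : ℝ) - x) * ((z : ℝ) - y) / (x : ℝ) ^ 2 ∂(P y) +
        5 * ∫ z : X, min (|(z : ℝ) - y| / |(x : ℝ)|) ((|(z : ℝ) - y| / |(x : ℝ)|) ^ 2) ∂(P y) := by
        have hcl : Integrable (fun z : X => bump x y +
            8 * ((y : ℝ) - x) * ((z : ℝ) - y) / (x : ℝ) ^ 2) (P y) := hconst.add hlin
        rw [integral_add hcl (hmi'.const_mul 5), integral_add hconst hlin, integral_const_mul 5]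
        simp
    _ ≤ bump x y + 4 * (2 ^ γ * K₂) * |(x : ℝ)| ^ (-(γ + 1)) +
        5 * (4 * (max K₁ 1 * 2 ^ α) * |(x : ℝ)| ^ (-(γ + 1))) := by gcongr
    _ = _ := by ring

end Outward

/-- On a coarser scale the drift is invisible; with γ' = α - 1 this reduces the range γ > α - 1 to
the critical case with b = 0. -/
lemma AsymptoticDrift.of_lt {X : Set ℝ} {P : Kernel X X} {γ b : ℝ}
    (hD : AsymptoticDrift P γ b) {γ' : ℝ} (h : γ' < γ) :
    AsymptoticDrift P γ' 0 := by
  have hpos : Tendsto (fun x : ℝ => x ^ (γ' - γ)) atTop (𝓝 0) := by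
    simpa using tendsto_rpow_neg_atTop (y := γ - γ') (by linarith)
  constructor
  · have h1 := (hpos.comp (tendsto_comap (f := fun x : X => (x : ℝ)))).mul hD.1
    rw [zero_mul] at h1
    refine h1.congr' ?_
    filter_upwards [(tendsto_comap (f := fun x : X => (x : ℝ))).eventually_gt_atTop 0] with x hx
    simp only [Function.comp_apply]
    rw [← mul_assoc, ← Real.rpow_add hx, sub_add_cancel]
  · have h1 := (hpos.comp (tendsto_abs_atBot_atTop.comp
      (tendsto_comap (f := fun x : X => (x : ℝ))))).mul hD.2
    rw [zero_mul] at h1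
    refine h1.congr' ?_
    filter_upwards [(tendsto_comap (f := fun x : X => (x : ℝ))).eventually_lt_atBot 0] with x hx
    have hx0 : 0 < |(x : ℝ)| := abs_pos.2 hx.ne
    simp only [Function.comp_apply]
    rw [mul_neg, ← mul_assoc, ← Real.rpow_add hx0, sub_add_cancel]

/-! ### Passage-time moments of the chain. -/

section Moments

variable {X : Set ℝ} {P : Kernel X X} [IsMarkovKernel P] {α c γ b : ℝ}

/-- From `x` the chain stays away from the origin for a time of order `|x|^(γ + 1)`. -/
lemma exists_le_passageMoment (hα : α ∈ Ioo (1 : ℝ) 2) (hc : 0 < c) (hγ : 0 ≤ γ)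
    (hγα : γ ≤ α - 1) (hT : BalancedTails P α c) (hD : AsymptoticDrift P γ b) {q : ℝ} (hq : 0 < q) :
    ∃ c₁ > 0, ∃ A > 0, ∀ (a : ℝ) (x : X), A ≤ |(x : ℝ)| → 2 * a ≤ |(x : ℝ)| →
      ENNReal.ofReal (c₁ * |(x : ℝ)| ^ ((γ + 1) * q)) ≤ passageMoment P q a x := by
  obtain ⟨K, hK, A, hA, hbump⟩ := exists_integral_bump_le hα hc hγ hγα hT hD
  refine ⟨(1 / (4 * K)) ^ q / 2, by positivity, max A (max 1 (4 * K)), by positivity,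
    fun a x hx hxa => ?_⟩
  have hxA : A ≤ |(x : ℝ)| := (le_max_left _ _).trans hx
  have hx1 : 1 ≤ |(x : ℝ)| := ((le_max_left _ _).trans (le_max_right _ _)).trans hx
  have hxK : 4 * K ≤ |(x : ℝ)| := ((le_max_right _ _).trans (le_max_right _ _)).trans hx
  have hx0 : 0 < |(x : ℝ)| := by linarith
  have hone : ∀ z : ℝ, |(x : ℝ)| / 2 ≤ |z - x| → bump x z = 1 := by
    intro z hz
    have hx' : (x : ℝ) ≠ 0 := abs_pos.1 hx0
    refine min_eq_left ?_
    rw [one_le_div (by positivity), ← sq_abs (x : ℝ), ← sq_abs (z - x)]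
    nlinarith
  have hD' : ∀ y ∉ outside X a, 1 ≤ ENNReal.ofReal (bump x y) := by
    intro y hy
    have hy : |(y : ℝ)| ≤ a := not_lt.1 hy
    rw [hone y, ENNReal.ofReal_one]
    have := abs_sub_abs_le_abs_sub (x : ℝ) y
    rw [abs_sub_comm] at this
    linarith
  have hstep : ∀ y : X, ENNReal.ofReal (bump x y) < 1 →
      ∫⁻ z : X, ENNReal.ofReal (bump x z) ∂(P y) ≤
        ENNReal.ofReal (bump x y) + ENNReal.ofReal (K * |(x : ℝ)| ^ (-(γ + 1))) := by
    intro y hy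
    have hxy : |(y : ℝ) - x| < |(x : ℝ)| / 2 := by
      by_contra h
      rw [hone y (not_lt.1 h), ENNReal.ofReal_one] at hy
      exact lt_irrefl _ hy
    have hbi : Integrable (fun z : X => bump x z) (P y) := by
      refine (integrable_const (1 : ℝ)).mono' ?_ (Eventually.of_forall fun z => ?_)
      · unfold bump; fun_prop
      · rw [Real.norm_of_nonneg (bump_nonneg _ _)]; exact min_le_left _ _
    rw [← ofReal_integral_eq_lintegral_ofReal hbi (Eventually.of_forall fun z => bump_nonneg _ _),
      ← ENNReal.ofReal_add (bump_nonneg _ _) (by positivity)]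
    exact ENNReal.ofReal_le_ofReal (hbump x y hxA hxy)
  -- In N steps the mean of the bump grows by at most N K |x|^(-(γ+1)) ≤ 1/2, so the chain is still
  -- outside with probability at least 1/2. The requirement |x| ≥ 4K lets the floor lose at most
  -- half of its argument.
  set N := ⌊|(x : ℝ)| ^ (γ + 1) / (2 * K)⌋₊ with hN
  have hmain := one_le_killed_add (P := P) (measurableSet_outside a) hD' hstep N x
  have hxx : bump x x = 0 := by simp [bump]
  have hpow : |(x : ℝ)| ≤ |(x : ℝ)| ^ (γ + 1) := by
    have := Real.rpow_le_rpow_of_exponent_le hx1 (show (1 : ℝ) ≤ γ + 1 by linarith)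
    rwa [Real.rpow_one] at this
  have hpow0 : 0 < |(x : ℝ)| ^ (γ + 1) := by positivity
  have hNη : (N : ℝ≥0∞) * ENNReal.ofReal (K * |(x : ℝ)| ^ (-(γ + 1))) ≤ 1 / 2 := by
    rw [← ENNReal.ofReal_natCast, ← ENNReal.ofReal_mul (by positivity)]
    have h1 : (N : ℝ) * (K * |(x : ℝ)| ^ (-(γ + 1))) ≤ 1 / 2 := by
      have h2 : (N : ℝ) ≤ |(x : ℝ)| ^ (γ + 1) / (2 * K) := Nat.floor_le (by positivity)
      rw [Real.rpow_neg hx0.le]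
      calc (N : ℝ) * (K * (|(x : ℝ)| ^ (γ + 1))⁻¹)
          ≤ |(x : ℝ)| ^ (γ + 1) / (2 * K) * (K * (|(x : ℝ)| ^ (γ + 1))⁻¹) := by gcongr
        _ = 1 / 2 := by field_simp
    refine (ENNReal.ofReal_le_ofReal h1).trans_eq ?_
    rw [ENNReal.ofReal_div_of_pos two_pos]; simp
  have hhalf : 1 / 2 ≤ killed P (outside X a) (fun _ => 1) N x := by
    rw [hxx, ENNReal.ofReal_zero, add_zero] at hmain
    have h1 : (1 / 2 : ℝ≥0∞) + 1 / 2 ≤ killed P (outside X a) (fun _ => 1) N x + 1 / 2 := by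
      rw [ENNReal.add_halves]
      exact hmain.trans (by gcongr)
    exact (ENNReal.add_le_add_iff_right (by simp)).1 h1
  rw [passageMoment_eq_tsum P hq]
  refine le_trans ?_ (rpow_div_two_le_tsum_powIncr hq hhalf)
  have hNlow : 1 / (4 * K) * |(x : ℝ)| ^ (γ + 1) ≤ N := by
    have h1 := (Nat.lt_floor_add_one (|(x : ℝ)| ^ (γ + 1) / (2 * K))).le
    have h2 : |(x : ℝ)| ^ (γ + 1) / (2 * K) = 1 / (4 * K) * |(x : ℝ)| ^ (γ + 1) +
        |(x : ℝ)| ^ (γ + 1) / (4 * K) := by field_simp; norm_num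
    have h3 : 1 ≤ |(x : ℝ)| ^ (γ + 1) / (4 * K) := by
      rw [one_le_div (by positivity)]; exact hxK.trans hpow
    rw [← hN] at h1
    linarith
  have h1 : (1 / (4 * K)) ^ q / 2 * |(x : ℝ)| ^ ((γ + 1) * q) =
      (1 / (4 * K) * |(x : ℝ)| ^ (γ + 1)) ^ q / 2 := by
    rw [Real.mul_rpow (by positivity) (by positivity), ← Real.rpow_mul hx0.le]; ring
  rw [h1, ENNReal.ofReal_div_of_pos two_pos, ← ENNReal.ofReal_rpow_of_nonneg (by positivity) hq.le]
  simp only [ENNReal.ofReal_ofNat]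
  gcongr
  rw [← ENNReal.ofReal_natCast]
  exact ENNReal.ofReal_le_ofReal hNlow

lemma one_le_passageMoment {q : ℝ} (hq : 0 < q) {a : ℝ} {x : X} (hx : a < |(x : ℝ)|) :
    1 ≤ passageMoment P q a x := by
  rw [passageMoment_eq_tsum P hq]
  refine le_trans ?_ (ENNReal.le_tsum 0)
  have hx : x ∈ outside X a := hx
  simp [powIncr, killed_zero, hx, Real.zero_rpow hq.ne']

/-- Infinite moments when `|x|^ν` is a submartingale outside a bounded set. -/
lemma passageMoment_eq_top_of_submartingale (hα : α ∈ Ioo (1 : ℝ) 2) (hc : 0 < c) (hγ : 0 ≤ γ)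
    (hγα : γ ≤ α - 1) (hT : BalancedTails P α c) (hD : AsymptoticDrift P γ b) {q ν a : ℝ}
    (hq : 0 < q) (hν : 0 < ν) (hνq : ν ≤ (γ + 1) * q) (ha : 0 ≤ a)
    (hsub : ∀ x : X, a < |(x : ℝ)| →
      ENNReal.ofReal (|(x : ℝ)| ^ ν) ≤ ∫⁻ z : X, ENNReal.ofReal (|(z : ℝ)| ^ ν) ∂(P x))
    {x : X} (hx : a < |(x : ℝ)|) : passageMoment P q a x = ∞ := by
  obtain ⟨c₁, hc₁, A, hA, hlow⟩ := exists_le_passageMoment hα hc hγ hγα hT hD hq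
  set B := max (max A (2 * a)) 1 with hB
  have hB0 : 0 < B := by positivity
  rw [passageMoment_eq_tsum P hq]
  -- Truncated subtraction in `ℝ≥0∞` makes v = (|x|^ν - a^ν)⁺, which vanishes inside and is still a
  -- submartingale outside. In the constant, c₁⁻¹ serves |y| ≥ B through the lower bound on moments,
  -- and B^ν serves |y| ≤ B, where the moment is at least 1.
  refine tsum_powIncr_killed_eq_top (measurableSet_outside a) hq
    (v := fun x : X => ENNReal.ofReal (|(x : ℝ)| ^ ν - a ^ ν))
    (C := ENNReal.ofReal (c₁⁻¹ + B ^ ν)) (fun y hy => ?_) (fun y hy => ?_) ENNReal.ofReal_ne_top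
    (fun y hy => ?_) ?_
  · have hy : |(y : ℝ)| ≤ a := not_lt.1 hy
    rw [ENNReal.ofReal_eq_zero]
    linarith [Real.rpow_le_rpow (abs_nonneg (y : ℝ)) hy hν.le]
  · rw [ENNReal.ofReal_sub _ (by positivity), tsub_le_iff_right]
    calc ENNReal.ofReal (|(y : ℝ)| ^ ν) ≤ ∫⁻ z : X, ENNReal.ofReal (|(z : ℝ)| ^ ν) ∂(P y) := hsub y hy
      _ ≤ ∫⁻ z : X, (ENNReal.ofReal (|(z : ℝ)| ^ ν - a ^ ν) + ENNReal.ofReal (a ^ ν)) ∂(P y) := by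
          refine lintegral_mono fun z => ?_
          refine le_trans (ENNReal.ofReal_le_ofReal ?_) ENNReal.ofReal_add_le
          linarith
      _ = _ := by rw [lintegral_add_right _ measurable_const]; simp
  · rw [← passageMoment_eq_tsum P hq]
    have hanu : 0 ≤ a ^ ν := by positivity
    rcases le_total B |(y : ℝ)| with h | h
    · have hy1 : 1 ≤ |(y : ℝ)| := (le_max_right _ _).trans h
      have h1 := hlow a y (((le_max_left _ _).trans (le_max_left _ _)).trans h)
        (((le_max_right _ _).trans (le_max_left _ _)).trans h)
      calc ENNReal.ofReal (|(y : ℝ)| ^ ν - a ^ ν)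
          ≤ ENNReal.ofReal ((c₁⁻¹ + B ^ ν) * (c₁ * |(y : ℝ)| ^ ((γ + 1) * q))) := by
            refine ENNReal.ofReal_le_ofReal ?_
            have h2 : |(y : ℝ)| ^ ν ≤ |(y : ℝ)| ^ ((γ + 1) * q) :=
              Real.rpow_le_rpow_of_exponent_le hy1 hνq
            have h3 : (c₁⁻¹ + B ^ ν) * (c₁ * |(y : ℝ)| ^ ((γ + 1) * q)) =
                |(y : ℝ)| ^ ((γ + 1) * q) + B ^ ν * c₁ * |(y : ℝ)| ^ ((γ + 1) * q) := by
              field_simp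
            have h4 : 0 ≤ B ^ ν * c₁ * |(y : ℝ)| ^ ((γ + 1) * q) := by positivity
            linarith
        _ ≤ _ := by
            rw [ENNReal.ofReal_mul (by positivity)]
            gcongr
    · calc ENNReal.ofReal (|(y : ℝ)| ^ ν - a ^ ν) ≤ ENNReal.ofReal (c₁⁻¹ + B ^ ν) * 1 := by
            rw [mul_one]
            refine ENNReal.ofReal_le_ofReal ?_
            have h2 : |(y : ℝ)| ^ ν ≤ B ^ ν := Real.rpow_le_rpow (abs_nonneg _) h hν.le
            have h3 : 0 < c₁⁻¹ := by positivity
            linarith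
        _ ≤ _ := by
            gcongr
            exact one_le_passageMoment hq hy
  · simp only [ne_eq, ENNReal.ofReal_eq_zero, not_le, sub_pos]
    exact Real.rpow_lt_rpow ha hx hν

/-- By the layer-cake formula the moment dominates a multiple of ∫ t^(s-1-α) dt near ∞, which
diverges as s ≥ α. -/
lemma lintegral_rpow_abs_eq_top {x : X} {Y s : ℝ} (hc : 0 < c) (hα : 0 < α) (hs : α ≤ s)
    (h : ∀ y ≥ Y, c * y ^ (-α) ≤ (P x).real {z : X | y < |(z : ℝ)|}) :
    ∫⁻ z : X, ENNReal.ofReal (|(z : ℝ)| ^ s) ∂(P x) = ∞ := by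
  rw [lintegral_rpow_eq_lintegral_meas_lt_mul (P x) (Eventually.of_forall fun z => abs_nonneg _)
    (by fun_prop) (hα.trans_le hs)]
  refine ENNReal.mul_eq_top.2 (Or.inl ⟨by simpa using hα.trans_le hs, ?_⟩)
  set B := max Y 1
  have hB : 0 < B := by positivity
  rw [← top_le_iff]
  have htop : ∫⁻ t in Ioi B, ENNReal.ofReal (c * t ^ (s - 1 - α)) = ∞ := by
    by_contra hfin
    have hi : IntegrableOn (fun t : ℝ => c * t ^ (s - 1 - α)) (Ioi B) := by
      refine ⟨Measurable.aestronglyMeasurable (by fun_prop), ?_⟩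
      rw [hasFiniteIntegral_iff_ofReal]
      · exact lt_top_iff_ne_top.2 hfin
      · refine ae_restrict_of_forall_mem measurableSet_Ioi fun t ht => ?_
        have : 0 < t := hB.trans ht
        simp only [Pi.zero_apply]
        positivity
    have h1 := hi.const_mul c⁻¹
    have h2 : (fun t : ℝ => c⁻¹ * (c * t ^ (s - 1 - α))) = fun t => t ^ (s - 1 - α) := by
      ext t; field_simp
    rw [h2] at h1
    have := (integrableOn_Ioi_rpow_iff hB).1 h1
    linarith
  rw [← htop]
  refine le_trans ?_ (lintegral_mono_set (Ioi_subset_Ioi hB.le))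
  refine setLIntegral_mono' measurableSet_Ioi fun t ht => ?_
  have ht0 : 0 < t := hB.trans ht
  have h1 := h t ((le_max_left Y 1).trans (le_of_lt ht))
  have h2 : c * t ^ (s - 1 - α) = c * t ^ (-α) * t ^ (s - 1) := by
    rw [mul_assoc, ← Real.rpow_add ht0]; congr 2; ring
  rw [h2, ENNReal.ofReal_mul (by positivity)]
  gcongr
  rw [← ofReal_measureReal]
  exact ENNReal.ofReal_le_ofReal h1

/-- One big jump makes the moments of order at least `α / (γ + 1)` infinite. -/
lemma eventually_passageMoment_eq_top (hα : α ∈ Ioo (1 : ℝ) 2) (hc : 0 < c) (hγ : 0 ≤ γ)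
    (hγα : γ ≤ α - 1) (hT : BalancedTails P α c) (hD : AsymptoticDrift P γ b) {q : ℝ}
    (hq : α / (γ + 1) ≤ q) :
    ∀ᶠ a : ℝ in atTop, ∀ x : X, a < |(x : ℝ)| → passageMoment P q a x = ∞ := by
  have hβ : 0 < γ + 1 := by linarith
  -- As γ + 1 ≤ α, these orders are at least 1, which `lintegral_tsum_powIncr_le` requires.
  have hq1 : 1 ≤ q := le_trans ((one_le_div hβ).2 (by linarith)) hq
  have hs : α ≤ (γ + 1) * q := by rwa [div_le_iff₀' hβ] at hq
  obtain ⟨c₁, hc₁, A, hA, hlow⟩ := exists_le_passageMoment hα hc hγ hγα hT hD (q := q) (by linarith)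
  obtain ⟨Y, hY⟩ := hT.uniformTail.1 (c / 2) (by positivity)
  obtain ⟨A', hA'⟩ := eventually_absAtTop.1 hY
  filter_upwards [eventually_ge_atTop A', eventually_ge_atTop 0] with a ha ha0 x hx
  have htail := hA' x (ha.trans hx.le)
  have hinf : ∫⁻ z : X, ENNReal.ofReal (|(z : ℝ)| ^ ((γ + 1) * q)) ∂(P x) = ∞ := by
    refine lintegral_rpow_abs_eq_top (c := c / 2) (Y := max Y 1) (by positivity)
      (by linarith [hα.1]) hs fun y hy => ?_
    have hy0 : 0 < y := lt_of_lt_of_le one_pos ((le_max_right _ _).trans hy)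
    have h1 := (abs_le.1 (htail y ((le_max_left _ _).trans hy))).1
    have h2 : c / 2 * y ^ (-α) ≤ (P x).real {z | y < (outward x z)⁺} := by
      rw [Real.rpow_neg hy0.le, ← div_eq_mul_inv, div_le_iff₀ (by positivity)]
      linarith
    refine h2.trans (measureReal_mono fun z hz => ?_)
    have hz : y < (outward x z)⁺ := hz
    have h3 : y < outward x z := by
      rcases le_total (outward x z) 0 with h | h
      · rw [posPart_eq_zero.2 h] at hz; linarith
      · rwa [posPart_of_nonneg h] at hz
    have hx0 : 0 < |(x : ℝ)| := by linarith
    have h4 := abs_one_add_outward_div hx0 z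
    have h5 : 0 < outward x z / |(x : ℝ)| := div_pos (by linarith) hx0
    rw [abs_of_pos (by linarith), eq_div_iff hx0.ne', add_mul, div_mul_cancel₀ _ hx0.ne'] at h4
    simp only [mem_ofPred_eq]
    linarith
  set B := max A (2 * a)
  have hB0 : 0 < B := by positivity
  -- The additive constant covers |z| ≤ B; being finite, it cannot account for the infinite integral
  -- after one jump.
  have hM : ∀ z : X, ENNReal.ofReal c₁ * ENNReal.ofReal (|(z : ℝ)| ^ ((γ + 1) * q)) ≤
      passageMoment P q a z + ENNReal.ofReal (c₁ * B ^ ((γ + 1) * q)) := by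
    intro z
    rw [← ENNReal.ofReal_mul hc₁.le]
    rcases le_total B |(z : ℝ)| with h | h
    · exact (hlow a z ((le_max_left _ _).trans h) ((le_max_right _ _).trans h)).trans le_self_add
    · refine le_trans (ENNReal.ofReal_le_ofReal ?_) le_add_self
      gcongr
  have hle := lintegral_tsum_powIncr_le (P := P) (measurableSet_outside a) hq1 (x := x) hx
  simp_rw [← passageMoment_eq_tsum P (show 0 < q by linarith)] at hle
  rw [← top_le_iff]
  refine le_trans ?_ hle
  have h1 := lintegral_mono (μ := P x) hM
  rw [lintegral_const_mul _ (by fun_prop), hinf, ENNReal.mul_top (by simpa using hc₁),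
    lintegral_add_right _ measurable_const, top_le_iff, ENNReal.add_eq_top] at h1
  rcases h1 with h1 | h1
  · exact h1.ge
  · simp at h1

/-- Finite moments when the Lyapunov function `|x|^ν` decreases on average outside a bounded set. -/
lemma eventually_passageMoment_lt_top {β ν q ε : ℝ} (hβ : 0 < β) (hν : 0 < ν)
    (hε : 0 < ε) (hq : 0 < q) (hqν : q < ν / β ∨ 1 ≤ ν / β ∧ q ≤ ν / β)
    (h : ∀ᶠ x : X in absAtTop X, ∫⁻ z : X, ENNReal.ofReal (|(z : ℝ)| ^ ν) ∂(P x) +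
      ENNReal.ofReal (ε * |(x : ℝ)| ^ (ν - β)) ≤ ENNReal.ofReal (|(x : ℝ)| ^ ν)) :
    ∀ᶠ a : ℝ in atTop, ∀ x : X, passageMoment P q a x < ∞ := by
  obtain ⟨A, hA⟩ := eventually_absAtTop.1 h
  filter_upwards [eventually_ge_atTop A, eventually_ge_atTop 0] with a ha ha0 x
  have hpos : ∀ y ∈ outside X a, 0 < |(y : ℝ)| := fun y hy => ha0.trans_lt hy
  have hdec : ∀ y ∈ outside X a, ∫⁻ z : X, ENNReal.ofReal (|(z : ℝ)| ^ ν) ∂(P y) +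
      ENNReal.ofReal (ε * |(y : ℝ)| ^ (ν - β)) ≤ ENNReal.ofReal (|(y : ℝ)| ^ ν) :=
    fun y hy => hA y (ha.trans (le_of_lt hy))
  rw [passageMoment_eq_tsum P hq]
  rcases lt_or_ge ν β with h1 | h1
  · have hq' : q < ν / β := by
      rcases hqν with h2 | h2
      · exact h2
      · exact absurd ((one_le_div hβ).1 h2.1) (not_le.2 h1)
    exact tsum_powIncr_killed_lt_top_of_lt_one (measurableSet_outside a) (by fun_prop) hpos hν h1 hε
      hq' hdec x
  · exact tsum_powIncr_killed_lt_top_of_one_le (measurableSet_outside a) (by fun_prop)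
      (fun y => abs_nonneg _) hpos hβ h1 hε (hqν.elim le_of_lt And.right) hdec x

/-- Unboundedness of X makes the filter |x| → ∞ nontrivial, which the probabilistic proof of strict
monotonicity needs. The sign of the drift of |x|^ν₁ is then that of `criticalFun α ν - criticalFun α
ν₁`. -/
lemma critical_case (hXunb : ¬ Bornology.IsBounded X) (hα : α ∈ Ioo (1 : ℝ) 2) (hc : 0 < c)
    (hT : BalancedTails P α c) (hD : AsymptoticDrift P (α - 1) b)
    (hb : b + c * Real.pi * Real.cot (Real.pi * α / 2) < 0) :
    ∃ ν ∈ Ioo (0 : ℝ) α, (∀ ν' ∈ Ioo (0 : ℝ) α, b / c = criticalFun α ν' ↔ ν' = ν) ∧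
      ∀ q : ℝ, 0 < q → ∀ᶠ a : ℝ in atTop, ∀ x : X, a < |(x : ℝ)| →
        (q < ν / α → passageMoment P q a x < ∞) ∧ (ν / α < q → passageMoment P q a x = ∞) := by
  have := absAtTop_neBot hXunb
  have hα0 : 0 < α := by linarith [hα.1]
  obtain ⟨hp, hn⟩ := hT.uniformTail
  have hanti : ∀ ν₁ ν₂, 0 < ν₁ → ν₁ < ν₂ → ν₂ < α → criticalFun α ν₂ < criticalFun α ν₁ :=
    fun ν₁ ν₂ h1 h12 h2 => criticalFun_lt (tendsto_abs_absAtTop (X := X)) hα.1 hα.2 hc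
      measurable_outward hp hn h1 h12 h2
  obtain ⟨ν, hν, hνb⟩ := exists_criticalFun_eq hα.1 hα.2 (y := b / c) (by
    have h1 : b / c + Real.pi * Real.cot (Real.pi * α / 2) =
        (b + c * Real.pi * Real.cot (Real.pi * α / 2)) / c := by field_simp
    rw [h1]
    exact div_neg_of_neg_of_pos hb hc)
  have he : Tendsto (fun x : X => |(x : ℝ)| ^ (α - 1 + 1 - α)) (absAtTop X) (𝓝 1) := by
    simp
  refine ⟨ν, hν, fun ν' hν' => ⟨fun h => ?_, fun h => by rw [h, hνb]⟩, fun q hq => ?_⟩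
  · rw [← hνb] at h
    rcases lt_trichotomy ν' ν with hlt | heq | hlt
    · exact absurd h (hanti ν' ν hν'.1 hlt hν.2).ne
    · exact heq
    · exact absurd h (hanti ν ν' hν.1 hlt hν'.2).ne'
  · have hbc : b = c * criticalFun α ν := by rw [hνb]; field_simp
    have hfin : q < ν / α → ∀ᶠ a : ℝ in atTop, ∀ x : X, passageMoment P q a x < ∞ := by
      intro hqν
      rw [lt_div_iff₀ hα0] at hqν
      -- An exponent with qα < ν₁ < ν: small enough for strict decrease, large enough to reach
      -- moments of order q.
      obtain ⟨ν₁, h1, h2⟩ := exists_between hqν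
      have hν₁ : 0 < ν₁ := (mul_pos hq hα0).trans h1
      obtain ⟨ε, hε, h⟩ := eventually_lyapunov_decrease hα hc hT hD hν₁ (h2.trans hν.2) he (by
        rw [hbc, one_mul, ← mul_sub]
        exact mul_neg_of_pos_of_neg hc (sub_neg.2 (hanti ν₁ ν hν₁ h2 hν.2)))
      rw [sub_add_cancel] at h
      exact eventually_passageMoment_lt_top hα0 hν₁ hε hq (Or.inl ((lt_div_iff₀ hα0).2 h1)) h
    have hinf : ν / α < q → ∀ᶠ a : ℝ in atTop, ∀ x : X, a < |(x : ℝ)| →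
        passageMoment P q a x = ∞ := by
      intro hqν
      rw [div_lt_iff₀ hα0] at hqν
      -- An exponent with ν < ν₁ < min(qα, α): above ν for the submartingale property, below qα to
      -- be dominated by the moment, below α for integrability.
      obtain ⟨ν₁, h1, h2⟩ := exists_between (lt_min hqν hν.2)
      have hν₁ : 0 < ν₁ := hν.1.trans h1
      obtain ⟨A, hA⟩ := eventually_absAtTop.1 (eventually_lyapunov_increase hα hc hT hD hν₁
        (h2.trans_le (min_le_right _ _)) he (by
          rw [hbc, one_mul, ← mul_sub]
          exact mul_pos hc (sub_pos.2 (hanti ν ν₁ hν.1 h1 (h2.trans_le (min_le_right _ _))))))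
      filter_upwards [eventually_ge_atTop A, eventually_ge_atTop 0] with a ha ha0 x hx
      exact passageMoment_eq_top_of_submartingale hα hc (by linarith [hα.1]) le_rfl hT hD hq hν₁
        (by rw [sub_add_cancel, mul_comm]; exact (h2.trans_le (min_le_left _ _)).le) ha0
        (fun y hy => hA y (ha.trans hy.le)) hx
    by_cases h1 : q < ν / α
    · filter_upwards [hfin h1] with a ha x hx
      exact ⟨fun _ => ha x, fun h => absurd h h1.not_gt⟩
    · by_cases h2 : ν / α < q
      · filter_upwards [hinf h2] with a ha x hx
        exact ⟨fun h => absurd h h1, fun _ => ha x hx⟩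
      · exact Eventually.of_forall fun a x hx => ⟨fun h => absurd h h1, fun h => absurd h h2⟩

end Moments

end HeavyTailWalk

/-! ### The three drift regimes. -/

theorem theorem2p8 (X : Set ℝ) (hX : MeasurableSet X) (hXunb : ¬ Bornology.IsBounded X)
    (P : Kernel X X) [IsMarkovKernel P]
    (α c γ b : ℝ) (hα : α ∈ Ioo (1 : ℝ) 2) (hc : 0 < c) (hγ : 0 ≤ γ)
    (hT : HeavyTailWalk.BalancedTails P α c) (hD : HeavyTailWalk.AsymptoticDrift P γ b) :
    (α - 1 < γ →
      ∀ q : ℝ, 0 < q → ∀ᶠ a : ℝ in atTop, ∀ x : X, a < |(x : ℝ)| →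
        (q < 1 - 1 / α → HeavyTailWalk.passageMoment P q a x < ∞) ∧
        (1 - 1 / α < q → HeavyTailWalk.passageMoment P q a x = ∞)) ∧
    (γ = α - 1 → b + c * Real.pi * Real.cot (Real.pi * α / 2) < 0 →
      ∃ ν ∈ Ioo (0 : ℝ) α,
        (∀ ν' ∈ Ioo (0 : ℝ) α, b / c = HeavyTailWalk.criticalFun α ν' ↔ ν' = ν) ∧
        ∀ q : ℝ, 0 < q → ∀ᶠ a : ℝ in atTop, ∀ x : X, a < |(x : ℝ)| →
          (q < ν / α → HeavyTailWalk.passageMoment P q a x < ∞) ∧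
          (ν / α < q → HeavyTailWalk.passageMoment P q a x = ∞)) ∧
    (γ < α - 1 → b < 0 →
      ∀ q : ℝ, 0 < q → ∀ᶠ a : ℝ in atTop, ∀ x : X, a < |(x : ℝ)| →
        (q < α / (γ + 1) → HeavyTailWalk.passageMoment P q a x < ∞) ∧
        (α / (γ + 1) ≤ q → HeavyTailWalk.passageMoment P q a x = ∞)) := by
  open HeavyTailWalk in
  have hα0 : 0 < α := by linarith [hα.1]
  refine ⟨fun h q hq => ?_, fun h hb => ?_, fun h hb q hq => ?_⟩
  · have hcot : Real.cot (Real.pi * α / 2) < 0 := by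
      have hπ := Real.pi_pos
      rw [Real.cot_eq_cos_div_sin]
      refine div_neg_of_neg_of_pos (Real.cos_neg_of_pi_div_two_lt_of_lt ?_ ?_)
        (Real.sin_pos_of_pos_of_lt_pi ?_ ?_) <;> nlinarith [hα.1, hα.2]
    -- The critical case with b = 0 applies because cot(πα/2) < 0 for πα/2 in (π/2, π). Uniqueness
    -- identifies its root with α - 1.
    obtain ⟨ν, -, huniq, hmain⟩ := critical_case hXunb hα hc hT (hD.of_lt h) (by
      have := mul_neg_of_pos_of_neg (mul_pos hc Real.pi_pos) hcot
      linarith)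
    have hν : α - 1 = ν := (huniq (α - 1) ⟨by linarith [hα.1], by linarith⟩).1 (by
      rw [criticalFun_sub_one hα.1 hα.2, zero_div])
    have e : 1 - 1 / α = ν / α := by rw [← hν]; field_simp
    rw [e]
    exact hmain q hq
  · subst h
    exact critical_case hXunb hα hc hT hD hb
  · have hβ : 0 < γ + 1 := by linarith
    rcases lt_or_ge q (α / (γ + 1)) with h1 | h1
    · have hp : max q 1 < α / (γ + 1) := max_lt h1 ((one_lt_div hβ).2 (by linarith))
      have hν : 0 < (γ + 1) * max q 1 := by positivity
      have e1 : (γ + 1) * max q 1 / (γ + 1) = max q 1 := by field_simp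
      have he : Tendsto (fun x : X => |(x : ℝ)| ^ (γ + 1 - α)) (absAtTop X) (𝓝 0) := by
        have := (tendsto_rpow_neg_atTop (y := α - (γ + 1)) (by linarith)).comp
          (tendsto_abs_absAtTop (X := X))
        simpa [Function.comp_def] using this
      obtain ⟨ε, hε, hdec⟩ := eventually_lyapunov_decrease hα hc hT hD hν
        (by rwa [lt_div_iff₀' hβ] at hp) he (by simpa using hb)
      filter_upwards [eventually_passageMoment_lt_top hβ hν hε hq
        (Or.inr (by rw [e1]; exact ⟨le_max_right _ _, le_max_left _ _⟩)) hdec] with a ha x hx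
      exact ⟨fun _ => ha x, fun h2 => absurd h1 (not_lt.2 h2)⟩
    · filter_upwards [eventually_passageMoment_eq_top hα hc hγ h.le hT hD h1] with a ha x hx
      exact ⟨fun h2 => absurd h2 (not_lt.2 h1), fun _ => ha x hx⟩
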